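/- Let $X$ be a smooth compact Riemannian manifold of dimension $n$ (without boundary), let $E$ be a smooth Euclidean vector bundle over $X$, and let $A$ be a smooth connection on $E$. Fix a radius $R>0$ (for instance, half of the injectivity radius of $X$). For $d\in\mathbb R$, $p\in[1,\infty)$ and a measurable function $f$ on $X$ put $$\|f\|_{L^p_d(X)}^p=\|f\|_{L^p(X)}^p+\sup_{\rho\in(0,R]}\ \sup_{x\in X}\ \rho^{d-n}\,\|f\|_{L^p(B_\rho(x))}^p ,$$ where $B_\rho(x)$ is the geodesic ball and $L^p$ refers to the Riemannian volume measure. Let $L^p_d(X,E)$ be the normed space of all measurable sections $s$ of $E$ (modulo equality almost everywhere) with finite norm $\|s\|_{L^p_d(X,E)}=\bigl\|\,|s|\,\bigr\|_{L^p_d(X)}$. Let $L^{1,p}_d(X,E)$ be the normed space of all sections $s\in L^p_d(X,E)$ whose weak covariant derivative $\nabla_A s$ exists and for which the norm $$\|s\|_{L^{1,p}_{d,A}(X,E)}=\Bigl(\bigl\|\,|s|\,\bigr\|_{L^p_d(X)}^p+\bigl\|\,|\nabla_A s|\,\bigr\|_{L^p_d(X)}^p\Bigr)^{1/p}$$ is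 finite, where $|\nabla_A s|$ is the pointwise Euclidean norm in $T^*X\otimes E$. Let $d\in(0,n)$, $p\in(1,d)$, define $p^*$ by $1/p^*=1/p-1/d$, and let $q\in[1,p^*)$. Then $L^{1,p}_d(X,E)\subset L^q_d(X,E)$, and the inclusion map $L^{1,p}_d(X,E)\to L^q_d(X,E)$ is an injective bounded linear map that is compact. -/

import Mathlib

open Bundle Manifold MeasureTheory Set
open scoped ENNReal ContDiff Topology

set_option linter.unusedSectionVars false

noncomputable section

namespace Morrey

/-! ### The Euclidean norm on `V* ⊗ W` -/

section HilbertSchmidt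

variable {V W : Type*} [NormedAddCommGroup V] [InnerProductSpace ℝ V] [FiniteDimensional ℝ V]
  [NormedAddCommGroup W] [InnerProductSpace ℝ W]

/-- The Euclidean (Hilbert-Schmidt) norm of `T ∈ V* ⊗ W = Hom(V, W)`: the square root of
`∑ i, |T bᵢ|²` for an orthonormal basis `b` of `V`. -/
def hsNorm (T : V →L[ℝ] W) : ℝ :=
  √(∑ i, ‖T (stdOrthonormalBasis ℝ V i)‖ ^ 2)

lemma hsNorm_eq (T : V →L[ℝ] W) :
    hsNorm T = ‖WithLp.toLp 2 (fun i => T (stdOrthonormalBasis ℝ V i))‖ := by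
  rw [PiLp.norm_eq_of_L2, hsNorm]

lemma hsNorm_nonneg (T : V →L[ℝ] W) : 0 ≤ hsNorm T := Real.sqrt_nonneg _

lemma hsNorm_zero : hsNorm (0 : V →L[ℝ] W) = 0 := by simp [hsNorm]

lemma hsNorm_add_le (S T : V →L[ℝ] W) : hsNorm (S + T) ≤ hsNorm S + hsNorm T := by
  simp only [hsNorm_eq]
  exact norm_add_le (WithLp.toLp 2 (fun i => S (stdOrthonormalBasis ℝ V i)))
    (WithLp.toLp 2 (fun i => T (stdOrthonormalBasis ℝ V i)))

lemma hsNorm_smul (c : ℝ) (T : V →L[ℝ] W) : hsNorm (c • T) = |c| * hsNorm T := by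
  simp only [hsNorm_eq]
  exact norm_smul c (WithLp.toLp 2 (fun i => T (stdOrthonormalBasis ℝ V i)))

/-- The Hilbert-Schmidt norm in an arbitrary basis `f` with Gram matrix `G`:
`|T|² = ∑ᵢⱼ (G⁻¹)ᵢⱼ ⟨T fᵢ, T fⱼ⟩`. -/
lemma hsNorm_sq_eq {ι : Type*} [Fintype ι] [DecidableEq ι] (f : Module.Basis ι ℝ V)
    (T : V →L[ℝ] W) :
    hsNorm T ^ 2 = ∑ i, ∑ j, ((Matrix.of fun i j => (inner ℝ (f i) (f j) : ℝ))⁻¹ i j) *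
      inner ℝ (T (f i)) (T (f j)) := by
  set b := stdOrthonormalBasis ℝ V with hb
  set P : Matrix (Fin (Module.finrank ℝ V)) ι ℝ := Matrix.of fun k i => f.repr (b k) i with hP
  set Q : Matrix (Fin (Module.finrank ℝ V)) ι ℝ := Matrix.of fun k i => inner ℝ (b k) (f i) with hQ
  set G : Matrix ι ι ℝ := Matrix.of fun i j => (inner ℝ (f i) (f j) : ℝ) with hG
  have hbk : ∀ k, b k = ∑ i, P k i • f i := fun k => (f.sum_repr (b k)).symm
  have h1 : P * Q.transpose = 1 := by
    ext k l
    have h := congrArg (fun v => (inner ℝ (b l) v : ℝ)) (hbk k)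
    simp only [inner_sum, inner_smul_right] at h
    rw [Matrix.mul_apply, Matrix.one_apply]
    simp only [Matrix.transpose_apply]
    rw [show ∑ j, P k j * Q l j = inner ℝ (b l) (b k) from h.symm]
    rw [orthonormal_iff_ite.mp b.orthonormal]
    simp [eq_comm]
  have h2 : Q.transpose * P = 1 := by
    ext i j
    have h := b.sum_repr' (f i)
    have h' := congrArg (fun v => f.repr v j) h
    simp only [map_sum, map_smul, Finsupp.coe_finsetSum, Finset.sum_apply, Finsupp.smul_apply,
      smul_eq_mul, Module.Basis.repr_self] at h'
    rw [Matrix.mul_apply, Matrix.one_apply]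
    simp only [Matrix.transpose_apply]
    rw [show ∑ k, Q k i * P k j = Finsupp.single i 1 j from h', Finsupp.single_apply]
  have h3 : G = Q.transpose * Q := by
    ext i j
    rw [Matrix.mul_apply]
    simp only [Matrix.transpose_apply, hQ, hG, Matrix.of_apply]
    rw [← b.sum_inner_mul_inner (f i) (f j)]
    exact Finset.sum_congr rfl fun k _ => by rw [real_inner_comm]
  have h4 : G⁻¹ = P.transpose * P := by
    apply Matrix.inv_eq_left_inv
    rw [h3, Matrix.mul_assoc, ← Matrix.mul_assoc P, h1, Matrix.one_mul]
    have := congrArg Matrix.transpose h2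
    simpa [Matrix.transpose_mul] using this
  rw [h4, hsNorm, Real.sq_sqrt (Finset.sum_nonneg fun _ _ => sq_nonneg _)]
  simp only [Matrix.mul_apply, Matrix.transpose_apply, Finset.sum_mul]
  have h5 : ∀ k, ‖T (b k)‖ ^ 2 = ∑ i, ∑ j, P k i * P k j * inner ℝ (T (f i)) (T (f j)) := by
    intro k
    rw [← real_inner_self_eq_norm_sq, hbk k, map_sum, sum_inner]
    refine Finset.sum_congr rfl fun i _ => ?_
    rw [inner_sum]
    refine Finset.sum_congr rfl fun j _ => ?_
    rw [map_smul, map_smul, real_inner_smul_left, real_inner_smul_right]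
    ring
  rw [Finset.sum_congr rfl fun k _ => h5 k, Finset.sum_comm]
  exact Finset.sum_congr rfl fun i _ => Finset.sum_comm

end HilbertSchmidt


/-! ### The Riemannian volume measure -/

section Volume

variable (n : ℕ) {X : Type*} [EMetricSpace X] [ChartedSpace (EuclideanSpace ℝ (Fin n)) X]
  [IsManifold (𝓡 n) ∞ X] [RiemannianBundle (fun x : X => TangentSpace (𝓡 n) x)]

/-- The coordinate vector field on `X` with constant coordinates `v`, for the chart at `x₀`,
evaluated at `x` (and `0` if `x` is not in the domain of the chart). -/
def coordField (x₀ x : X) (v : EuclideanSpace ℝ (Fin n)) : TangentSpace (𝓡 n) x :=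
  (trivializationAt (EuclideanSpace ℝ (Fin n)) (TangentSpace (𝓡 n)) x₀).symmL ℝ x v

/-- The matrix `g i j = ⟨∂ᵢ, ∂ⱼ⟩` of the metric at `x`, in the chart at `x₀`. -/
def metricMatrix (x₀ x : X) : Matrix (Fin n) (Fin n) ℝ :=
  Matrix.of fun i j => inner ℝ (coordField n x₀ x (EuclideanSpace.basisFun (Fin n) ℝ i))
    (coordField n x₀ x (EuclideanSpace.basisFun (Fin n) ℝ j))

variable [MeasurableSpace X]

/-- The measure `√(det g) dz¹ ⋯ dzⁿ` on the domain of the chart at `x₀`, extended by zero. -/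
def chartVolume (x₀ : X) : Measure X :=
  (((volume : Measure (EuclideanSpace ℝ (Fin n))).restrict
      (chartAt (EuclideanSpace ℝ (Fin n)) x₀).target).withDensity fun z =>
        ENNReal.ofReal √(metricMatrix n x₀
          ((chartAt (EuclideanSpace ℝ (Fin n)) x₀).symm z)).det).map
    (chartAt (EuclideanSpace ℝ (Fin n)) x₀).symm

variable (X) in
/-- The Riemannian volume measure. The measures `√(det g) dz` of the charts agree on overlaps, and
their supremum is the measure on `X` that extends each of them. -/
def riemannianVolume : Measure X := ⨆ x₀ : X, chartVolume n x₀

/-- The Morrey norm `‖f‖_{L^p_d(X)}` of a function on `X` with absolute value `f`: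
`‖f‖^p = ∫_X f^p + sup_{0 < ρ ≤ R} sup_{x ∈ X} ρ^{d-n} ∫_{B_ρ(x)} f^p`,
where `B_ρ(x)` are geodesic balls. -/
def morreyENorm (R d p : ℝ) (f : X → ℝ≥0∞) : ℝ≥0∞ :=
  (∫⁻ y, f y ^ p ∂(riemannianVolume n X) +
    ⨆ ρ ∈ Ioc 0 R, ⨆ x : X, ENNReal.ofReal (ρ ^ (d - n)) *
      ∫⁻ y in Metric.eball x (ENNReal.ofReal ρ), f y ^ p ∂(riemannianVolume n X)) ^ (1 / p)

variable {n}

lemma morreyENorm_mono {R d p : ℝ} (hp : 0 ≤ p) {f g : X → ℝ≥0∞} (h : ∀ x, f x ≤ g x) :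
    morreyENorm n R d p f ≤ morreyENorm n R d p g := by
  unfold morreyENorm
  gcongr
  · exact h _
  · exact h _

lemma morreyENorm_zero {R d p : ℝ} (hp : 0 < p) :
    morreyENorm n R d p (fun _ : X => 0) = 0 := by
  simp [morreyENorm, hp]

lemma morreyENorm_rpow {R d p : ℝ} (hp : 0 < p) (f : X → ℝ≥0∞) :
    morreyENorm n R d p f ^ p = ∫⁻ y, f y ^ p ∂(riemannianVolume n X) +
    ⨆ ρ ∈ Ioc 0 R, ⨆ x : X, ENNReal.ofReal (ρ ^ (d - n)) *
      ∫⁻ y in Metric.eball x (ENNReal.ofReal ρ), f y ^ p ∂(riemannianVolume n X) := by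
  rw [morreyENorm, ← ENNReal.rpow_mul, one_div_mul_cancel hp.ne', ENNReal.rpow_one]

lemma morreyENorm_add_le {R d p : ℝ} (hp : 1 ≤ p) {f g : X → ℝ≥0∞}
    (hf : AEMeasurable f (riemannianVolume n X)) (hg : AEMeasurable g (riemannianVolume n X)) :
    morreyENorm n R d p (fun x => f x + g x) ≤ morreyENorm n R d p f + morreyENorm n R d p g := by
  have hp0 : 0 < p := zero_lt_one.trans_le hp
  set M := morreyENorm n R d p f + morreyENorm n R d p g with hM
  rw [← ENNReal.rpow_le_rpow_iff hp0, morreyENorm_rpow hp0]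
  -- each of the integrals is a power of an `L^p` norm
  have key : ∀ μ : Measure X, AEMeasurable f μ → AEMeasurable g μ →
      ∫⁻ y, f y ^ p ∂μ ≤ morreyENorm n R d p f ^ p →
      ∫⁻ y, g y ^ p ∂μ ≤ morreyENorm n R d p g ^ p →
      ∫⁻ y, (f y + g y) ^ p ∂μ ≤ M ^ p := by
    intro μ hfμ hgμ h1 h2
    have h := ENNReal.lintegral_Lp_add_le hfμ hgμ hp
    have h1' := ENNReal.rpow_le_rpow h1 (by positivity : 0 ≤ 1 / p)
    have h2' := ENNReal.rpow_le_rpow h2 (by positivity : 0 ≤ 1 / p)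
    rw [← ENNReal.rpow_mul, mul_one_div_cancel hp0.ne', ENNReal.rpow_one] at h1' h2'
    have h3 := ENNReal.rpow_le_rpow (h.trans (add_le_add h1' h2')) hp0.le
    rw [← ENNReal.rpow_mul, one_div_mul_cancel hp0.ne', ENNReal.rpow_one] at h3
    exact h3
  have h0 : ∫⁻ y, (f y + g y) ^ p ∂(riemannianVolume n X) ≤ M ^ p :=
    key _ hf hg (by rw [morreyENorm_rpow hp0]; exact le_self_add)
      (by rw [morreyENorm_rpow hp0]; exact le_self_add)
  rcases eq_or_ne (∫⁻ y, (f y + g y) ^ p ∂(riemannianVolume n X)) ⊤ with htop | hfin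
  · rw [htop, top_le_iff] at h0
    rw [h0]; exact le_top
  rw [← add_tsub_cancel_of_le h0]
  gcongr
  refine iSup₂_le fun ρ hρ => iSup_le fun x => ENNReal.le_sub_of_add_le_left hfin ?_
  set c := ENNReal.ofReal (ρ ^ (d - n))
  set B := Metric.eball x (ENNReal.ofReal ρ)
  have hμ : ∀ h : X → ℝ≥0∞, ∫⁻ y, h y ∂(riemannianVolume n X +
      c • (riemannianVolume n X).restrict B) =
      ∫⁻ y, h y ∂(riemannianVolume n X) + c * ∫⁻ y in B, h y ∂(riemannianVolume n X) := by
    intro h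
    rw [lintegral_add_measure, lintegral_smul_measure, smul_eq_mul]
  have hle : ∀ h : X → ℝ≥0∞, ∫⁻ y, h y ^ p ∂(riemannianVolume n X +
      c • (riemannianVolume n X).restrict B) ≤ morreyENorm n R d p h ^ p := by
    intro h
    rw [hμ, morreyENorm_rpow hp0]
    gcongr
    exact le_trans (le_iSup (fun x : X => ENNReal.ofReal (ρ ^ (d - n)) *
      ∫⁻ y in Metric.eball x (ENNReal.ofReal ρ), h y ^ p ∂(riemannianVolume n X)) x)
      (le_iSup₂ (f := fun ρ (_ : ρ ∈ Ioc 0 R) => ⨆ x : X, ENNReal.ofReal (ρ ^ (d - n)) *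
      ∫⁻ y in Metric.eball x (ENNReal.ofReal ρ), h y ^ p ∂(riemannianVolume n X)) ρ hρ)
  rw [← hμ]
  exact key _ (hf.add_measure (hf.restrict.smul_measure _))
    (hg.add_measure (hg.restrict.smul_measure _)) (hle f) (hle g)

lemma morreyENorm_const_mul {R d p : ℝ} (hp : 0 < p) {c : ℝ≥0∞} (hc : c ≠ ⊤) (f : X → ℝ≥0∞) :
    morreyENorm n R d p (fun x => c * f x) = c * morreyENorm n R d p f := by
  have hcp : c ^ p ≠ ⊤ := ENNReal.rpow_ne_top_of_nonneg hp.le hc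
  have h1 : ∀ μ : Measure X, ∫⁻ y, (c * f y) ^ p ∂μ = c ^ p * ∫⁻ y, f y ^ p ∂μ := by
    intro μ
    simp_rw [ENNReal.mul_rpow_of_nonneg _ _ hp.le]
    exact lintegral_const_mul' _ _ hcp
  unfold morreyENorm
  simp_rw [h1, ← mul_assoc, mul_comm _ (c ^ p), mul_assoc, ← ENNReal.mul_iSup, ← mul_add]
  rw [ENNReal.mul_rpow_of_nonneg _ _ (by positivity), ← ENNReal.rpow_mul, mul_one_div_cancel hp.ne',
    ENNReal.rpow_one]

end Volume

/-! ### Sections of a Euclidean vector bundle and their weak covariant derivatives -/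

section Sections

variable {n : ℕ} {X : Type*} [EMetricSpace X] [ChartedSpace (EuclideanSpace ℝ (Fin n)) X]
  [IsManifold (𝓡 n) ∞ X] [RiemannianBundle (fun x : X => TangentSpace (𝓡 n) x)]
  {F : Type*} [NormedAddCommGroup F] [NormedSpace ℝ F]
  {E : X → Type*} [TopologicalSpace (TotalSpace F E)] [∀ x, NormedAddCommGroup (E x)]
  [∀ x, InnerProductSpace ℝ (E x)] [FiberBundle F E] [VectorBundle ℝ F E]

variable (F) in
/-- The representation in `F` of a vector of `E x`, in the trivialization of `E` at `x₀`. -/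
def fiberCoord (x₀ : X) {x : X} (v : E x) : F :=
  (trivializationAt F E x₀).continuousLinearMapAt ℝ x v

variable (E) in
/-- The local section of `E` that is constant, equal to `c`, in the trivialization of `E` at `x₀`
(extended by zero). -/
def constSection (x₀ : X) (c : F) : Π x : X, E x :=
  fun x => (trivializationAt F E x₀).symmL ℝ x c

variable (n F E) in
/-- The part of the chart at `x₀` over which the trivialization of `E` at `x₀` is defined,
as an open subset of `ℝⁿ`. -/
def chartDomain (x₀ : X) : Set (EuclideanSpace ℝ (Fin n)) :=
  (chartAt (EuclideanSpace ℝ (Fin n)) x₀).target ∩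
    (chartAt (EuclideanSpace ℝ (Fin n)) x₀).symm ⁻¹' (trivializationAt F E x₀).baseSet

variable (n F) in
/-- The section `s`, in the chart and the trivialization at `x₀`, as an `F`-valued function. -/
def sectionCoord (s : Π x : X, E x) (x₀ : X) (z : EuclideanSpace ℝ (Fin n)) : F :=
  fiberCoord F x₀ (s ((chartAt (EuclideanSpace ℝ (Fin n)) x₀).symm z))

/-- Let `u` represent `s` in the chart and the trivialization at `x₀`, where `∇_A = d + ω`.
If `t` is to be `∇_A s`, then `∂ᵥ u` has to be the function `t(∂ᵥ) - ω(∂ᵥ) u` defined here. Note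
that `ω(∂ᵥ) c = ∇_{A,∂ᵥ} c` for the local section that is constant equal to `c`. -/
def derivCoord (A : CovariantDerivative (𝓡 n) F E) (s : Π x : X, E x)
    (t : Π x : X, TangentSpace (𝓡 n) x →L[ℝ] E x) (x₀ : X) (v z : EuclideanSpace ℝ (Fin n)) : F :=
  let y := (chartAt (EuclideanSpace ℝ (Fin n)) x₀).symm z
  fiberCoord F x₀ (t y (coordField n x₀ y v)) -
    fiberCoord F x₀ (A (constSection E x₀ (sectionCoord n F s x₀ z)) y (coordField n x₀ y v))

/-- `t` is the weak covariant derivative `∇_A s` of `s`: in the charts and trivializations, both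
are locally integrable, and `∂ᵥ u = t(∂ᵥ) - ω(∂ᵥ) u` in the sense of distributions. -/
structure IsWeakCovDeriv (A : CovariantDerivative (𝓡 n) F E) (s : Π x : X, E x)
    (t : Π x : X, TangentSpace (𝓡 n) x →L[ℝ] E x) : Prop where
  locallyIntegrableOn : ∀ x₀ : X,
    LocallyIntegrableOn (sectionCoord n F s x₀) (chartDomain n F E x₀)
  locallyIntegrableOn_deriv : ∀ (x₀ : X) (v : EuclideanSpace ℝ (Fin n)),
    LocallyIntegrableOn (derivCoord A s t x₀ v) (chartDomain n F E x₀)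
  integral_eq : ∀ (x₀ : X) (v : EuclideanSpace ℝ (Fin n)) (η : EuclideanSpace ℝ (Fin n) → ℝ),
    ContDiff ℝ ∞ η → HasCompactSupport η → tsupport η ⊆ chartDomain n F E x₀ →
    ∫ z in chartDomain n F E x₀, (fderiv ℝ η z v) • sectionCoord n F s x₀ z =
      - ∫ z in chartDomain n F E x₀, η z • derivCoord A s t x₀ v z

variable [MeasurableSpace X]

variable (n F) in
/-- The section `s` of `E` is almost everywhere measurable (in the trivializations of `E`). -/
def AEMeasurableSection (s : Π x : X, E x) : Prop :=
  ∀ x₀ : X, AEStronglyMeasurable (fun x => fiberCoord F x₀ (s x))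
    ((riemannianVolume n X).restrict (trivializationAt F E x₀).baseSet)

variable (F) in
/-- The section `t` of `Hom(TX, E) = T*X ⊗ E` is almost everywhere measurable. -/
def AEMeasurableHomSection (t : Π x : X, TangentSpace (𝓡 n) x →L[ℝ] E x) : Prop :=
  ∀ (x₀ : X) (v : EuclideanSpace ℝ (Fin n)),
    AEStronglyMeasurable (fun x => fiberCoord F x₀ (t x (coordField n x₀ x v)))
      ((riemannianVolume n X).restrict ((trivializationAt F E x₀).baseSet ∩
        (chartAt (EuclideanSpace ℝ (Fin n)) x₀).source))

variable (n) in
/-- The norm `‖(|s|)‖_{L^p_d(X)}` of a section `s` of `E`. -/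
def sectionENorm (R d p : ℝ) (s : Π x : X, E x) : ℝ≥0∞ :=
  morreyENorm n R d p fun x => ‖s x‖ₑ

/-- The tangent spaces have finite dimension. -/
instance (x : X) : FiniteDimensional ℝ (TangentSpace (𝓡 n) x) :=
  inferInstanceAs (FiniteDimensional ℝ (EuclideanSpace ℝ (Fin n)))

/-- The norm `‖(|t|)‖_{L^p_d(X)}` of a section `t` of `T*X ⊗ E`. -/
def homSectionENorm (R d p : ℝ) (t : Π x : X, TangentSpace (𝓡 n) x →L[ℝ] E x) : ℝ≥0∞ :=
  morreyENorm n R d p fun x => ENNReal.ofReal (hsNorm (t x))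

/-- The norm `‖s‖_{L^{1,p}_{d,A}(X,E)}` of a section `s` of `E` with `∇_A s = t`. -/
def sobolevENorm (R d p : ℝ)
    (st : (Π x : X, E x) × (Π x : X, TangentSpace (𝓡 n) x →L[ℝ] E x)) : ℝ≥0∞ :=
  (sectionENorm n R d p st.1 ^ p + homSectionENorm R d p st.2 ^ p) ^ (1 / p)

end Sections

/-- The Hilbert-Schmidt norm in local coordinates. -/
lemma hsNorm_sq_eq_metricMatrix {n : ℕ} {X : Type*} [EMetricSpace X]
    [ChartedSpace (EuclideanSpace ℝ (Fin n)) X] [IsManifold (𝓡 n) ∞ X]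
    [RiemannianBundle (fun x : X => TangentSpace (𝓡 n) x)]
    {W : Type*} [NormedAddCommGroup W] [InnerProductSpace ℝ W] (x₀ : X) {x : X}
    (hx : x ∈ (chartAt (EuclideanSpace ℝ (Fin n)) x₀).source) (T : TangentSpace (𝓡 n) x →L[ℝ] W) :
    hsNorm T ^ 2 = ∑ i, ∑ j, (metricMatrix n x₀ x)⁻¹ i j *
      (inner ℝ (T (coordField n x₀ x (EuclideanSpace.basisFun (Fin n) ℝ i)))
        (T (coordField n x₀ x (EuclideanSpace.basisFun (Fin n) ℝ j))) : ℝ) := by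
  set e := trivializationAt (EuclideanSpace ℝ (Fin n)) (TangentSpace (𝓡 n)) x₀ with he
  have hx' : x ∈ e.baseSet := hx
  set f : Module.Basis (Fin n) ℝ (TangentSpace (𝓡 n) x) :=
    (EuclideanSpace.basisFun (Fin n) ℝ).toBasis.map
      (e.continuousLinearEquivAt ℝ x hx').toLinearEquiv.symm with hf
  have hfi : ∀ i, f i = coordField n x₀ x (EuclideanSpace.basisFun (Fin n) ℝ i) := by
    intro i
    simp only [hf, Module.Basis.map_apply, OrthonormalBasis.coe_toBasis]
    rw [coordField, Trivialization.symmL_apply _ hx']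
    rfl
  rw [hsNorm_sq_eq f T]
  simp only [hfi]
  rfl

/-! ### Basic facts: measurability and linearity -/

section Facts

variable {n : ℕ} {X : Type*} [EMetricSpace X] [ChartedSpace (EuclideanSpace ℝ (Fin n)) X]
  {F : Type*} [NormedAddCommGroup F] [NormedSpace ℝ F]
  {E : X → Type*} [TopologicalSpace (TotalSpace F E)] [∀ x, NormedAddCommGroup (E x)]
  [∀ x, InnerProductSpace ℝ (E x)] [FiberBundle F E] [VectorBundle ℝ F E]
  [ContMDiffVectorBundle ∞ F E (𝓡 n)]

lemma contMDiffOn_constSection (x₀ : X) (c : F) :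
    ContMDiffOn (𝓡 n) ((𝓡 n).prod 𝓘(ℝ, F)) ∞
      (fun x => TotalSpace.mk' F x (constSection E x₀ c x)) (trivializationAt F E x₀).baseSet := by
  rw [Trivialization.contMDiffOn_section_baseSet_iff]
  refine (contMDiffOn_const (c := c)).congr fun x hx => ?_
  rw [constSection, Trivialization.symmL_apply _ hx, Trivialization.apply_mk_symm _ hx]

lemma contMDiffOn_inner_constSection [IsContMDiffRiemannianBundle (𝓡 n) ∞ F E] (x₀ : X) (c c' : F) :
    ContMDiffOn (𝓡 n) 𝓘(ℝ) ∞
      (fun x => (inner ℝ (constSection E x₀ c x) (constSection E x₀ c' x) : ℝ))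
      (trivializationAt F E x₀).baseSet :=
  (contMDiffOn_constSection x₀ c).inner_bundle (contMDiffOn_constSection x₀ c')

lemma constSection_fiberCoord (x₀ : X) {x : X} (hx : x ∈ (trivializationAt F E x₀).baseSet)
    (v : E x) : constSection E x₀ (fiberCoord F x₀ v) x = v :=
  Trivialization.symmL_continuousLinearMapAt _ hx v

lemma constSection_add (x₀ : X) (c c' : F) :
    constSection E x₀ (c + c') = constSection E x₀ c + constSection E x₀ c' := by
  ext x; simp [constSection]

lemma constSection_smul (x₀ : X) (a : ℝ) (c : F) :
    constSection E x₀ (a • c) = a • constSection E x₀ c := by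
  ext x; simp [constSection]

variable [MeasurableSpace X] [BorelSpace X]

lemma aestronglyMeasurable_inner [FiniteDimensional ℝ F] [IsContMDiffRiemannianBundle (𝓡 n) ∞ F E]
    {μ : Measure X} {s s' : Π x : X, E x} {U : Set X} (hU : IsOpen U) (x₀ : X)
    (hUx : U ⊆ (trivializationAt F E x₀).baseSet)
    (hs : AEStronglyMeasurable (fun x => fiberCoord F x₀ (s x)) (μ.restrict U))
    (hs' : AEStronglyMeasurable (fun x => fiberCoord F x₀ (s' x)) (μ.restrict U)) :
    AEStronglyMeasurable (fun x => (inner ℝ (s x) (s' x) : ℝ)) (μ.restrict U) := by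
  set b := Module.finBasis ℝ F
  have hexp : ∀ (s : Π x : X, E x), ∀ x ∈ U,
      s x = ∑ i, b.repr (fiberCoord F x₀ (s x)) i • constSection E x₀ (b i) x := by
    intro s x hx
    conv_lhs => rw [← constSection_fiberCoord (F := F) x₀ (hUx hx) (s x),
      ← b.sum_repr (fiberCoord F x₀ (s x))]
    simp only [constSection, map_sum, map_smul]
  have hcoord : ∀ (s : Π x : X, E x),
      AEStronglyMeasurable (fun x => fiberCoord F x₀ (s x)) (μ.restrict U) → ∀ i,
      AEStronglyMeasurable (fun x => b.repr (fiberCoord F x₀ (s x)) i) (μ.restrict U) := by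
    intro s hs i
    exact (LinearMap.continuous_of_finiteDimensional (b.coord i)).comp_aestronglyMeasurable hs
  have hmain : AEStronglyMeasurable (fun x => ∑ i, ∑ j,
      b.repr (fiberCoord F x₀ (s x)) i * (b.repr (fiberCoord F x₀ (s' x)) j *
        (inner ℝ (constSection E x₀ (b i) x) (constSection E x₀ (b j) x) : ℝ))) (μ.restrict U) := by
    refine Finset.aestronglyMeasurable_fun_sum _ fun i _ =>
      Finset.aestronglyMeasurable_fun_sum _ fun j _ => ?_
    exact (hcoord s hs i).mul ((hcoord s' hs' j).mul
      (((contMDiffOn_inner_constSection (n := n) x₀ (b i) (b j)).continuousOn.mono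
        hUx).aestronglyMeasurable hU.measurableSet))
  refine hmain.congr ?_
  filter_upwards [ae_restrict_mem hU.measurableSet] with x hx
  conv_rhs => rw [hexp s x hx, hexp s' x hx]
  simp only [sum_inner]
  refine Finset.sum_congr rfl fun i _ => ?_
  simp only [inner_sum, real_inner_smul_left, real_inner_smul_right]
  exact Finset.sum_congr rfl fun j _ => by ring

/-- Measurability can be checked on a family of open neighborhoods of the points. -/
lemma aestronglyMeasurable_of_cover [CompactSpace X] {μ : Measure X} {f : X → ℝ} (U : X → Set X)
    (hU : ∀ x, IsOpen (U x)) (hxU : ∀ x, x ∈ U x)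
    (hf : ∀ x, AEStronglyMeasurable f (μ.restrict (U x))) : AEStronglyMeasurable f μ := by
  obtain ⟨t, ht⟩ := isCompact_univ.elim_finite_subcover U hU (fun x _ => mem_iUnion.2 ⟨x, hxU x⟩)
  have h : AEStronglyMeasurable f (μ.restrict (⋃ i : t, U i)) :=
    (aestronglyMeasurable_iUnion_iff).2 fun i => hf i
  have hcov : (⋃ i : t, U i) = univ := by
    refine univ_subset_iff.1 fun x hx => ?_
    obtain ⟨i, hi, hxi⟩ := mem_iUnion₂.1 (ht hx)
    exact mem_iUnion.2 ⟨⟨i, hi⟩, hxi⟩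
  rwa [hcov, Measure.restrict_univ] at h

variable [CompactSpace X] [IsManifold (𝓡 n) ∞ X] [FiniteDimensional ℝ F] [IsContMDiffRiemannianBundle (𝓡 n) ∞ F E]
  [RiemannianBundle (fun x : X => TangentSpace (𝓡 n) x)]

lemma AEMeasurableSection.aemeasurable_enorm {s : Π x : X, E x} (hs : AEMeasurableSection n F s) :
    AEMeasurable (fun x => ‖s x‖ₑ) (riemannianVolume n X) := by
  have h : AEStronglyMeasurable (fun x => (inner ℝ (s x) (s x) : ℝ)) (riemannianVolume n X) :=
    aestronglyMeasurable_of_cover (fun x => (trivializationAt F E x).baseSet)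
      (fun x => (trivializationAt F E x).open_baseSet)
      (fun x => FiberBundle.mem_baseSet_trivializationAt' x) fun x =>
      aestronglyMeasurable_inner (n := n) (trivializationAt F E x).open_baseSet x subset_rfl
        (hs x) (hs x)
  have h2 := (h.aemeasurable.sqrt).ennreal_ofReal
  refine h2.congr (ae_of_all _ fun x => ?_)
  simp only [← norm_eq_sqrt_real_inner, ofReal_norm]

variable [IsContMDiffRiemannianBundle (𝓡 n) ∞ (EuclideanSpace ℝ (Fin n))
    (fun x : X => TangentSpace (𝓡 n) x)]

lemma AEMeasurableHomSection.aemeasurable_hsNorm {t : Π x : X, TangentSpace (𝓡 n) x →L[ℝ] E x}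
    (ht : AEMeasurableHomSection F t) :
    AEMeasurable (fun x => ENNReal.ofReal (hsNorm (t x))) (riemannianVolume n X) := by
  refine AEMeasurable.ennreal_ofReal ?_
  have hsq : AEStronglyMeasurable (fun x => hsNorm (t x) ^ 2) (riemannianVolume n X) := by
    refine aestronglyMeasurable_of_cover (fun x => (trivializationAt F E x).baseSet ∩
        (chartAt (EuclideanSpace ℝ (Fin n)) x).source)
      (fun x => (trivializationAt F E x).open_baseSet.inter (chartAt _ x).open_source)
      (fun x => ⟨FiberBundle.mem_baseSet_trivializationAt' x, mem_chart_source _ x⟩) fun x₀ => ?_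
    set U := (trivializationAt F E x₀).baseSet ∩ (chartAt (EuclideanSpace ℝ (Fin n)) x₀).source
      with hUdef
    have hU : IsOpen U := (trivializationAt F E x₀).open_baseSet.inter (chartAt _ x₀).open_source
    set b := (EuclideanSpace.basisFun (Fin n) ℝ) with hb
    have hG : ∀ i j, AEMeasurable (fun x => metricMatrix n x₀ x i j)
        ((riemannianVolume n X).restrict U) := by
      intro i j
      have h := (contMDiffOn_inner_constSection (n := n) (E := (TangentSpace (𝓡 n) : X → Type _))
        x₀ (b i) (b j)).continuousOn
      have h' : ContinuousOn (fun x => metricMatrix n x₀ x i j) U := h.mono fun x hx => hx.2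
      exact (h'.aestronglyMeasurable hU.measurableSet).aemeasurable
    have hT : ∀ i j, AEMeasurable (fun x => (inner ℝ (t x (coordField n x₀ x (b i)))
        (t x (coordField n x₀ x (b j))) : ℝ)) ((riemannianVolume n X).restrict U) := fun i j =>
      (aestronglyMeasurable_inner (n := n) hU x₀ inter_subset_left
        (s := fun x => t x (coordField n x₀ x (b i))) (s' := fun x => t x (coordField n x₀ x (b j)))
        (ht x₀ (b i)) (ht x₀ (b j))).aemeasurable
    have hdet : ∀ (M : X → Matrix (Fin n) (Fin n) ℝ), (∀ i j, AEMeasurable (fun x => M x i j)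
        ((riemannianVolume n X).restrict U)) →
        AEMeasurable (fun x => (M x).det) ((riemannianVolume n X).restrict U) := by
      intro M hM
      simp only [Matrix.det_apply']
      fun_prop
    have hinv : ∀ i j, AEMeasurable (fun x => (metricMatrix n x₀ x)⁻¹ i j)
        ((riemannianVolume n X).restrict U) := by
      intro i j
      simp only [Matrix.inv_def, Matrix.smul_apply, smul_eq_mul, Ring.inverse_eq_inv',
        Matrix.adjugate_apply]
      refine (hdet _ hG).inv.mul (hdet _ fun k l => ?_)
      simp only [Matrix.updateRow_apply]
      split_ifs
      · exact aemeasurable_const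
      · exact hG k l
    have hsum : AEMeasurable (fun x => ∑ i, ∑ j, (metricMatrix n x₀ x)⁻¹ i j *
        (inner ℝ (t x (coordField n x₀ x (b i))) (t x (coordField n x₀ x (b j))) : ℝ))
        ((riemannianVolume n X).restrict U) := by
      exact Finset.aemeasurable_fun_sum _ fun i _ => Finset.aemeasurable_fun_sum _ fun j _ =>
        (hinv i j).mul (hT i j)
    refine (hsum.congr ?_).aestronglyMeasurable
    filter_upwards [ae_restrict_mem hU.measurableSet] with x hx
    exact (hsNorm_sq_eq_metricMatrix x₀ hx.2 (t x)).symm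
  exact hsq.aemeasurable.sqrt.congr (ae_of_all _ fun x => Real.sqrt_sq (hsNorm_nonneg _))

end Facts

section Linear

variable {n : ℕ} {X : Type*} [EMetricSpace X] [ChartedSpace (EuclideanSpace ℝ (Fin n)) X]
  [IsManifold (𝓡 n) ∞ X]
  {F : Type*} [NormedAddCommGroup F] [NormedSpace ℝ F]
  {E : X → Type*} [TopologicalSpace (TotalSpace F E)] [∀ x, NormedAddCommGroup (E x)]
  [∀ x, InnerProductSpace ℝ (E x)] [FiberBundle F E] [VectorBundle ℝ F E]
  {A : CovariantDerivative (𝓡 n) F E} {s s' : Π x : X, E x}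
  {t t' : Π x : X, TangentSpace (𝓡 n) x →L[ℝ] E x}

lemma fiberCoord_add (x₀ : X) {x : X} (v w : E x) :
    fiberCoord F x₀ (v + w) = fiberCoord F x₀ v + fiberCoord F x₀ w := map_add _ _ _

lemma fiberCoord_smul (x₀ : X) {x : X} (c : ℝ) (v : E x) :
    fiberCoord F x₀ (c • v) = c • fiberCoord F x₀ v := map_smul _ _ _

lemma fiberCoord_zero (x₀ x : X) : fiberCoord F x₀ (0 : E x) = 0 := map_zero _

lemma sectionCoord_add : sectionCoord n F (s + s') = sectionCoord n F s + sectionCoord n F s' := by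
  ext x₀ z; exact fiberCoord_add _ _ _

lemma sectionCoord_smul (c : ℝ) : sectionCoord n F (c • s) = c • sectionCoord n F s := by
  ext x₀ z; exact fiberCoord_smul _ _ _

lemma isOpen_chartDomain (x₀ : X) : IsOpen (chartDomain n F E x₀) :=
  (chartAt _ x₀).isOpen_inter_preimage_symm (trivializationAt F E x₀).open_baseSet

lemma sectionCoord_zero (x₀ : X) (z) : sectionCoord n F (0 : Π x : X, E x) x₀ z = 0 :=
  fiberCoord_zero _ _

lemma derivCoord_zero (x₀ : X) (v z) : derivCoord A 0 0 x₀ v z = 0 := by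
  have h : constSection E x₀ (0 : F) = 0 := by ext x; simp [constSection]
  simp [derivCoord, sectionCoord_zero, h, fiberCoord_zero]

variable [ContMDiffVectorBundle ∞ F E (𝓡 n)]

lemma mdifferentiableAt_constSection (x₀ : X) (c : F) {x : X}
    (hx : x ∈ (trivializationAt F E x₀).baseSet) :
    MDifferentiableAt (𝓡 n) ((𝓡 n).prod 𝓘(ℝ, F))
      (fun x => TotalSpace.mk' F x (constSection E x₀ c x)) x :=
  ((contMDiffOn_constSection x₀ c).contMDiffAt
    ((trivializationAt F E x₀).open_baseSet.mem_nhds hx)).mdifferentiableAt (by simp)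

lemma derivCoord_add (x₀ : X) (v : EuclideanSpace ℝ (Fin n)) {z : EuclideanSpace ℝ (Fin n)}
    (hz : z ∈ chartDomain n F E x₀) :
    derivCoord A (s + s') (t + t') x₀ v z = derivCoord A s t x₀ v z + derivCoord A s' t' x₀ v z := by
  simp only [derivCoord, sectionCoord_add, Pi.add_apply, constSection_add]
  rw [A.isCovariantDerivativeOnUniv.add (mdifferentiableAt_constSection x₀ _ hz.2)
    (mdifferentiableAt_constSection x₀ _ hz.2)]
  simp only [add_apply, fiberCoord_add]
  abel

lemma derivCoord_smul (c : ℝ) (x₀ : X) (v : EuclideanSpace ℝ (Fin n))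
    {z : EuclideanSpace ℝ (Fin n)} (hz : z ∈ chartDomain n F E x₀) :
    derivCoord A (c • s) (c • t) x₀ v z = c • derivCoord A s t x₀ v z := by
  simp only [derivCoord, sectionCoord_smul, Pi.smul_apply, constSection_smul]
  rw [A.isCovariantDerivativeOnUniv.smul_const c (mdifferentiableAt_constSection x₀ _ hz.2)]
  simp only [smul_apply, fiberCoord_smul, smul_sub]

lemma integrableOn_smul {Ω : Set (EuclideanSpace ℝ (Fin n))} 
    {f : EuclideanSpace ℝ (Fin n) → F} (hf : LocallyIntegrableOn f Ω)
    {η : EuclideanSpace ℝ (Fin n) → ℝ} (hη : Continuous η) (hc : HasCompactSupport η)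
    (hs : tsupport η ⊆ Ω) : IntegrableOn (fun z => η z • f z) Ω := by
  have h := (hf.integrableOn_compact_subset hs hc).continuousOn_smul hη.continuousOn hc
  refine Integrable.integrableOn ?_
  refine (integrableOn_iff_integrable_of_support_subset ?_).1 h
  intro z hz
  refine subset_tsupport _ fun h0 => hz ?_
  simp [h0]

lemma integrableOn_fderiv_smul {Ω : Set (EuclideanSpace ℝ (Fin n))}
    {f : EuclideanSpace ℝ (Fin n) → F} (hf : LocallyIntegrableOn f Ω)
    {η : EuclideanSpace ℝ (Fin n) → ℝ} (hη : ContDiff ℝ ∞ η) (hc : HasCompactSupport η)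
    (hs : tsupport η ⊆ Ω) (v) : IntegrableOn (fun z => fderiv ℝ η z v • f z) Ω :=
  integrableOn_smul hf ((hη.continuous_fderiv (by simp)).clm_apply continuous_const)
    (hc.fderiv_apply ℝ v) ((tsupport_fderiv_apply_subset ℝ v).trans hs)

lemma IsWeakCovDeriv.zero : IsWeakCovDeriv A 0 0 where
  locallyIntegrableOn x₀ := by
    simpa only [funext (sectionCoord_zero x₀)] using locallyIntegrableOn_zero
  locallyIntegrableOn_deriv x₀ v := by
    simpa only [funext (derivCoord_zero x₀ v)] using locallyIntegrableOn_zero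
  integral_eq x₀ v η _ _ _ := by simp [sectionCoord_zero, derivCoord_zero]

lemma IsWeakCovDeriv.add (h : IsWeakCovDeriv A s t) (h' : IsWeakCovDeriv A s' t') :
    IsWeakCovDeriv A (s + s') (t + t') where
  locallyIntegrableOn x₀ := by
    rw [sectionCoord_add]
    exact (h.locallyIntegrableOn x₀).add (h'.locallyIntegrableOn x₀)
  locallyIntegrableOn_deriv x₀ v := by
    refine ((h.locallyIntegrableOn_deriv x₀ v).add (h'.locallyIntegrableOn_deriv x₀ v)).congr ?_
    filter_upwards [ae_restrict_mem (isOpen_chartDomain x₀).measurableSet] with z hz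
    exact (derivCoord_add x₀ v hz).symm
  integral_eq x₀ v η hη hc hs := by
    have h1 := setIntegral_congr_fun (μ := volume)
      (isOpen_chartDomain (n := n) (F := F) (E := E) x₀).measurableSet
      (f := fun z => η z • derivCoord A (s + s') (t + t') x₀ v z)
      (g := fun z => η z • derivCoord A s t x₀ v z + η z • derivCoord A s' t' x₀ v z)
      fun z hz => by simp only [derivCoord_add x₀ v hz, smul_add]
    rw [h1, integral_add (integrableOn_smul (h.locallyIntegrableOn_deriv x₀ v) hη.continuous hc hs)
      (integrableOn_smul (h'.locallyIntegrableOn_deriv x₀ v) hη.continuous hc hs)]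
    simp only [sectionCoord_add, Pi.add_apply, smul_add]
    rw [integral_add (integrableOn_fderiv_smul (h.locallyIntegrableOn x₀) hη hc hs v)
      (integrableOn_fderiv_smul (h'.locallyIntegrableOn x₀) hη hc hs v),
      h.integral_eq x₀ v η hη hc hs, h'.integral_eq x₀ v η hη hc hs, neg_add]

lemma IsWeakCovDeriv.smul (c : ℝ) (h : IsWeakCovDeriv A s t) :
    IsWeakCovDeriv A (c • s) (c • t) where
  locallyIntegrableOn x₀ := by
    rw [sectionCoord_smul]
    exact (h.locallyIntegrableOn x₀).smul c
  locallyIntegrableOn_deriv x₀ v := by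
    refine ((h.locallyIntegrableOn_deriv x₀ v).smul c).congr ?_
    filter_upwards [ae_restrict_mem (isOpen_chartDomain x₀).measurableSet] with z hz
    exact (derivCoord_smul c x₀ v hz).symm
  integral_eq x₀ v η hη hc hs := by
    have h1 := setIntegral_congr_fun (μ := volume)
      (isOpen_chartDomain (n := n) (F := F) (E := E) x₀).measurableSet
      (f := fun z => η z • derivCoord A (c • s) (c • t) x₀ v z)
      (g := fun z => c • (η z • derivCoord A s t x₀ v z))
      fun z hz => by simp only [derivCoord_smul c x₀ v hz, smul_comm c]
    rw [h1, integral_smul, ← smul_neg, ← h.integral_eq x₀ v η hη hc hs, ← integral_smul]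
    simp only [sectionCoord_smul, Pi.smul_apply, smul_comm c]

end Linear

/-! ### The Morrey spaces -/

section Spaces

variable {n : ℕ} {X : Type*} [EMetricSpace X] [CompactSpace X]
  [ChartedSpace (EuclideanSpace ℝ (Fin n)) X]
  [IsManifold (𝓡 n) ∞ X] [RiemannianBundle (fun x : X => TangentSpace (𝓡 n) x)]
  [IsContMDiffRiemannianBundle (𝓡 n) ∞ (EuclideanSpace ℝ (Fin n))
    (fun x : X => TangentSpace (𝓡 n) x)]
  [MeasurableSpace X] [BorelSpace X]
  {F : Type*} [NormedAddCommGroup F] [NormedSpace ℝ F] [FiniteDimensional ℝ F]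
  {E : X → Type*} [TopologicalSpace (TotalSpace F E)] [∀ x, NormedAddCommGroup (E x)]
  [∀ x, InnerProductSpace ℝ (E x)] [FiberBundle F E] [VectorBundle ℝ F E]
  [ContMDiffVectorBundle ∞ F E (𝓡 n)] [IsContMDiffRiemannianBundle (𝓡 n) ∞ F E]
  {A : CovariantDerivative (𝓡 n) F E} {R d p : ℝ}

lemma sectionENorm_zero (hp : 0 < p) : sectionENorm n R d p (0 : Π x : X, E x) = 0 := by
  simpa [sectionENorm] using morreyENorm_zero hp

lemma sectionENorm_smul (hp : 0 < p) (c : ℝ) (s : Π x : X, E x) :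
    sectionENorm n R d p (c • s) = ‖c‖ₑ * sectionENorm n R d p s := by
  simp only [sectionENorm, Pi.smul_apply, enorm_smul]
  exact morreyENorm_const_mul hp enorm_ne_top _

lemma sectionENorm_add_le (hp : 1 ≤ p) {s s' : Π x : X, E x} (hs : AEMeasurableSection n F s)
    (hs' : AEMeasurableSection n F s') :
    sectionENorm n R d p (s + s') ≤ sectionENorm n R d p s + sectionENorm n R d p s' :=
  (morreyENorm_mono (zero_le_one.trans hp) fun _ => enorm_add_le _ _).trans
    (morreyENorm_add_le hp hs.aemeasurable_enorm hs'.aemeasurable_enorm)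

lemma homSectionENorm_zero (hp : 0 < p) :
    homSectionENorm R d p (0 : Π x : X, TangentSpace (𝓡 n) x →L[ℝ] E x) = 0 := by
  simpa [homSectionENorm, hsNorm_zero] using morreyENorm_zero hp

lemma homSectionENorm_smul (hp : 0 < p) (c : ℝ) (t : Π x : X, TangentSpace (𝓡 n) x →L[ℝ] E x) :
    homSectionENorm R d p (c • t) = ‖c‖ₑ * homSectionENorm R d p t := by
  simp only [homSectionENorm, Pi.smul_apply, hsNorm_smul, ENNReal.ofReal_mul (abs_nonneg c),
    ← Real.enorm_eq_ofReal_abs]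
  exact morreyENorm_const_mul hp enorm_ne_top _

lemma homSectionENorm_add_le (hp : 1 ≤ p) {t t' : Π x : X, TangentSpace (𝓡 n) x →L[ℝ] E x}
    (ht : AEMeasurableHomSection F t) (ht' : AEMeasurableHomSection F t') :
    homSectionENorm R d p (t + t') ≤ homSectionENorm R d p t + homSectionENorm R d p t' :=
  (morreyENorm_mono (zero_le_one.trans hp) fun _ =>
    (ENNReal.ofReal_le_ofReal (hsNorm_add_le _ _)).trans ENNReal.ofReal_add_le).trans
    (morreyENorm_add_le hp ht.aemeasurable_hsNorm ht'.aemeasurable_hsNorm)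

lemma sobolevENorm_ne_top (hp : 0 < p)
    {st : (Π x : X, E x) × (Π x : X, TangentSpace (𝓡 n) x →L[ℝ] E x)} :
    sobolevENorm R d p st ≠ ⊤ ↔
      sectionENorm n R d p st.1 ≠ ⊤ ∧ homSectionENorm R d p st.2 ≠ ⊤ := by
  simp [sobolevENorm, ENNReal.rpow_eq_top_iff, hp, not_lt.2 hp.le]

lemma AEMeasurableSection.zero : AEMeasurableSection n F (0 : Π x : X, E x) := fun x₀ => by
  simpa [fiberCoord_zero] using aestronglyMeasurable_const

lemma AEMeasurableSection.add {s s' : Π x : X, E x} (hs : AEMeasurableSection n F s)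
    (hs' : AEMeasurableSection n F s') : AEMeasurableSection n F (s + s') := fun x₀ => by
  simpa only [Pi.add_apply, fiberCoord_add] using! (hs x₀).add (hs' x₀)

lemma AEMeasurableSection.smul (c : ℝ) {s : Π x : X, E x} (hs : AEMeasurableSection n F s) :
    AEMeasurableSection n F (c • s) := fun x₀ => by
  simpa only [Pi.smul_apply, fiberCoord_smul] using! (hs x₀).const_smul c

lemma AEMeasurableHomSection.zero :
    AEMeasurableHomSection F (0 : Π x : X, TangentSpace (𝓡 n) x →L[ℝ] E x) := fun x₀ v => by
  simpa [fiberCoord_zero] using aestronglyMeasurable_const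

lemma AEMeasurableHomSection.add {t t' : Π x : X, TangentSpace (𝓡 n) x →L[ℝ] E x}
    (ht : AEMeasurableHomSection F t) (ht' : AEMeasurableHomSection F t') :
    AEMeasurableHomSection F (t + t') := fun x₀ v => by
  simpa only [Pi.add_apply, add_apply, fiberCoord_add] using! (ht x₀ v).add (ht' x₀ v)

lemma AEMeasurableHomSection.smul (c : ℝ) {t : Π x : X, TangentSpace (𝓡 n) x →L[ℝ] E x}
    (ht : AEMeasurableHomSection F t) : AEMeasurableHomSection F (c • t) := fun x₀ v => by
  simpa only [Pi.smul_apply, smul_apply, fiberCoord_smul] using! (ht x₀ v).const_smul c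

lemma sobolevENorm_zero (hp : 0 < p) :
    sobolevENorm R d p (0 : (Π x : X, E x) × (Π x : X, TangentSpace (𝓡 n) x →L[ℝ] E x)) = 0 := by
  simp [sobolevENorm, sectionENorm_zero hp, homSectionENorm_zero hp, hp]

lemma sobolevENorm_smul (hp : 0 < p) (c : ℝ)
    (st : (Π x : X, E x) × (Π x : X, TangentSpace (𝓡 n) x →L[ℝ] E x)) :
    sobolevENorm R d p (c • st) = ‖c‖ₑ * sobolevENorm R d p st := by
  simp only [sobolevENorm, Prod.smul_fst, Prod.smul_snd, sectionENorm_smul hp,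
    homSectionENorm_smul hp, ENNReal.mul_rpow_of_nonneg _ _ hp.le, ← mul_add]
  rw [ENNReal.mul_rpow_of_nonneg _ _ (by positivity), ← ENNReal.rpow_mul,
    mul_one_div_cancel hp.ne', ENNReal.rpow_one]

lemma sobolevENorm_add_le (hp : 1 ≤ p)
    {st st' : (Π x : X, E x) × (Π x : X, TangentSpace (𝓡 n) x →L[ℝ] E x)}
    (hs : AEMeasurableSection n F st.1) (hs' : AEMeasurableSection n F st'.1)
    (ht : AEMeasurableHomSection F st.2) (ht' : AEMeasurableHomSection F st'.2) :
    sobolevENorm R d p (st + st') ≤ sobolevENorm R d p st + sobolevENorm R d p st' := by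
  have h := ENNReal.Lp_add_le (Finset.univ : Finset (Fin 2))
    ![sectionENorm n R d p st.1, homSectionENorm R d p st.2]
    ![sectionENorm n R d p st'.1, homSectionENorm R d p st'.2] hp
  simp only [Fin.sum_univ_two, Matrix.cons_val_zero, Matrix.cons_val_one] at h
  refine le_trans ?_ h
  have hp0 : 0 ≤ p := zero_le_one.trans hp
  refine ENNReal.rpow_le_rpow (add_le_add ?_ ?_) (by positivity)
  · exact ENNReal.rpow_le_rpow (sectionENorm_add_le hp hs hs') hp0
  · exact ENNReal.rpow_le_rpow (homSectionENorm_add_le hp ht ht') hp0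

variable (n F E R d) in
/-- The sections of `E` that represent the elements of `L^p_d(X, E)`. -/
def lpSubmodule (p : ℝ) (hp : 1 ≤ p) : Submodule ℝ (Π x : X, E x) where
  carrier := {s | AEMeasurableSection n F s ∧ sectionENorm n R d p s < ⊤}
  zero_mem' := ⟨.zero, by simp [sectionENorm_zero (zero_lt_one.trans_le hp)]⟩
  add_mem' h h' := ⟨h.1.add h'.1,
    (sectionENorm_add_le hp h.1 h'.1).trans_lt (ENNReal.add_lt_top.2 ⟨h.2, h'.2⟩)⟩
  smul_mem' c _ h := ⟨h.1.smul c, by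
    rw [sectionENorm_smul (zero_lt_one.trans_le hp)]
    exact ENNReal.mul_lt_top enorm_lt_top h.2⟩

variable (A R d) in
/-- The pairs `(s, t)` of a section `s` of `E` and its weak covariant derivative `t = ∇_A s` that
represent the elements of `L^{1,p}_d(X, E)`. -/
def sobolevSubmodule (p : ℝ) (hp : 1 ≤ p) :
    Submodule ℝ ((Π x : X, E x) × (Π x : X, TangentSpace (𝓡 n) x →L[ℝ] E x)) where
  carrier := {st | AEMeasurableSection n F st.1 ∧ AEMeasurableHomSection F st.2 ∧
    IsWeakCovDeriv A st.1 st.2 ∧ sobolevENorm R d p st < ⊤}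
  zero_mem' := ⟨.zero, .zero, .zero, by simp [sobolevENorm_zero (zero_lt_one.trans_le hp)]⟩
  add_mem' h h' := ⟨h.1.add h'.1, h.2.1.add h'.2.1, h.2.2.1.add h'.2.2.1,
    (sobolevENorm_add_le hp h.1 h'.1 h.2.1 h'.2.1).trans_lt
      (ENNReal.add_lt_top.2 ⟨h.2.2.2, h'.2.2.2⟩)⟩
  smul_mem' c _ h := ⟨h.1.smul c, h.2.1.smul c, h.2.2.1.smul c, by
    rw [sobolevENorm_smul (zero_lt_one.trans_le hp)]
    exact ENNReal.mul_lt_top enorm_lt_top h.2.2.2⟩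

variable (n F E R d) in
/-- The space of representatives of elements of `L^p_d(X, E)`, with the seminorm
`‖s‖_{L^p_d(X, E)}`. -/
def LpSections (p : ℝ) (hp : 1 ≤ p) : Type _ := lpSubmodule n F E R d p hp

variable (A R d) in
/-- The space of representatives of elements of `L^{1,p}_d(X, E)`, with the seminorm
`‖s‖_{L^{1,p}_{d,A}(X, E)}`. -/
def SobolevSections (p : ℝ) (hp : 1 ≤ p) : Type _ := sobolevSubmodule A R d p hp

variable {hp : 1 ≤ p}

instance : AddCommGroup (LpSections n F E R d p hp) :=
  inferInstanceAs (AddCommGroup (lpSubmodule n F E R d p hp))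

instance : Module ℝ (LpSections n F E R d p hp) :=
  inferInstanceAs (Module ℝ (lpSubmodule n F E R d p hp))

instance : AddCommGroup (SobolevSections A R d p hp) :=
  inferInstanceAs (AddCommGroup (sobolevSubmodule A R d p hp))

instance : Module ℝ (SobolevSections A R d p hp) :=
  inferInstanceAs (Module ℝ (sobolevSubmodule A R d p hp))

instance : SeminormedAddCommGroup (LpSections n F E R d p hp) :=
  AddGroupSeminorm.toSeminormedAddCommGroup
    { toFun := fun s => (sectionENorm n R d p s.1).toReal
      map_zero' := by
        change (sectionENorm n R d p (0 : Π x : X, E x)).toReal = 0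
        simp [sectionENorm_zero (zero_lt_one.trans_le hp)]
      add_le' := fun s s' => by
        change (sectionENorm n R d p (s.1 + s'.1)).toReal ≤ _
        rw [← ENNReal.toReal_add s.2.2.ne s'.2.2.ne]
        exact ENNReal.toReal_mono (ENNReal.add_ne_top.2 ⟨s.2.2.ne, s'.2.2.ne⟩)
          (sectionENorm_add_le hp s.2.1 s'.2.1)
      neg' := fun s => by
        change (sectionENorm n R d p (-s.1)).toReal = _
        rw [← neg_one_smul ℝ s.1, sectionENorm_smul (zero_lt_one.trans_le hp)]
        simp }

lemma LpSections.norm_def (s : LpSections n F E R d p hp) :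
    ‖s‖ = (sectionENorm n R d p s.1).toReal := rfl

instance : NormedSpace ℝ (LpSections n F E R d p hp) where
  norm_smul_le c s := by
    rw [LpSections.norm_def, LpSections.norm_def]
    change (sectionENorm n R d p (c • s.1)).toReal ≤ _
    simp [sectionENorm_smul (zero_lt_one.trans_le hp)]

instance : SeminormedAddCommGroup (SobolevSections A R d p hp) :=
  AddGroupSeminorm.toSeminormedAddCommGroup
    { toFun := fun s => (sobolevENorm R d p s.1).toReal
      map_zero' := by
        change (sobolevENorm R d p
          (0 : (Π x : X, E x) × (Π x : X, TangentSpace (𝓡 n) x →L[ℝ] E x))).toReal = 0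
        simp [sobolevENorm_zero (zero_lt_one.trans_le hp)]
      add_le' := fun s s' => by
        change (sobolevENorm R d p (s.1 + s'.1)).toReal ≤ _
        rw [← ENNReal.toReal_add s.2.2.2.2.ne s'.2.2.2.2.ne]
        exact ENNReal.toReal_mono (ENNReal.add_ne_top.2 ⟨s.2.2.2.2.ne, s'.2.2.2.2.ne⟩)
          (sobolevENorm_add_le hp s.2.1 s'.2.1 s.2.2.1 s'.2.2.1)
      neg' := fun s => by
        change (sobolevENorm R d p (-s.1)).toReal = _
        rw [← neg_one_smul ℝ s.1, sobolevENorm_smul (zero_lt_one.trans_le hp)]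
        simp }

lemma SobolevSections.norm_def (s : SobolevSections A R d p hp) :
    ‖s‖ = (sobolevENorm R d p s.1).toReal := rfl

instance : NormedSpace ℝ (SobolevSections A R d p hp) where
  norm_smul_le c s := by
    rw [SobolevSections.norm_def, SobolevSections.norm_def]
    change (sobolevENorm R d p (c • s.1)).toReal ≤ _
    simp [sobolevENorm_smul (zero_lt_one.trans_le hp)]

variable (n F E R d) in
/-- The Morrey space `L^p_d(X, E)`, as a normed space (sections that agree almost everywhere are
identified). The radii in the norm are those up to `R`. -/
abbrev MorreyLp (p : ℝ) (hp : 1 ≤ p) : Type _ := SeparationQuotient (LpSections n F E R d p hp)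

variable (A R d) in
/-- The Morrey space `L^{1,p}_d(X, E)`, as a normed space with the norm defined by the connection
`A` (sections that agree almost everywhere are identified). -/
abbrev MorreySobolev (p : ℝ) (hp : 1 ≤ p) : Type _ :=
  SeparationQuotient (SobolevSections A R d p hp)

variable (R d) in
/-- The element of `L^p_d(X, E)` that is represented by the section `s`. -/
def MorreyLp.mk (hp : 1 ≤ p) (s : Π x : X, E x) (hs : s ∈ lpSubmodule n F E R d p hp) :
    MorreyLp n F E R d p hp :=
  SeparationQuotient.mk (⟨s, hs⟩ : lpSubmodule n F E R d p hp)

variable (R d) in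
/-- The element of `L^{1,p}_d(X, E)` that is represented by the section `s` with weak covariant
derivative `t`. -/
def MorreySobolev.mk (hp : 1 ≤ p) (s : Π x : X, E x)
    (t : Π x : X, TangentSpace (𝓡 n) x →L[ℝ] E x) (h : (s, t) ∈ sobolevSubmodule A R d p hp) :
    MorreySobolev A R d p hp :=
  SeparationQuotient.mk (⟨(s, t), h⟩ : sobolevSubmodule A R d p hp)

lemma MorreyLp.norm_mk (s : Π x : X, E x) (hs : s ∈ lpSubmodule n F E R d p hp) :
    ‖MorreyLp.mk R d hp s hs‖ = (sectionENorm n R d p s).toReal := rfl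

lemma MorreySobolev.norm_mk (s : Π x : X, E x) (t : Π x : X, TangentSpace (𝓡 n) x →L[ℝ] E x)
    (h : (s, t) ∈ sobolevSubmodule A R d p hp) :
    ‖MorreySobolev.mk R d hp s t h‖ = (sobolevENorm R d p (s, t)).toReal := rfl

end Spaces

end Morrey

end

/-! In a chart and a trivialization, a Sobolev section becomes an `F`-valued function u whose weak
gradient g obeys a Morrey bound ∫_{B_ρ} |g|^p ≤ M^p ρ^{n-d}. Let u_r be the mollification of u at
scale r. The derivative in r of the kernel r^{-n} φ(x/r) is a divergence, so integration by parts
bounds |u_r - u_{r/2}| by C r times the average of |g| over B_r (`enorm_mollify_sub_le`). Hölder's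
inequality makes this a pointwise bound C M r^{1-d/p}. Tonelli's theorem gives a better bound in the
mean: the integral of |u_r - u_{r/2}|^p over B_ρ is at most C M^p r^p ρ^{n-d}. Interpolation between
the two bounds the L^q norm on B_ρ, for q ≥ p, by C M r^θ ρ^{(n-d)/q} with θ = 1 - d/p + d/q
(`setLIntegral_rpow_le_of_morrey_of_le`).

The condition q < p* says exactly that θ > 0. The differences over the scales r, r/2, r/4, ...
therefore sum to a geometric series, and u_r approximates u in the Morrey norm with error O(r^θ M)
(`eLpNorm'_mollify_sub_le`). For fixed r the functions u_r are Lipschitz with a constant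
proportional to the L¹ norm of u, so they are controlled, up to a small multiple of M, by their
values on a finite net. These values are finitely many linear maps of u, whence
`exists_local_estimate`; exponents q < p follow from q = p by Hölder.

To return to X, distances, volume, fiber norms and derivatives are compared with the Euclidean ones
near each point (`exists_isComparisonBall`). A finite cover then gives an Ehrling inequality: for
every ε, the L^q_d norm of s is at most ε times its Sobolev norm plus the norms of finitely many
vector-valued functionals (`exists_sectionENorm_le`). With ε = 1 this is boundedness of the
inclusion. With all ε it shows that the image of the unit ball is totally bounded, hence relatively
compact because L^q_d is complete (`LpSections.instCompleteSpace`).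

Injectivity is the uniqueness of weak derivatives: elements of the Sobolev space are classes of
pairs (s, ∇s), and s = 0 almost everywhere forces ∇s = 0 almost everywhere. -/

set_option linter.unusedSectionVars false

noncomputable section

namespace Morrey

/-! ### Mollification in `ℝⁿ` -/

section Mollifier

variable (n : ℕ)

/-- A smooth function of integral `1` with support in the unit ball. -/
def mollifier : EuclideanSpace ℝ (Fin n) → ℝ :=
  (⟨1 / 2, 1, by norm_num, by norm_num⟩ : ContDiffBump (0 : EuclideanSpace ℝ (Fin n))).normed volume

lemma contDiff_mollifier : ContDiff ℝ ∞ (mollifier n) := ContDiffBump.contDiff_normed _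

lemma mollifier_nonneg (x) : 0 ≤ mollifier n x := ContDiffBump.nonneg_normed _ _

lemma integral_mollifier : ∫ x, mollifier n x = 1 := ContDiffBump.integral_normed _

lemma support_mollifier : Function.support (mollifier n) = Metric.ball 0 1 :=
  ContDiffBump.support_normed_eq _

lemma hasCompactSupport_mollifier : HasCompactSupport (mollifier n) :=
  ContDiffBump.hasCompactSupport_normed _

variable {n} in
lemma mollifier_eq_zero {x : EuclideanSpace ℝ (Fin n)} (hx : 1 ≤ ‖x‖) : mollifier n x = 0 := by
  by_contra h
  have : x ∈ Function.support (mollifier n) := h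
  rw [support_mollifier, mem_ball_zero_iff] at this
  linarith

lemma continuous_mollifier : Continuous (mollifier n) := (contDiff_mollifier n).continuous

lemma exists_mollifier_le : ∃ K > 0, ∀ x, mollifier n x ≤ K := by
  obtain ⟨K, hK⟩ := (continuous_mollifier n).bounded_above_of_compact_support
    (hasCompactSupport_mollifier n)
  exact ⟨max K 1, by positivity, fun x => ((le_abs_self _).trans (hK x)).trans (le_max_left _ _)⟩

/-- The divergence of the vector field `y ↦ φ(y) y`, where `φ` is the mollifier. -/
def radialDiv (y : EuclideanSpace ℝ (Fin n)) : ℝ := n * mollifier n y + fderiv ℝ (mollifier n) y y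

lemma continuous_radialDiv : Continuous (radialDiv n) := by
  have := (contDiff_mollifier n).continuous_fderiv (by simp)
  have h2 := continuous_mollifier n
  unfold radialDiv
  fun_prop

lemma exists_abs_radialDiv_le : ∃ K, ∀ x, |radialDiv n x| ≤ K := by
  refine (continuous_radialDiv n).bounded_above_of_compact_support ?_
  refine (hasCompactSupport_mollifier n).mul_left.add ?_
  refine (hasCompactSupport_mollifier n).fderiv (𝕜 := ℝ) |>.mono ?_
  intro x hx h0
  apply hx
  simp [h0]

lemma exists_norm_fderiv_mollifier_le : ∃ K, 0 ≤ K ∧ ∀ x, ‖fderiv ℝ (mollifier n) x‖ ≤ K := by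
  obtain ⟨K, hK⟩ :=
    ((contDiff_mollifier n).continuous_fderiv (by simp)).bounded_above_of_compact_support
    ((hasCompactSupport_mollifier n).fderiv (𝕜 := ℝ))
  exact ⟨K, (norm_nonneg _).trans (hK 0), hK⟩

/-- The kernel `s⁻ⁿ φ(x / s)` of the mollification at scale `s`. -/
def mollKernel (s : ℝ) (x : EuclideanSpace ℝ (Fin n)) : ℝ := (s ^ n)⁻¹ * mollifier n (s⁻¹ • x)

variable {n}

lemma continuous_mollKernel (s : ℝ) : Continuous (mollKernel n s) := by
  have h2 := continuous_mollifier n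
  unfold mollKernel
  fun_prop

lemma mollKernel_nonneg {s : ℝ} (hs : 0 < s) (x) : 0 ≤ mollKernel n s x :=
  mul_nonneg (by positivity) (mollifier_nonneg n _)

lemma mollKernel_eq_zero {s : ℝ} (hs : 0 < s) {x : EuclideanSpace ℝ (Fin n)} (hx : s ≤ ‖x‖) :
    mollKernel n s x = 0 := by
  rw [mollKernel, mollifier_eq_zero, mul_zero]
  rw [norm_smul, norm_inv, Real.norm_of_nonneg hs.le, ← div_eq_inv_mul, le_div_iff₀ hs]
  linarith

lemma integral_mollKernel {s : ℝ} (hs : 0 < s) : ∫ x, mollKernel n s x = 1 := by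
  unfold mollKernel
  rw [integral_const_mul, Measure.integral_comp_smul, integral_mollifier]
  simp only [finrank_euclideanSpace, Fintype.card_fin, smul_eq_mul, mul_one]
  rw [abs_of_pos (by positivity), inv_pow, inv_inv, inv_mul_cancel₀ (by positivity)]

/-- Changing the scale moves mass along the radial field: the derivative of the kernel in s is, up
to a power of s, minus the divergence of φ(y) y at y = x/s. This divergence form is what permits
integration by parts below. -/
lemma hasDerivAt_mollKernel {s : ℝ} (hs : s ≠ 0) (x : EuclideanSpace ℝ (Fin n)) :
    HasDerivAt (fun s => mollKernel n s x) (-((s ^ (n + 1))⁻¹ * radialDiv n (s⁻¹ • x))) s := by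
  have h1 : HasDerivAt (fun s : ℝ => s⁻¹ • x) ((-(s ^ 2)⁻¹) • x) s :=
    (hasDerivAt_inv hs).smul_const x
  have h2 : HasFDerivAt (mollifier n) (fderiv ℝ (mollifier n) (s⁻¹ • x)) (s⁻¹ • x) :=
    ((contDiff_mollifier n).differentiable (by simp) _).hasFDerivAt
  have h3 := h2.comp_hasDerivAt s h1
  have h4 := ((hasDerivAt_pow n s).fun_inv (pow_ne_zero n hs)).mul h3
  refine h4.congr_deriv ?_
  simp only [radialDiv, map_smul, smul_eq_mul, Function.comp]
  -- The derivative of `s ^ n` contains the truncated exponent `n - 1`, so dimension zero is treated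
  -- apart.
  rcases n with _ | m
  · simp; field_simp
  · simp only [Nat.add_sub_cancel]; field_simp; ring

/-- The mollification at scale `s` of the restriction of `u` to `Ω`. -/
def mollify {F : Type*} [NormedAddCommGroup F] [NormedSpace ℝ F]
    (Ω : Set (EuclideanSpace ℝ (Fin n)))
    (u : EuclideanSpace ℝ (Fin n) → F) (s : ℝ) (z : EuclideanSpace ℝ (Fin n)) : F :=
  ∫ w in Ω, mollKernel n s (z - w) • u w

/-- The test function `w ↦ (z - w)ᵢ φ((z - w) / s)`. -/
def radialTest (s : ℝ) (z : EuclideanSpace ℝ (Fin n)) (i : Fin n) (w : EuclideanSpace ℝ (Fin n)) :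
    ℝ := (z - w) i * mollifier n (s⁻¹ • (z - w))

lemma contDiff_radialTest (s : ℝ) (z) (i : Fin n) : ContDiff ℝ ∞ (radialTest s z i) := by
  have := contDiff_mollifier n
  unfold radialTest
  refine ContDiff.mul ?_ (this.comp (by fun_prop))
  have h : (fun w : EuclideanSpace ℝ (Fin n) => (z - w) i)
    = fun w => EuclideanSpace.proj (𝕜 := ℝ) i (z - w) := rfl
  rw [h]
  fun_prop

lemma radialTest_eq_zero {s : ℝ} (hs : 0 < s) {z w : EuclideanSpace ℝ (Fin n)} (hw : s ≤ ‖z - w‖)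
    (i : Fin n) : radialTest s z i w = 0 := by
  rw [radialTest, mollifier_eq_zero, mul_zero]
  rw [norm_smul, norm_inv, Real.norm_of_nonneg hs.le, ← div_eq_inv_mul, le_div_iff₀ hs]
  linarith

lemma tsupport_radialTest_subset {s : ℝ} (hs : 0 < s) (z : EuclideanSpace ℝ (Fin n)) (i : Fin n) :
    tsupport (radialTest s z i) ⊆ Metric.closedBall z s := by
  refine closure_minimal (fun w hw => ?_) Metric.isClosed_closedBall
  by_contra h
  refine hw (radialTest_eq_zero hs ?_ i)
  rw [Metric.mem_closedBall, dist_comm, dist_eq_norm] at h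
  linarith

lemma hasCompactSupport_radialTest {s : ℝ} (hs : 0 < s) (z : EuclideanSpace ℝ (Fin n)) (i : Fin n) :
    HasCompactSupport (radialTest s z i) :=
  HasCompactSupport.of_support_subset_isCompact (isCompact_closedBall z s)
    ((subset_tsupport _).trans (tsupport_radialTest_subset hs z i))

lemma fderiv_radialTest (s : ℝ) (z w : EuclideanSpace ℝ (Fin n)) (i : Fin n) :
    fderiv ℝ (radialTest s z i) w (EuclideanSpace.basisFun (Fin n) ℝ i) =
      -mollifier n (s⁻¹ • (z - w)) - (s⁻¹ • (z - w)) i *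
        fderiv ℝ (mollifier n) (s⁻¹ • (z - w)) (EuclideanSpace.basisFun (Fin n) ℝ i) := by
  have h1 : HasFDerivAt (fun w : EuclideanSpace ℝ (Fin n) => (z - w) i)
      (-(EuclideanSpace.proj (𝕜 := ℝ) i)) w := by
    have := (EuclideanSpace.proj (𝕜 := ℝ) i).hasFDerivAt (x := z - w) |>.comp w
      ((hasFDerivAt_id w).const_sub z)
    refine this.congr_fderiv ?_
    ext v; simp
  have h2 : HasFDerivAt (fun w => s⁻¹ • (z - w)) (s⁻¹ • (-ContinuousLinearMap.id ℝ _)) w :=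
    ((hasFDerivAt_id w).const_sub z).const_smul s⁻¹
  have h3 : HasFDerivAt (mollifier n) (fderiv ℝ (mollifier n) (s⁻¹ • (z - w))) (s⁻¹ • (z - w)) :=
    ((contDiff_mollifier n).differentiable (by simp) _).hasFDerivAt
  have h4 := h1.mul (h3.comp w h2)
  have h5 : fderiv ℝ (radialTest s z i) w = _ := h4.fderiv
  rw [h5]
  simp
  ring

/-- The sign is negative because the test functions are differentiated in w, while they depend on z
- w. -/
lemma sum_fderiv_radialTest (s : ℝ) (z w : EuclideanSpace ℝ (Fin n)) :
    ∑ i, fderiv ℝ (radialTest s z i) w (EuclideanSpace.basisFun (Fin n) ℝ i) =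
      -radialDiv n (s⁻¹ • (z - w)) := by
  simp only [fderiv_radialTest]
  set y := s⁻¹ • (z - w)
  have : fderiv ℝ (mollifier n) y y = ∑ i, y i *
      fderiv ℝ (mollifier n) y (EuclideanSpace.basisFun (Fin n) ℝ i) := by
    conv_lhs => rw [← (EuclideanSpace.basisFun (Fin n) ℝ).sum_repr y]
    rw [map_sum]
    -- The first rewrite also expanded the base point of the derivative; this folds it back to y.
    conv_lhs => rw [(EuclideanSpace.basisFun (Fin n) ℝ).sum_repr y]
    simp
  rw [radialDiv, this, Finset.sum_sub_distrib]
  simp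
  ring

/-- On the support of the mollifier factor, |z - w| < s. This factor s is the power of the scale
gained over the kernel itself. -/
lemma abs_radialTest_le {K : ℝ} (hK : ∀ x, mollifier n x ≤ K) {s : ℝ} (hs : 0 < s)
    (z w : EuclideanSpace ℝ (Fin n)) (i : Fin n) : |radialTest s z i w| ≤ s * K := by
  have hK0 := (mollifier_nonneg n 0).trans (hK 0)
  rcases le_or_gt s ‖z - w‖ with h | h
  · rw [radialTest_eq_zero hs h, abs_zero]; positivity
  · rw [radialTest, abs_mul, abs_of_nonneg (mollifier_nonneg n _)]
    have : |(z - w) i| ≤ ‖z - w‖ := PiLp.norm_apply_le (z - w) i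
    exact mul_le_mul (by linarith) (hK _) (mollifier_nonneg n _) hs.le

end Mollifier

/-! ### Dependence of the mollification on the scale, and convergence almost everywhere -/

section MollifyDeriv

variable {n : ℕ} {F : Type*} [NormedAddCommGroup F] [NormedSpace ℝ F]

/-- `g i` is the weak partial derivative `∂ᵢ u` on `Ω`. -/
structure HasWeakPartials (Ω : Set (EuclideanSpace ℝ (Fin n))) (u : EuclideanSpace ℝ (Fin n) → F)
    (g : Fin n → EuclideanSpace ℝ (Fin n) → F) : Prop where
  locallyIntegrableOn : ∀ i, LocallyIntegrableOn (g i) Ω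
  integral_eq : ∀ (i : Fin n) (η : EuclideanSpace ℝ (Fin n) → ℝ), ContDiff ℝ ∞ η →
    HasCompactSupport η → tsupport η ⊆ Ω →
    ∫ z in Ω, (fderiv ℝ η z (EuclideanSpace.basisFun (Fin n) ℝ i)) • u z = - ∫ z in Ω, η z • g i z

variable {Ω : Set (EuclideanSpace ℝ (Fin n))} {u : EuclideanSpace ℝ (Fin n) → F}

lemma integrable_continuous_bounded_smul (hu : IntegrableOn u Ω)
    {k : EuclideanSpace ℝ (Fin n) → ℝ} (hk : Continuous k) {C : ℝ} (hC : ∀ x, |k x| ≤ C) :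
    IntegrableOn (fun w => k w • u w) Ω :=
  Integrable.bdd_smul hu C hk.aestronglyMeasurable (ae_of_all _ hC)

lemma exists_abs_mollKernel_le {s : ℝ} (hs : 0 < s) : ∃ C, 0 ≤ C ∧ ∀ x, |mollKernel n s x| ≤ C := by
  obtain ⟨K, hK0, hK⟩ := exists_mollifier_le n
  refine ⟨(s ^ n)⁻¹ * K, by positivity, fun x => ?_⟩
  rw [abs_of_nonneg (mollKernel_nonneg hs x), mollKernel]
  gcongr
  exact hK _

lemma integrableOn_mollKernel_smul (hu : IntegrableOn u Ω) {s : ℝ} (hs : 0 < s) (z) :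
    IntegrableOn (fun w => mollKernel n s (z - w) • u w) Ω := by
  obtain ⟨C, -, hC⟩ := exists_abs_mollKernel_le (n := n) hs
  exact integrable_continuous_bounded_smul hu
    ((continuous_mollKernel s).comp (by fun_prop)) fun x => hC _

lemma hasDerivAt_mollify (hu : IntegrableOn u Ω) {s : ℝ} (hs : 0 < s) (z) :
    HasDerivAt (fun s => mollify Ω u s z)
      (∫ w in Ω, (-((s ^ (n + 1))⁻¹ * radialDiv n (s⁻¹ • (z - w)))) • u w) s := by
  obtain ⟨K, hK⟩ := exists_abs_radialDiv_le n
  have hK0 : 0 ≤ K := (abs_nonneg _).trans (hK 0)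
  -- Scales above s/2 stay away from zero, so the derivative of the kernel is bounded there by one
  -- constant, and that constant times ‖u‖ dominates.
  refine (hasDerivAt_integral_of_dominated_loc_of_deriv_le (s := Ioi (s / 2))
    (bound := fun w => (((s / 2) ^ (n + 1))⁻¹ * K) * ‖u w‖)
    (F := fun s w => mollKernel n s (z - w) • u w)
    (F' := fun s w => (-((s ^ (n + 1))⁻¹ * radialDiv n (s⁻¹ • (z - w)))) • u w)
    (Ioi_mem_nhds (by linarith)) ?_ ?_ ?_ ?_ ?_ ?_).2
  · filter_upwards [Ioi_mem_nhds hs] with t ht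
    exact (integrableOn_mollKernel_smul hu ht z).aestronglyMeasurable
  · exact integrableOn_mollKernel_smul hu hs z
  · refine AEStronglyMeasurable.smul (Continuous.aestronglyMeasurable ?_) hu.aestronglyMeasurable
    have := continuous_radialDiv n
    fun_prop
  · refine ae_of_all _ fun w t (ht : s / 2 < t) => ?_
    have ht0 : 0 < t := by linarith
    rw [norm_smul]
    gcongr
    rw [norm_neg, norm_mul, norm_inv, norm_pow, Real.norm_of_nonneg ht0.le]
    gcongr
    exact hK _
  · exact hu.norm.const_mul _
  · refine ae_of_all _ fun w t (ht : s / 2 < t) => ?_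
    have ht0 : t ≠ 0 := by linarith
    exact (hasDerivAt_mollKernel ht0 (z - w)).smul_const (u w)

variable {g : Fin n → EuclideanSpace ℝ (Fin n) → F}

/-- This is integration by parts: the left kernel is minus the sum of the i-th partial derivatives
of the i-th radial test functions. The closed ball must lie in Ω for these functions to be
admissible. -/
lemma integral_radialDiv_smul (hu : IntegrableOn u Ω) (hg : HasWeakPartials Ω u g) {s : ℝ}
    (hs : 0 < s) {z} (hz : Metric.closedBall z s ⊆ Ω) :
    ∫ w in Ω, radialDiv n (s⁻¹ • (z - w)) • u w =
      ∑ i, ∫ w in Ω, radialTest s z i w • g i w := by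
  have h (i) := hg.integral_eq i (radialTest s z i) (contDiff_radialTest s z i)
    (hasCompactSupport_radialTest hs z i) ((tsupport_radialTest_subset hs z i).trans hz)
  have h2 : ∀ w, radialDiv n (s⁻¹ • (z - w)) • u w = -∑ i, fderiv ℝ (radialTest s z i) w
      (EuclideanSpace.basisFun (Fin n) ℝ i) • u w := by
    intro w
    rw [← Finset.sum_smul, sum_fderiv_radialTest, neg_smul, neg_neg]
  simp_rw [h2]
  rw [integral_neg, integral_finsetSum, Finset.sum_congr rfl fun i _ => h i,
    Finset.sum_neg_distrib, neg_neg]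
  intro i _
  have hc := (contDiff_radialTest s z i).continuous_fderiv (by simp)
  have hc' : Continuous fun w => fderiv ℝ (radialTest s z i) w
    (EuclideanSpace.basisFun (Fin n) ℝ i) := by fun_prop
  obtain ⟨C, hC⟩ := hc'.bounded_above_of_compact_support
    ((hasCompactSupport_radialTest hs z i).fderiv_apply ℝ _)
  exact integrable_continuous_bounded_smul hu hc' hC

/-- The test functions have size s K, which lowers the power s^{-(n+1)} to s^{-n}. The scale
derivative is thus bounded by a multiple of the average of the weak gradient. -/
lemma enorm_deriv_mollify_le {K : ℝ} (hK : ∀ x, mollifier n x ≤ K) (hΩ : MeasurableSet Ω)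
    (hu : IntegrableOn u Ω) (hg : HasWeakPartials Ω u g) {s : ℝ}
    (hs : 0 < s) {z} (hz : Metric.closedBall z s ⊆ Ω) :
    ‖∫ w in Ω, (-((s ^ (n + 1))⁻¹ * radialDiv n (s⁻¹ • (z - w)))) • u w‖ₑ ≤
      ENNReal.ofReal ((s ^ n)⁻¹ * K) *
        ∫⁻ w in Metric.ball z s, Ω.indicator (fun w => ∑ i, ‖g i w‖ₑ) w := by
  have hK0 : 0 ≤ K := (mollifier_nonneg n 0).trans (hK 0)
  simp_rw [← neg_mul, mul_smul]
  rw [integral_smul, integral_radialDiv_smul hu hg hs hz, enorm_smul]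
  have h1 : ∀ i, ‖∫ w in Ω, radialTest s z i w • g i w‖ₑ ≤
      ENNReal.ofReal (s * K) * ∫⁻ w in Metric.ball z s, Ω.indicator (fun w => ‖g i w‖ₑ) w := by
    intro i
    refine (enorm_integral_le_lintegral_enorm _).trans ?_
    rw [← lintegral_const_mul' _ _ ENNReal.ofReal_ne_top, ← lintegral_indicator hΩ,
      ← lintegral_indicator Metric.isOpen_ball.measurableSet]
    refine lintegral_mono fun w => ?_
    by_cases hw : w ∈ Ω
    · by_cases hwb : w ∈ Metric.ball z s
      · simp only [hw, hwb, indicator_of_mem]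
        rw [enorm_smul]
        gcongr
        rw [Real.enorm_eq_ofReal_abs]
        exact ENNReal.ofReal_le_ofReal (abs_radialTest_le hK hs z w i)
      · have : radialTest s z i w = 0 := radialTest_eq_zero hs (by
          rw [Metric.mem_ball, dist_comm, dist_eq_norm] at hwb; linarith) i
        rw [indicator_of_mem hw, this]; simp
    · simp [hw]
  calc _ ≤ ‖-(s ^ (n + 1))⁻¹‖ₑ * ∑ i, (ENNReal.ofReal (s * K) *
          ∫⁻ w in Metric.ball z s, Ω.indicator (fun w => ‖g i w‖ₑ) w) := by
        gcongr
        exact (enorm_sum_le _ _).trans (Finset.sum_le_sum fun i _ => h1 i)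
    _ = _ := ?_
  rw [← Finset.mul_sum, ← mul_assoc, enorm_neg, Real.enorm_of_nonneg (by positivity),
    ← ENNReal.ofReal_mul (by positivity)]
  congr 1
  · congr 1
    field_simp
    ring
  · rw [← lintegral_finsetSum']
    · refine lintegral_congr fun w => ?_
      by_cases hw : w ∈ Ω <;> simp [hw]
    · intro i _
      rw [aemeasurable_indicator_iff hΩ]
      rw [Measure.restrict_restrict hΩ]
      exact (hg.locallyIntegrableOn i).aestronglyMeasurable.enorm.mono_measure
        (Measure.restrict_mono inter_subset_left le_rfl)

/-- The mollifications at the scales `r` and `r / 2` differ by at most `r` times the average of the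
weak gradient. -/
lemma enorm_mollify_sub_le {K : ℝ} (hK : ∀ x, mollifier n x ≤ K) (hΩ : MeasurableSet Ω)
    (hu : IntegrableOn u Ω) (hg : HasWeakPartials Ω u g) {r : ℝ}
    (hr : 0 < r) {z} (hz : Metric.closedBall z r ⊆ Ω) :
    ‖mollify Ω u r z - mollify Ω u (r / 2) z‖ₑ ≤ ENNReal.ofReal (2 ^ n * K * (r * (r ^ n)⁻¹)) *
        ∫⁻ w in Metric.ball z r, Ω.indicator (fun w => ∑ i, ‖g i w‖ₑ) w := by
  have hK0 : 0 < K := by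
    obtain ⟨x, hx⟩ : (Function.support (mollifier n)).Nonempty := by
      rw [support_mollifier]; exact ⟨0, by simp⟩
    exact ((mollifier_nonneg n x).lt_of_ne' hx).trans_le (hK x)
  set I := ∫⁻ w in Metric.ball z r, Ω.indicator (fun w => ∑ i, ‖g i w‖ₑ) w with hI
  -- If the integral is infinite, so is the right side, because its coefficient is strictly
  -- positive; this is why K > 0 was needed. Otherwise one may argue with real numbers.
  rcases eq_or_ne I ⊤ with htop | htop
  · rw [htop, ENNReal.mul_top]
    · exact le_top
    · simp only [ne_eq, ENNReal.ofReal_eq_zero, not_le]; positivity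
  -- Over the whole scale interval, s^{-n} is at most (r/2)^{-n} and the ball of radius s lies in
  -- the one of radius r. The first comparison is the origin of the factor 2^n.
  have hbound : ∀ s ∈ Icc (r / 2) r,
      ‖∫ w in Ω, (-((s ^ (n + 1))⁻¹ * radialDiv n (s⁻¹ • (z - w)))) • u w‖ ≤
        ((r / 2) ^ n)⁻¹ * K * I.toReal := by
    intro s hs
    have hs0 : 0 < s := by linarith [hs.1]
    have h := enorm_deriv_mollify_le hK hΩ hu hg hs0
      ((Metric.closedBall_subset_closedBall hs.2).trans hz)
    rw [← toReal_enorm, ← ENNReal.toReal_ofReal (r := ((r / 2) ^ n)⁻¹ * K) (by positivity),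
      ← ENNReal.toReal_mul]
    refine ENNReal.toReal_mono (ENNReal.mul_ne_top ENNReal.ofReal_ne_top htop) (h.trans ?_)
    gcongr
    · exact hs.1
    · exact lintegral_mono_set (Metric.ball_subset_ball hs.2)
  -- Mean value inequality in the scale. The interval has length r/2, which supplies the factor r
  -- with a factor 1/2 to spare.
  have h := Convex.norm_image_sub_le_of_norm_hasDerivWithin_le (s := Icc (r / 2) r)
    (x := r / 2) (y := r)
    (fun s hs => (hasDerivAt_mollify hu (by linarith [hs.1] : 0 < s) z).hasDerivWithinAt) hbound
    (convex_Icc _ _) ⟨le_rfl, by linarith⟩ ⟨by linarith, le_rfl⟩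
  rw [← ENNReal.ofReal_toReal htop, ← ENNReal.ofReal_mul (by positivity), ← ofReal_norm]
  refine ENNReal.ofReal_le_ofReal (h.trans ?_)
  rw [Real.norm_of_nonneg (by linarith)]
  have : ((r / 2) ^ n)⁻¹ * K * I.toReal * (r - r / 2) =
      (2 ^ n * K * (r * (r ^ n)⁻¹) * I.toReal) / 2 := by
    rw [div_pow]; field_simp; ring
  rw [this]
  refine half_le_self (by positivity)

lemma exists_lipschitz_mollKernel {s : ℝ} (hs : 0 < s) :
    ∃ C, 0 ≤ C ∧ ∀ x y, |mollKernel n s x - mollKernel n s y| ≤ C * ‖x - y‖ := by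
  obtain ⟨K, hK0, hK⟩ := exists_norm_fderiv_mollifier_le n
  refine ⟨(s ^ n)⁻¹ * (K * s⁻¹), by positivity, fun x y => ?_⟩
  have h := Convex.norm_image_sub_le_of_norm_fderiv_le (𝕜 := ℝ) (f := mollifier n) (s := univ)
    (x := s⁻¹ • y) (y := s⁻¹ • x)
    (fun w _ => (contDiff_mollifier n).differentiable (by simp) w)
    (fun w _ => hK w) convex_univ (mem_univ _) (mem_univ _)
  rw [← smul_sub, norm_smul, norm_inv, Real.norm_of_nonneg hs.le] at h
  rw [mollKernel, mollKernel, ← mul_sub, abs_mul, abs_of_nonneg (by positivity), mul_assoc, mul_assoc]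
  gcongr
  exact h

/-- The Lipschitz constant depends on u only through its L¹ norm. This equicontinuity at a fixed
scale is the source of compactness. -/
lemma norm_mollify_sub_le {s C : ℝ} (hs : 0 < s)
    (hC : ∀ x y, |mollKernel n s x - mollKernel n s y| ≤ C * ‖x - y‖)
    (hu : IntegrableOn u Ω) (z z' : EuclideanSpace ℝ (Fin n)) :
    ‖mollify Ω u s z - mollify Ω u s z'‖ ≤ C * ‖z - z'‖ * ∫ w in Ω, ‖u w‖ := by
  rw [mollify, mollify, ← integral_sub (integrableOn_mollKernel_smul hu hs z)
    (integrableOn_mollKernel_smul hu hs z'), ← integral_const_mul]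
  refine norm_integral_le_of_norm_le (hu.norm.const_mul _) (ae_of_all _ fun w => ?_)
  rw [← sub_smul, norm_smul]
  gcongr
  refine (hC _ _).trans_eq ?_
  congr 2
  abel

lemma continuous_mollify (hu : IntegrableOn u Ω) {s : ℝ} (hs : 0 < s) :
    Continuous (mollify Ω u s) := by
  obtain ⟨C, hC0, hC⟩ := exists_lipschitz_mollKernel (n := n) hs
  refine (LipschitzWith.of_dist_le_mul (K := (C * ∫ w in Ω, ‖u w‖).toNNReal)
    fun z z' => ?_).continuous
  rw [dist_eq_norm, dist_eq_norm, Real.coe_toNNReal _ (by positivity)]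
  refine (norm_mollify_sub_le hs hC hu z z').trans_eq (by ring)

/-- The mollifications converge almost everywhere. -/
lemma ae_tendsto_mollify [CompleteSpace F] (hΩ : MeasurableSet Ω) (hu : IntegrableOn u Ω)
    {r : ℕ → ℝ}
    (hr : ∀ k, 0 < r k) (hr0 : Filter.Tendsto r Filter.atTop (𝓝 0)) :
    ∀ᵐ z, z ∈ Ω → Filter.Tendsto (fun k => mollify Ω u (r k) z) Filter.atTop (𝓝 (u z)) := by
  obtain ⟨K, hK0, hK⟩ := exists_mollifier_le n
  set v := Ω.indicator u with hv
  have hvi : Integrable v := (integrable_indicator_iff hΩ).2 hu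
  -- Convergence holds at every Lebesgue point of the extension of u by zero.
  filter_upwards [IsUnifLocDoublingMeasure.ae_tendsto_average_norm_sub volume
    hvi.locallyIntegrable 1] with z hz hzΩ
  have h := hz (l := Filter.atTop) (fun _ : ℕ => z) r
    (tendsto_nhdsWithin_iff.2 ⟨hr0, Filter.Eventually.of_forall hr⟩)
    (Filter.Eventually.of_forall fun k => by simp [(hr k).le])
  set c := (volume (Metric.closedBall (0 : EuclideanSpace ℝ (Fin n)) 1)).toReal with hc
  have h2 := h.const_mul (K * c)
  rw [mul_zero] at h2
  rw [tendsto_iff_norm_sub_tendsto_zero]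
  refine squeeze_zero (fun _ => norm_nonneg _) (fun k => ?_) h2
  have hk := hr k
  have hker : Integrable fun w => mollKernel n (r k) (z - w) := by
    refine Continuous.integrable_of_hasCompactSupport
      ((continuous_mollKernel _).comp (by fun_prop)) ?_
    refine HasCompactSupport.of_support_subset_isCompact (isCompact_closedBall z (r k)) ?_
    intro w hw
    by_contra hc
    refine hw (mollKernel_eq_zero hk ?_)
    rw [Metric.mem_closedBall, dist_comm, dist_eq_norm] at hc
    linarith
  have e1 : mollify Ω u (r k) z = ∫ w, mollKernel n (r k) (z - w) • v w := by
    rw [mollify, ← integral_indicator hΩ]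
    congr 1
    ext w
    by_cases hw : w ∈ Ω <;> simp [hv, hw]
  have e2 : v z = ∫ w, mollKernel n (r k) (z - w) • v z := by
    rw [integral_smul_const, integral_sub_left_eq_self, integral_mollKernel hk, one_smul]
  have e3 : u z = v z := by simp [hv, hzΩ]
  rw [e1, e3]
  obtain ⟨C, -, hC⟩ := exists_abs_mollKernel_le (n := n) hk
  have hint : Integrable fun w => mollKernel n (r k) (z - w) • v w := by
    have := integrable_continuous_bounded_smul (integrableOn_univ.2 hvi)
      (k := fun w => mollKernel n (r k) (z - w)) 
      ((continuous_mollKernel _).comp (by fun_prop)) (C := C) (fun x => hC _)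
    rwa [integrableOn_univ] at this
  rw [show (∫ w, mollKernel n (r k) (z - w) • v w) - v z = ∫ w,
    (mollKernel n (r k) (z - w) • v w - mollKernel n (r k) (z - w) • v z) by
      rw [integral_sub hint (hker.smul_const _), ← e2], setAverage_eq, smul_eq_mul]
  have hvol : (volume.real (Metric.closedBall z (r k))) = r k ^ n * c := by
    rw [Measure.real, Measure.addHaar_closedBall' _ _ hk.le, ENNReal.toReal_mul,
      ENNReal.toReal_ofReal (by positivity), finrank_euclideanSpace, Fintype.card_fin]
  have hc0 : 0 < c := ENNReal.toReal_pos (Metric.measure_closedBall_pos volume _ one_pos).ne'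
    measure_closedBall_lt_top.ne
  rw [hvol]
  -- The kernel is at most K r^{-n}, which is K c divided by the volume of the ball of radius r. The
  -- error is therefore at most K c times the mean oscillation.
  have hfin : K * c * ((r k ^ n * c)⁻¹ * ∫ y in Metric.closedBall z (r k), ‖v y - v z‖) =
      ∫ y in Metric.closedBall z (r k), (((r k) ^ n)⁻¹ * K) * ‖v y - v z‖ := by
    rw [integral_const_mul]
    field_simp
  rw [hfin, ← integral_indicator Metric.isClosed_closedBall.measurableSet]
  refine norm_integral_le_of_norm_le ?_ (ae_of_all _ fun w => ?_)
  · rw [integrable_indicator_iff Metric.isClosed_closedBall.measurableSet]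
    refine Integrable.const_mul (Integrable.norm ?_) _
    exact hvi.integrableOn.sub (integrableOn_const measure_closedBall_lt_top.ne)
  · rw [← smul_sub, norm_smul]
    by_cases hw : w ∈ Metric.closedBall z (r k)
    · rw [indicator_of_mem hw, Real.norm_of_nonneg (mollKernel_nonneg hk _), mollKernel]
      gcongr
      exact hK _
    · rw [indicator_of_notMem hw, mollKernel_eq_zero hk, norm_zero, zero_mul]
      rw [Metric.mem_closedBall, dist_comm, dist_eq_norm] at hw
      linarith

end MollifyDeriv

/-! ### Morrey and L^q bounds for functions dominated by averages -/

section Averages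

variable {n : ℕ}

lemma volume_ball_eq (x : EuclideanSpace ℝ (Fin n)) {r : ℝ} (hr : 0 < r) :
    volume (Metric.ball x r) = ENNReal.ofReal (r ^ (n : ℝ) *
      volume.real (Metric.ball (0 : EuclideanSpace ℝ (Fin n)) 1)) := by
  rw [Measure.addHaar_ball_of_pos _ _ hr, finrank_euclideanSpace, Fintype.card_fin,
    ENNReal.ofReal_mul (by positivity), Real.rpow_natCast, ofReal_measureReal]

/-- Hölder's inequality on a set of finite measure. -/
lemma lintegral_rpow_le_measure_mul {α : Type*} [MeasurableSpace α] {μ : Measure α} {H : α → ℝ≥0∞}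
    (hH : AEMeasurable H μ) {p : ℝ} (hp : 1 ≤ p) :
    (∫⁻ x, H x ∂μ) ^ p ≤ μ univ ^ (p - 1) * ∫⁻ x, H x ^ p ∂μ := by
  have hp0 : 0 < p := by linarith
  have h := eLpNorm'_le_eLpNorm'_mul_rpow_measure_univ (μ := μ) (f := H) one_pos hp
    hH.aestronglyMeasurable
  simp only [eLpNorm', enorm_eq_self, ENNReal.rpow_one, div_one, one_div] at h
  have h2 := ENNReal.rpow_le_rpow h hp0.le
  rw [ENNReal.mul_rpow_of_nonneg _ _ hp0.le, ← ENNReal.rpow_mul, ← ENNReal.rpow_mul,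
    inv_mul_cancel₀ hp0.ne', ENNReal.rpow_one, sub_mul, inv_mul_cancel₀ hp0.ne', one_mul] at h2
  rw [mul_comm]
  simpa using h2

variable {H D : EuclideanSpace ℝ (Fin n) → ℝ≥0∞} {Z : Set (EuclideanSpace ℝ (Fin n))}
  {K p d M a r : ℝ}

/-- In the application D is |u_r - u_{r/2}|, H is the norm of the weak gradient, and Z is the ball
on which the average bound is known. Hölder on the ball of radius r contributes r^{n(p-1)}, and r^p
r^{-np} r^{n(p-1)} = r^{p-n}. -/
lemma rpow_le_of_le_average (hH : Measurable H) (hp : 1 ≤ p) (hK : 0 ≤ K) (hr : 0 < r)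
    (hD : ∀ z ∈ Z, D z ≤ ENNReal.ofReal (K * (r * (r ^ n)⁻¹)) * ∫⁻ w in Metric.ball z r, H w) {z}
    (hz : z ∈ Z) :
    D z ^ p ≤ ENNReal.ofReal (K ^ p * volume.real (Metric.ball (0 : EuclideanSpace ℝ (Fin n)) 1) ^
      (p - 1) * r ^ (p - n)) * ∫⁻ w in Metric.ball z r, H w ^ p := by
  have hp0 : 0 < p := by linarith
  set τ := volume.real (Metric.ball (0 : EuclideanSpace ℝ (Fin n)) 1) with hτ
  have hτ0 : 0 ≤ τ := by positivity
  refine (ENNReal.rpow_le_rpow (hD z hz) hp0.le).trans ?_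
  rw [ENNReal.mul_rpow_of_nonneg _ _ hp0.le]
  refine (mul_le_mul_right (lintegral_rpow_le_measure_mul hH.aemeasurable hp) _).trans ?_
  rw [Measure.restrict_apply_univ, volume_ball_eq z hr, ← mul_assoc]
  gcongr ?_ * _
  rw [ENNReal.ofReal_rpow_of_nonneg (by positivity) hp0.le,
    ENNReal.ofReal_rpow_of_nonneg (by positivity) (by linarith), ← ENNReal.ofReal_mul (by positivity)]
  refine ENNReal.ofReal_le_ofReal (le_of_eq ?_)
  rw [Real.mul_rpow hK (by positivity), Real.mul_rpow (by positivity) hτ0, ← Real.rpow_natCast,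
    ← Real.rpow_neg hr.le]
  nth_rw 1 [← Real.rpow_one r]
  rw [← Real.rpow_add hr, ← Real.rpow_mul hr.le, ← Real.rpow_mul hr.le]
  have : r ^ (p - n) = r ^ ((1 + -(n : ℝ)) * p) * r ^ ((n : ℝ) * (p - 1)) := by
    rw [← Real.rpow_add hr]; congr 1; ring
  rw [this]
  ring

/-- The Morrey bound on a ball of radius r contributes r^{n-d}. The resulting exponent p - d is
negative when p < d, so this bound alone is not summable over small scales. -/
lemma rpow_le_of_morrey (hH : Measurable H) (hp : 1 ≤ p) (hK : 0 ≤ K) (hr : 0 < r) (hra : r ≤ a)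
    (hHM : ∀ y, ∀ ρ ∈ Ioc 0 a, ∫⁻ w in Metric.ball y ρ, H w ^ p ≤
      ENNReal.ofReal (M ^ p * ρ ^ (n - d)))
    (hD : ∀ z ∈ Z, D z ≤ ENNReal.ofReal (K * (r * (r ^ n)⁻¹)) * ∫⁻ w in Metric.ball z r, H w) {z}
    (hz : z ∈ Z) :
    D z ^ p ≤ ENNReal.ofReal (K ^ p * volume.real (Metric.ball (0 : EuclideanSpace ℝ (Fin n)) 1) ^
      (p - 1) * (M ^ p * r ^ (p - d))) := by
  refine (rpow_le_of_le_average hH hp hK hr hD hz).trans ?_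
  refine (mul_le_mul_right (hHM z r ⟨hr, hra⟩) _).trans ?_
  rw [← ENNReal.ofReal_mul (by positivity)]
  refine ENNReal.ofReal_le_ofReal (le_of_eq ?_)
  have : r ^ (p - d) = r ^ (p - n) * r ^ (n - d) := by rw [← Real.rpow_add hr]; congr 1; ring
  rw [this]
  ring

/-- By Tonelli, a point w is counted for those z that lie within r of it, and this requires w to be
within ρ + r of y. -/
lemma lintegral_lintegral_ball_le {f : EuclideanSpace ℝ (Fin n) → ℝ≥0∞} (hf : Measurable f)
    (y : EuclideanSpace ℝ (Fin n)) (ρ : ℝ) :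
    ∫⁻ z in Metric.ball y ρ, ∫⁻ w in Metric.ball z r, f w ≤
      volume (Metric.ball (0 : EuclideanSpace ℝ (Fin n)) r) *
        ∫⁻ w in Metric.ball y (ρ + r), f w := by
  have h1 : ∀ z, ∫⁻ w in Metric.ball z r, f w =
      ∫⁻ w, {x : EuclideanSpace ℝ (Fin n) × EuclideanSpace ℝ (Fin n) | dist x.2 x.1 < r}.indicator
        (fun x => f x.2) (z, w) := by
    intro z
    rw [← lintegral_indicator Metric.isOpen_ball.measurableSet]
    rfl
  have hS : MeasurableSet {x : EuclideanSpace ℝ (Fin n) × EuclideanSpace ℝ (Fin n) |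
      dist x.2 x.1 < r} := (isOpen_lt (by fun_prop) continuous_const).measurableSet
  simp_rw [h1]
  rw [lintegral_lintegral_swap]
  · rw [← lintegral_const_mul _ hf, ← lintegral_indicator Metric.isOpen_ball.measurableSet]
    refine lintegral_mono fun w => ?_
    by_cases hw : w ∈ Metric.ball y (ρ + r)
    · rw [indicator_of_mem hw]
      refine (setLIntegral_le_lintegral _ _).trans ?_
      have h2 : ∀ z, {x : EuclideanSpace ℝ (Fin n) × EuclideanSpace ℝ (Fin n) |
          dist x.2 x.1 < r}.indicator (fun x => f x.2) (z, w) =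
          (Metric.ball w r).indicator (fun _ => f w) z := by
        intro z
        simp only [indicator, mem_ofPred_eq, Metric.mem_ball, dist_comm]
      simp_rw [h2]
      rw [lintegral_indicator_const Metric.isOpen_ball.measurableSet, mul_comm,
        Measure.addHaar_ball_center]
    · rw [indicator_of_notMem hw]
      refine le_of_eq ((setLIntegral_congr_fun Metric.isOpen_ball.measurableSet
        (g := fun _ => 0) ?_).trans (by simp))
      intro z hz
      refine indicator_of_notMem (fun hzw => hw ?_) _
      rw [Metric.mem_ball] at hz ⊢
      have : dist w z < r := hzw
      linarith [dist_triangle w z y]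
  · exact ((hf.comp measurable_snd).indicator hS).aemeasurable

/-- Integrating over a ball of radius ρ replaces the pointwise power r^{p-d} by the full gain r^p,
with the Morrey weight ρ^{n-d}. Two regimes are needed, according to which of r and ρ is larger. -/
lemma setLIntegral_rpow_le_of_morrey (hH : Measurable H) (hp : 1 ≤ p) (hd : 0 < d)
    (hK : 0 ≤ K) (hr : 0 < r) (hra : r ≤ a) (hM : 0 ≤ M)
    (hHM : ∀ y, ∀ ρ ∈ Ioc 0 a, ∫⁻ w in Metric.ball y ρ, H w ^ p ≤
      ENNReal.ofReal (M ^ p * ρ ^ (n - d)))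
    (hD : ∀ z ∈ Z, D z ≤ ENNReal.ofReal (K * (r * (r ^ n)⁻¹)) * ∫⁻ w in Metric.ball z r, H w)
    (hZ : MeasurableSet Z) (y : EuclideanSpace ℝ (Fin n)) {ρ : ℝ} (hρ : 0 < ρ) (hρa : 2 * ρ ≤ a) :
    ∫⁻ z in Metric.ball y ρ ∩ Z, D z ^ p ≤ ENNReal.ofReal (2 ^ (n : ℝ) *
      (K ^ p * volume.real (Metric.ball (0 : EuclideanSpace ℝ (Fin n)) 1) ^ p) *
        (M ^ p * r ^ p * ρ ^ (n - d))) := by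
  have hp0 : 0 < p := by linarith
  set τ := volume.real (Metric.ball (0 : EuclideanSpace ℝ (Fin n)) 1) with hτ
  have hτ0 : 0 < τ := ENNReal.toReal_pos (Metric.measure_ball_pos volume _ one_pos).ne'
    measure_ball_lt_top.ne
  have hτp : τ ^ p = τ ^ (p - 1) * τ := by
    rw [← Real.rpow_add_one hτ0.ne']; congr 1; ring
  have hmeas : MeasurableSet (Metric.ball y ρ ∩ Z) := Metric.isOpen_ball.measurableSet.inter hZ
  -- If r ≤ ρ, Tonelli reduces the double integral to a ball of radius ρ + r ≤ 2ρ, where the Morrey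
  -- bound still applies since 2ρ ≤ a.
  rcases le_or_gt r ρ with hrρ | hrρ
  · calc ∫⁻ z in Metric.ball y ρ ∩ Z, D z ^ p
        ≤ ∫⁻ z in Metric.ball y ρ ∩ Z, ENNReal.ofReal (K ^ p * τ ^ (p - 1) * r ^ (p - n)) *
            ∫⁻ w in Metric.ball z r, H w ^ p :=
          setLIntegral_mono' hmeas fun z hz => rpow_le_of_le_average hH hp hK hr hD hz.2
      _ ≤ ENNReal.ofReal (K ^ p * τ ^ (p - 1) * r ^ (p - n)) *
            ∫⁻ z in Metric.ball y ρ, ∫⁻ w in Metric.ball z r, H w ^ p := by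
          rw [lintegral_const_mul' _ _ ENNReal.ofReal_ne_top]
          gcongr
          exact inter_subset_left
      _ ≤ ENNReal.ofReal (K ^ p * τ ^ (p - 1) * r ^ (p - n)) * (ENNReal.ofReal (r ^ (n : ℝ) * τ) *
            ENNReal.ofReal (M ^ p * (2 * ρ) ^ (n - d))) := by
          gcongr
          refine (lintegral_lintegral_ball_le (hH.pow_const p) y ρ).trans ?_
          rw [volume_ball_eq _ hr]
          gcongr
          refine (lintegral_mono_set (Metric.ball_subset_ball (by linarith))).trans
            (hHM y (2 * ρ) ⟨by linarith, hρa⟩)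
      _ ≤ _ := by
          rw [← ENNReal.ofReal_mul (by positivity), ← ENNReal.ofReal_mul (by positivity)]
          refine ENNReal.ofReal_le_ofReal ?_
          rw [Real.mul_rpow (by norm_num) hρ.le, hτp]
          have h1 : (2 : ℝ) ^ (n - d) ≤ 2 ^ (n : ℝ) :=
            Real.rpow_le_rpow_of_exponent_le (by norm_num) (by linarith)
          have h2 : r ^ p = r ^ (p - n) * r ^ (n : ℝ) := by
            rw [← Real.rpow_add hr]; congr 1; ring
          calc _ = 2 ^ (n - d) * (K ^ p * (τ ^ (p - 1) * τ)) *
                (M ^ p * (r ^ (p - n) * r ^ (n : ℝ)) * ρ ^ (n - d)) := by ring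
            _ ≤ _ := by rw [h2]; gcongr
  -- If r > ρ, the pointwise bound times the volume suffices: ρ^n = ρ^{n-d} ρ^d and ρ^d ≤ r^d.
  · calc ∫⁻ z in Metric.ball y ρ ∩ Z, D z ^ p
        ≤ ∫⁻ z in Metric.ball y ρ ∩ Z,
            ENNReal.ofReal (K ^ p * τ ^ (p - 1) * (M ^ p * r ^ (p - d))) :=
          setLIntegral_mono' hmeas fun z hz => rpow_le_of_morrey hH hp hK hr hra hHM hD hz.2
      _ ≤ ENNReal.ofReal (K ^ p * τ ^ (p - 1) * (M ^ p * r ^ (p - d))) *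
            ENNReal.ofReal (ρ ^ (n : ℝ) * τ) := by
          rw [setLIntegral_const, ← volume_ball_eq y hρ]
          gcongr
          exact inter_subset_left
      _ ≤ _ := by
          rw [← ENNReal.ofReal_mul (by positivity)]
          refine ENNReal.ofReal_le_ofReal ?_
          rw [hτp]
          have h1 : (1 : ℝ) ≤ 2 ^ (n : ℝ) := Real.one_le_rpow (by norm_num) (by positivity)
          have h2 : r ^ p = r ^ (p - d) * r ^ d := by rw [← Real.rpow_add hr]; congr 1; ring
          have h3 : ρ ^ (n : ℝ) = ρ ^ (n - d) * ρ ^ d := by rw [← Real.rpow_add hρ]; congr 1; ring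
          rw [h2, h3]
          calc _ = 1 * (K ^ p * (τ ^ (p - 1) * τ)) * (M ^ p * (r ^ (p - d) * ρ ^ d) * ρ ^ (n - d)) := by
                ring
            _ ≤ _ := by gcongr

/-- Write D^q = D^{q-p} D^p, bound the first factor pointwise and integrate the second. The powers
of r add up to (p-d)(q-p)/p + p = q (1 - d/p + d/q). The constant depends neither on the functions
nor on the scale, so it can be used at all dyadic scales at once. -/
lemma setLIntegral_rpow_le_of_morrey_of_le (hp : 1 ≤ p) (hd : 0 < d)
    (hK : 0 ≤ K) {q : ℝ} (hpq : p ≤ q) : ∃ C, 0 < C ∧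
    ∀ (H D : EuclideanSpace ℝ (Fin n) → ℝ≥0∞) (Z : Set (EuclideanSpace ℝ (Fin n))) (a r M : ℝ),
    Measurable H → 0 < r → r ≤ a → 0 ≤ M →
    (∀ y, ∀ ρ ∈ Ioc 0 a, ∫⁻ w in Metric.ball y ρ, H w ^ p ≤ ENNReal.ofReal (M ^ p * ρ ^ (n - d))) →
    (∀ z ∈ Z, D z ≤ ENNReal.ofReal (K * (r * (r ^ n)⁻¹)) * ∫⁻ w in Metric.ball z r, H w) →
    MeasurableSet Z → ∀ (y : EuclideanSpace ℝ (Fin n)) (ρ : ℝ), 0 < ρ → 2 * ρ ≤ a →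
    (∫⁻ z in Metric.ball y ρ ∩ Z, D z ^ q) ^ (1 / q) ≤
      ENNReal.ofReal (C * M * r ^ (1 - d / p + d / q) * ρ ^ ((n - d) / q)) := by
  have hp0 : 0 < p := by linarith
  have hq0 : 0 < q := by linarith
  set τ := volume.real (Metric.ball (0 : EuclideanSpace ℝ (Fin n)) 1) with hτ
  have hτ0 : 0 < τ := ENNReal.toReal_pos (Metric.measure_ball_pos volume _ one_pos).ne'
    measure_ball_lt_top.ne
  set K1 := K ^ p * τ ^ (p - 1) with hK1
  set K2 := 2 ^ (n : ℝ) * (K ^ p * τ ^ p) with hK2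
  have hK10 : 0 ≤ K1 := by positivity
  have hK20 : 0 ≤ K2 := by positivity
  -- The summand 1 only makes the constant positive when K vanishes.
  refine ⟨(K1 ^ ((q - p) / p) * K2) ^ (1 / q) + 1, by positivity, ?_⟩
  intro H D Z a r M hH hr hra hM hHM hD hZ y ρ hρ hρa
  have hmeas : MeasurableSet (Metric.ball y ρ ∩ Z) := Metric.isOpen_ball.measurableSet.inter hZ
  have h1 : ∫⁻ z in Metric.ball y ρ ∩ Z, D z ^ q ≤ ENNReal.ofReal ((K1 ^ ((q - p) / p) * K2) *
      (M * r ^ (1 - d / p + d / q)) ^ q * ρ ^ (n - d)) := by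
    calc ∫⁻ z in Metric.ball y ρ ∩ Z, D z ^ q
        ≤ ∫⁻ z in Metric.ball y ρ ∩ Z, ENNReal.ofReal ((K1 * (M ^ p * r ^ (p - d))) ^ ((q - p) / p)) *
            D z ^ p := by
          refine setLIntegral_mono' hmeas fun z hz => ?_
          have hs := rpow_le_of_morrey hH hp hK hr hra hHM hD hz.2
          rw [← ENNReal.ofReal_rpow_of_nonneg (by positivity) (div_nonneg (by linarith) hp0.le)]
          calc D z ^ q = D z ^ ((q - p) + p) := by congr 1; ring
            _ = (D z ^ p) ^ ((q - p) / p) * D z ^ p := by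
              rw [ENNReal.rpow_add_of_nonneg _ _ (by linarith) hp0.le, ← ENNReal.rpow_mul]
              congr 2
              field_simp
            _ ≤ _ := by
              gcongr
      _ ≤ ENNReal.ofReal ((K1 * (M ^ p * r ^ (p - d))) ^ ((q - p) / p)) *
            ENNReal.ofReal (K2 * (M ^ p * r ^ p * ρ ^ (n - d))) := by
          rw [lintegral_const_mul' _ _ ENNReal.ofReal_ne_top]
          gcongr
          exact setLIntegral_rpow_le_of_morrey hH hp hd hK hr hra hM hHM hD hZ y hρ hρa
      _ ≤ _ := by
          rw [← ENNReal.ofReal_mul (by positivity)]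
          refine ENNReal.ofReal_le_ofReal (le_of_eq ?_)
          rw [Real.mul_rpow hK10 (by positivity),
            Real.mul_rpow (x := M ^ p) (by positivity) (by positivity),
            Real.mul_rpow hM (by positivity), ← Real.rpow_mul hM, ← Real.rpow_mul hr.le,
            ← Real.rpow_mul hr.le]
          have e1 : M ^ q = M ^ (p * ((q - p) / p)) * M ^ p := by
            rw [← Real.rpow_add_of_nonneg hM
              (mul_nonneg hp0.le (div_nonneg (by linarith) hp0.le)) hp0.le]
            congr 1; field_simp; ring
          have e2 : r ^ ((1 - d / p + d / q) * q) = r ^ ((p - d) * ((q - p) / p)) * r ^ p := by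
            rw [← Real.rpow_add hr]; congr 1; field_simp; ring
          rw [e1, e2]; ring
  refine (ENNReal.rpow_le_rpow h1 (by positivity)).trans ?_
  rw [ENNReal.ofReal_rpow_of_nonneg (by positivity) (by positivity)]
  refine ENNReal.ofReal_le_ofReal ?_
  rw [Real.mul_rpow (by positivity) (by positivity), Real.mul_rpow (by positivity) (by positivity),
    ← Real.rpow_mul (by positivity), mul_one_div_cancel hq0.ne', Real.rpow_one,
    ← Real.rpow_mul hρ.le, mul_one_div, ← mul_assoc]
  gcongr
  linarith

end Averages

/-! ### The Euclidean estimate with finitely many functionals -/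

section LocalEstimate

variable {n : ℕ} {F : Type*} [NormedAddCommGroup F] [NormedSpace ℝ F]

/-- Telescope over the scales r 2^{-k}: the k-th difference is O(2^{-kθ}), and θ > 0 makes the sum
finite. The gap between radii b and 4b keeps the balls of radius r ≤ b around points of the small
ball inside Ω, and keeps 2ρ in the range of the Morrey hypothesis. -/
lemma eLpNorm'_mollify_sub_le [CompleteSpace F] {p q d : ℝ} (hp : 1 ≤ p) (hd : 0 < d)
    (hdn : d < n) (hpq : p ≤ q) (hθ : 0 < 1 - d / p + d / q) :
    ∃ C, 0 < C ∧ ∀ (z₀ : EuclideanSpace ℝ (Fin n)) (b r M : ℝ) (u : EuclideanSpace ℝ (Fin n) → F)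
      (g : Fin n → EuclideanSpace ℝ (Fin n) → F), 0 < r → r ≤ b → 0 ≤ M →
      IntegrableOn u (Metric.ball z₀ (4 * b)) → HasWeakPartials (Metric.ball z₀ (4 * b)) u g →
      (∀ y, ∀ ρ ∈ Ioc 0 (4 * b), ∫⁻ w in Metric.ball y ρ ∩ Metric.ball z₀ (4 * b),
        (∑ i, ‖g i w‖ₑ) ^ p ≤ ENNReal.ofReal (M ^ p * ρ ^ (n - d))) →
      ∀ y, ∀ ρ ∈ Ioc 0 b,
        eLpNorm' (fun z => mollify (Metric.ball z₀ (4 * b)) u r z - u z) q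
          (volume.restrict (Metric.ball y ρ ∩ Metric.ball z₀ b)) ≤
          ENNReal.ofReal (C * M * r ^ (1 - d / p + d / q) * ρ ^ ((n - d) / q)) := by
  have hp0 : 0 < p := by linarith
  have hq1 : 1 ≤ q := hp.trans hpq
  have hq0 : 0 < q := by linarith
  obtain ⟨K, hK0, hK⟩ := exists_mollifier_le n
  set K' : ℝ := 2 ^ n * K with hK'
  obtain ⟨C, hC0, hC⟩ := setLIntegral_rpow_le_of_morrey_of_le (n := n) (d := d) hp hd
    (by positivity : 0 ≤ K') hpq
  set θ := 1 - d / p + d / q with hθdef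
  -- Halving the scale multiplies the bound by x, so (1 - x)⁻¹ is the sum of the geometric series.
  set x : ℝ := (1 / 2) ^ θ with hx
  have hx0 : 0 < x := by positivity
  have hx1 : x < 1 := Real.rpow_lt_one (by norm_num) (by norm_num) hθ
  refine ⟨C * (1 - x)⁻¹, mul_pos hC0 (inv_pos.2 (by linarith)), ?_⟩
  intro z₀ b r M u g hr hrb hM hu hg hgM y ρ hρ
  set Ω := Metric.ball z₀ (4 * b) with hΩ
  have hΩm : MeasurableSet Ω := Metric.isOpen_ball.measurableSet
  have hZm : MeasurableSet (Metric.ball z₀ b) := Metric.isOpen_ball.measurableSet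
  -- a measurable version of the norm of the gradient
  have hG : AEMeasurable (Ω.indicator (fun w => ∑ i, ‖g i w‖ₑ)) := by
    rw [aemeasurable_indicator_iff hΩm]
    exact Finset.aemeasurable_fun_sum _ fun i _ =>
      (hg.locallyIntegrableOn i).aestronglyMeasurable.enorm
  have hHM : ∀ y, ∀ ρ ∈ Ioc 0 (4 * b), ∫⁻ w in Metric.ball y ρ, hG.mk _ w ^ p ≤
      ENNReal.ofReal (M ^ p * ρ ^ (n - d)) := by
    intro y ρ hρ
    refine le_trans (le_of_eq ?_) (hgM y ρ hρ)
    have hae : ∀ᵐ w ∂volume.restrict (Metric.ball y ρ), hG.mk _ w ^ p =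
        Ω.indicator (fun w => ∑ i, ‖g i w‖ₑ) w ^ p :=
      ae_restrict_of_ae (hG.ae_eq_mk.symm.fun_comp (· ^ p))
    rw [lintegral_congr_ae hae, inter_comm, ← Measure.restrict_restrict hΩm, ← lintegral_indicator hΩm]
    refine lintegral_congr fun w => ?_
    by_cases hw : w ∈ Ω <;> simp [hw, hp0]
  set rk : ℕ → ℝ := fun k => r * (1 / 2) ^ k with hrk
  have hrk0 : ∀ k, 0 < rk k := fun k => by positivity
  have hrkr : ∀ k, rk k ≤ r := fun k => by
    simp only [hrk]
    exact mul_le_of_le_one_right hr.le (pow_le_one₀ (by norm_num) (by norm_num))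
  have hD : ∀ k, ∀ z ∈ Metric.ball z₀ b, ‖mollify Ω u (rk k) z - mollify Ω u (rk (k + 1)) z‖ₑ ≤
      ENNReal.ofReal (K' * (rk k * (rk k ^ n)⁻¹)) * ∫⁻ w in Metric.ball z (rk k), hG.mk _ w := by
    intro k z hz
    have hz' : Metric.closedBall z (rk k) ⊆ Ω := by
      refine Metric.closedBall_subset_ball' ?_
      have := hrkr k
      rw [Metric.mem_ball] at hz
      linarith
    have h := enorm_mollify_sub_le hK hΩm hu hg (hrk0 k) hz'
    rw [lintegral_congr_ae (ae_restrict_of_ae hG.ae_eq_mk)] at h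
    rwa [show rk k / 2 = rk (k + 1) by simp only [hrk, pow_succ]; ring] at h
  set μ := volume.restrict (Metric.ball y ρ ∩ Metric.ball z₀ b) with hμ
  have hstep : ∀ k, eLpNorm' (fun z => mollify Ω u (rk k) z - mollify Ω u (rk (k + 1)) z) q μ ≤
      ENNReal.ofReal (C * M * r ^ θ * ρ ^ ((n - d) / q) * x ^ k) := by
    intro k
    have h := hC _ _ _ (4 * b) (rk k) M hG.measurable_mk (hrk0 k) (by linarith [hrkr k]) hM hHM
      (hD k) hZm y ρ hρ.1 (by linarith [hρ.2, hρ.1])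
    refine h.trans (le_of_eq ?_)
    congr 1
    simp only [hrk, hx]
    rw [Real.mul_rpow hr.le (by positivity), ← Real.rpow_natCast, ← Real.rpow_natCast,
      ← Real.rpow_mul (by norm_num), ← Real.rpow_mul (by norm_num), mul_comm (k : ℝ)]
    ring
  have hcont : ∀ k, Continuous (mollify Ω u (rk k)) := fun k => continuous_mollify hu (hrk0 k)
  have hsum : ∀ N, eLpNorm' (fun z => mollify Ω u r z - mollify Ω u (rk N) z) q μ ≤
      ENNReal.ofReal (C * (1 - x)⁻¹ * M * r ^ θ * ρ ^ ((n - d) / q)) := by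
    intro N
    have h0 : (fun z => mollify Ω u r z - mollify Ω u (rk N) z) = ∑ k ∈ Finset.range N,
        fun z => mollify Ω u (rk k) z - mollify Ω u (rk (k + 1)) z := by
      ext z
      rw [Finset.sum_apply, Finset.sum_range_sub' (fun k => mollify Ω u (rk k) z)]
      simp [hrk]
    rw [h0]
    refine (eLpNorm'_sum_le (fun k _ => ((hcont k).sub (hcont (k + 1))).aestronglyMeasurable)
      hq1).trans ((Finset.sum_le_sum fun k _ => hstep k).trans ?_)
    have hρn := Real.rpow_nonneg hρ.1.le ((n - d) / q)
    rw [← ENNReal.ofReal_sum_of_nonneg fun k _ => by positivity]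
    refine ENNReal.ofReal_le_ofReal ?_
    rw [← Finset.mul_sum]
    have hgeom : ∑ k ∈ Finset.range N, x ^ k ≤ (1 - x)⁻¹ := by
      rw [← tsum_geometric_of_lt_one hx0.le hx1]
      exact (summable_geometric_of_lt_one hx0.le hx1).sum_le_tsum _ fun _ _ => by positivity
    calc _ ≤ C * M * r ^ θ * ρ ^ ((n - d) / q) * (1 - x)⁻¹ := by gcongr
      _ = _ := by ring
  have hlim : Filter.Tendsto rk Filter.atTop (𝓝 0) := by
    have := (tendsto_pow_atTop_nhds_zero_of_lt_one (by norm_num : (0 : ℝ) ≤ 1 / 2)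
      (by norm_num)).const_mul r
    simpa [hrk] using this
  have hae : ∀ᵐ z ∂μ, Filter.Tendsto (fun k => mollify Ω u r z - mollify Ω u (rk k) z)
      Filter.atTop (𝓝 (mollify Ω u r z - u z)) := by
    filter_upwards [ae_restrict_of_ae (ae_tendsto_mollify hΩm hu hrk0 hlim),
      ae_restrict_mem (Metric.isOpen_ball.measurableSet.inter hZm)] with z hz hzm
    refine tendsto_const_nhds.sub (hz (Metric.ball_subset_ball ?_ hzm.2))
    linarith [hr, hrb]
  -- Fatou: the bounds on u_r - u_{r_N} are uniform in N and pass to the almost everywhere limit u_r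
  -- - u.
  refine (Lp.eLpNorm'_lim_le_liminf_eLpNorm' hq0
    (fun k => ((continuous_mollify hu hr).sub (hcont k)).aestronglyMeasurable) hae).trans ?_
  exact Filter.liminf_le_of_le (by isBoundedDefault) fun a ha => by
    obtain ⟨k, hk⟩ := ha.exists
    exact hk.trans (hsum k)

/-- The local form of the compact embedding, for exponents `q ≥ p`: the Morrey norm of `u` on a
small ball is bounded by an arbitrarily small multiple of the norm of its weak gradient, up to
finitely many linear functionals. -/
lemma exists_local_estimate_of_le [CompleteSpace F] {p q d : ℝ} (hp : 1 ≤ p) (hd : 0 < d)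
    (hdn : d < n) (hpq : p ≤ q) (hθ : 0 < 1 - d / p + d / q) (z₀ : EuclideanSpace ℝ (Fin n))
    {b : ℝ} (hb : 0 < b) {ε : ℝ} (hε : 0 < ε) :
    ∃ (m : ℕ) (ψ : Fin m → EuclideanSpace ℝ (Fin n) → ℝ), (∀ j, Continuous (ψ j)) ∧
      (∃ K, ∀ j x, |ψ j x| ≤ K) ∧ ∃ C, 0 ≤ C ∧
      ∀ (M : ℝ) (u : EuclideanSpace ℝ (Fin n) → F) (g : Fin n → EuclideanSpace ℝ (Fin n) → F),
      0 ≤ M → IntegrableOn u (Metric.ball z₀ (4 * b)) → ∫ w in Metric.ball z₀ (4 * b), ‖u w‖ ≤ M →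
      HasWeakPartials (Metric.ball z₀ (4 * b)) u g →
      (∀ y, ∀ ρ ∈ Ioc 0 (4 * b), ∫⁻ w in Metric.ball y ρ ∩ Metric.ball z₀ (4 * b),
        (∑ i, ‖g i w‖ₑ) ^ p ≤ ENNReal.ofReal (M ^ p * ρ ^ (n - d))) →
      ∀ y, ∀ ρ ∈ Ioc 0 b,
        eLpNorm' u q (volume.restrict (Metric.ball y ρ ∩ Metric.ball z₀ b)) ≤
          ENNReal.ofReal ((ε * M + C * ∑ j, ‖∫ w in Metric.ball z₀ (4 * b), ψ j w • u w‖) *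
            ρ ^ ((n - d) / q)) := by
  have hp0 : 0 < p := by linarith
  have hq1 : 1 ≤ q := hp.trans hpq
  have hq0 : 0 < q := by linarith
  obtain ⟨C, hC0, hC⟩ := eLpNorm'_mollify_sub_le (n := n) (F := F) hp hd hdn hpq hθ
  set θ := 1 - d / p + d / q with hθdef
  -- the scale of the mollification
  obtain ⟨r, hr, hrb, hrε⟩ : ∃ r, 0 < r ∧ r ≤ b ∧ C * r ^ θ ≤ ε / 2 := by
    refine ⟨min b ((ε / 2 / C) ^ (1 / θ)), by positivity, min_le_left _ _, ?_⟩
    calc C * (min b ((ε / 2 / C) ^ (1 / θ))) ^ θ ≤ C * ((ε / 2 / C) ^ (1 / θ)) ^ θ := by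
          gcongr
          exact min_le_right _ _
      _ = ε / 2 := by
          rw [← Real.rpow_mul (by positivity), one_div_mul_cancel hθ.ne', Real.rpow_one]
          field_simp
  obtain ⟨Λ, hΛ0, hΛ⟩ := exists_lipschitz_mollKernel (n := n) hr
  set τ := volume.real (Metric.ball (0 : EuclideanSpace ℝ (Fin n)) 1) with hτ
  -- For ρ ≤ b the ball has volume ρ^n τ ≤ ρ^{n-d} (b^d τ), so a function bounded by 1 has L^q norm
  -- at most c ρ^{(n-d)/q}.
  set c := (b ^ d * τ) ^ (1 / q) with hc
  have hc0 : 0 ≤ c := by positivity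
  -- the finite net
  obtain ⟨δ, hδ, hδε⟩ : ∃ δ > 0, c * (Λ * δ) ≤ ε / 2 := by
    refine ⟨ε / 2 / (c * Λ + 1), by positivity, ?_⟩
    rw [← mul_assoc, mul_div_assoc', div_le_iff₀ (by positivity)]
    nlinarith [mul_nonneg hc0 hΛ0]
  obtain ⟨t, -, htf, ht⟩ := (isCompact_closedBall z₀ b).finite_cover_balls hδ
  have := htf.fintype
  set e := Fintype.equivFin t with he
  -- The functionals are the values of the mollification u_r at the points of the net.
  refine ⟨Fintype.card t, fun j w => mollKernel n r ((e.symm j : EuclideanSpace ℝ (Fin n)) - w),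
    fun j => (continuous_mollKernel r).comp (by fun_prop), ?_, c, hc0, ?_⟩
  · obtain ⟨K, -, hK⟩ := exists_abs_mollKernel_le (n := n) hr
    exact ⟨K, fun j x => hK _⟩
  intro M u g hM hu huM hg hgM y ρ hρ
  set Ω := Metric.ball z₀ (4 * b) with hΩ
  set S := ∑ j, ‖∫ w in Ω, mollKernel n r ((e.symm j : EuclideanSpace ℝ (Fin n)) - w) • u w‖ with hS
  have hS0 : 0 ≤ S := Finset.sum_nonneg fun _ _ => norm_nonneg _
  set μ := volume.restrict (Metric.ball y ρ ∩ Metric.ball z₀ b) with hμ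
  have hμm : MeasurableSet (Metric.ball y ρ ∩ Metric.ball z₀ b) :=
    Metric.isOpen_ball.measurableSet.inter Metric.isOpen_ball.measurableSet
  -- Compare u_r(z) with its value at a net point within δ of z: the Lipschitz bound costs Λ δ M,
  -- and S bounds the value.
  have hsup : ∀ z ∈ Metric.ball z₀ b, ‖mollify Ω u r z‖ ≤ Λ * δ * M + S := by
    intro z hz
    obtain ⟨w, hw, hzw⟩ := mem_iUnion₂.1 (ht (Metric.ball_subset_closedBall hz))
    have h1 := norm_mollify_sub_le hr hΛ hu z w
    have h2 : ‖mollify Ω u r w‖ ≤ S := by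
      have := Finset.single_le_sum (f := fun j => ‖∫ x in Ω,
        mollKernel n r ((e.symm j : EuclideanSpace ℝ (Fin n)) - x) • u x‖)
        (fun _ _ => norm_nonneg _) (Finset.mem_univ (e ⟨w, hw⟩))
      simpa [mollify] using this
    rw [Metric.mem_ball, dist_eq_norm] at hzw
    have h3 : Λ * ‖z - w‖ * ∫ w in Ω, ‖u w‖ ≤ Λ * δ * M := by gcongr
    have h4 := norm_le_norm_sub_add (mollify Ω u r z) (mollify Ω u r w)
    linarith
  have hm : eLpNorm' (mollify Ω u r) q μ ≤
      ENNReal.ofReal (c * (Λ * δ * M + S) * ρ ^ ((n - d) / q)) := by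
    calc eLpNorm' (mollify Ω u r) q μ
        ≤ eLpNorm' (fun _ : EuclideanSpace ℝ (Fin n) => Λ * δ * M + S) q μ := by
          refine eLpNorm'_mono_ae hq0.le ?_
          filter_upwards [ae_restrict_mem hμm] with z hz
          exact (hsup z hz.2).trans (le_abs_self _)
      _ = ENNReal.ofReal (Λ * δ * M + S) * μ univ ^ (1 / q) := by
          rw [eLpNorm'_const _ hq0, Real.enorm_of_nonneg (by positivity)]
      _ ≤ ENNReal.ofReal (Λ * δ * M + S) * ENNReal.ofReal (ρ ^ (n : ℝ) * τ) ^ (1 / q) := by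
          gcongr
          rw [← volume_ball_eq y hρ.1, hμ, Measure.restrict_apply_univ]
          exact measure_mono inter_subset_left
      _ ≤ _ := by
          have hρ0 := hρ.1
          rw [ENNReal.ofReal_rpow_of_nonneg (by positivity) (by positivity),
            ← ENNReal.ofReal_mul (by positivity)]
          refine ENNReal.ofReal_le_ofReal ?_
          have h3 : ρ ^ (n : ℝ) = ρ ^ (n - d) * ρ ^ d := by rw [← Real.rpow_add hρ0]; congr 1; ring
          have h4 : (ρ ^ (n : ℝ) * τ) ^ (1 / q) ≤ ρ ^ ((n - d) / q) * c := by
            rw [h3, mul_assoc, Real.mul_rpow (by positivity) (by positivity), ← Real.rpow_mul hρ0.le,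
              mul_one_div, hc]
            gcongr
            exact hρ.2
          calc _ ≤ (Λ * δ * M + S) * (ρ ^ ((n - d) / q) * c) := by gcongr
            _ = _ := by ring
  have hdiff := hC z₀ b r M u g hr hrb hM hu hg hgM y ρ hρ
  have huμ : AEStronglyMeasurable u μ := hu.aestronglyMeasurable.mono_measure
    (Measure.restrict_mono (inter_subset_right.trans (Metric.ball_subset_ball (by linarith))) le_rfl)
  have hmμ : AEStronglyMeasurable (mollify Ω u r) μ := (continuous_mollify hu hr).aestronglyMeasurable
  have hρn := Real.rpow_nonneg hρ.1.le ((n - d) / q)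
  calc eLpNorm' u q μ = eLpNorm' (mollify Ω u r - fun z => mollify Ω u r z - u z) q μ := by
        congr 1; ext z; simp
    _ ≤ eLpNorm' (mollify Ω u r) q μ + eLpNorm' (fun z => mollify Ω u r z - u z) q μ := by
        rw [sub_eq_add_neg]
        refine (eLpNorm'_add_le hmμ (hmμ.sub huμ).neg hq1).trans ?_
        gcongr
        exact (eLpNorm'_neg (fun z => mollify Ω u r z - u z) q μ).le
    _ ≤ _ := by
        refine (add_le_add hm hdiff).trans ?_
        rw [← ENNReal.ofReal_add (by positivity) (by positivity), ← add_mul]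
        refine ENNReal.ofReal_le_ofReal (mul_le_mul_of_nonneg_right ?_ hρn)
        -- One half of ε M pays for the net, the other for replacing u by u_r.
        nlinarith [mul_le_mul_of_nonneg_right hδε hM, mul_le_mul_of_nonneg_right hrε hM]

/-- The local form of the compact embedding. -/
lemma exists_local_estimate [CompleteSpace F] {p q d : ℝ} (hp : 1 ≤ p) (hd : 0 < d)
    (hdn : d < n) (hq : 1 ≤ q) (hθ : 0 < 1 - d / p + d / q) (z₀ : EuclideanSpace ℝ (Fin n))
    {b : ℝ} (hb : 0 < b) {ε : ℝ} (hε : 0 < ε) :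
    ∃ (m : ℕ) (ψ : Fin m → EuclideanSpace ℝ (Fin n) → ℝ), (∀ j, Continuous (ψ j)) ∧
      (∃ K, ∀ j x, |ψ j x| ≤ K) ∧ ∃ C, 0 ≤ C ∧
      ∀ (M : ℝ) (u : EuclideanSpace ℝ (Fin n) → F) (g : Fin n → EuclideanSpace ℝ (Fin n) → F),
      0 ≤ M → IntegrableOn u (Metric.ball z₀ (4 * b)) → ∫ w in Metric.ball z₀ (4 * b), ‖u w‖ ≤ M →
      HasWeakPartials (Metric.ball z₀ (4 * b)) u g →
      (∀ y, ∀ ρ ∈ Ioc 0 (4 * b), ∫⁻ w in Metric.ball y ρ ∩ Metric.ball z₀ (4 * b),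
        (∑ i, ‖g i w‖ₑ) ^ p ≤ ENNReal.ofReal (M ^ p * ρ ^ (n - d))) →
      ∀ y, ∀ ρ ∈ Ioc 0 b,
        eLpNorm' u q (volume.restrict (Metric.ball y ρ ∩ Metric.ball z₀ b)) ≤
          ENNReal.ofReal ((ε * M + C * ∑ j, ‖∫ w in Metric.ball z₀ (4 * b), ψ j w • u w‖) *
            ρ ^ ((n - d) / q)) := by
  rcases le_or_gt p q with hpq | hqp
  · exact exists_local_estimate_of_le hp hd hdn hpq hθ z₀ hb hε
  have hp0 : 0 < p := by linarith
  have hq0 : 0 < q := by linarith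
  have hqp' : 0 ≤ 1 / q - 1 / p := sub_nonneg.2 (one_div_le_one_div_of_le hq0 hqp.le)
  set τ := volume.real (Metric.ball (0 : EuclideanSpace ℝ (Fin n)) 1) with hτ
  have hτ0 : 0 < τ := ENNReal.toReal_pos (Metric.measure_ball_pos volume _ one_pos).ne'
    measure_ball_lt_top.ne
  set c := (b ^ d * τ) ^ (1 / q - 1 / p) with hc
  have hc0 : 0 < c := by positivity
  -- For q < p, start from the exponent p, where θ = 1. Hölder on a ball of volume at most ρ^n τ
  -- supplies the missing power of ρ and a factor c, for which ε is divided by c in advance.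
  obtain ⟨m, ψ, hψ, hψK, C, hC0, hC⟩ := exists_local_estimate_of_le (F := F) hp hd hdn le_rfl
    (by simp : 0 < 1 - d / p + d / p) z₀ hb (by positivity : 0 < ε / c)
  refine ⟨m, ψ, hψ, hψK, c * C, by positivity, ?_⟩
  intro M u g hM hu huM hg hgM y ρ hρ
  have h := hC M u g hM hu huM hg hgM y ρ hρ
  set S := ∑ j, ‖∫ w in Metric.ball z₀ (4 * b), ψ j w • u w‖
  have hS0 : 0 ≤ S := Finset.sum_nonneg fun _ _ => norm_nonneg _
  have huμ : AEStronglyMeasurable u (volume.restrict (Metric.ball y ρ ∩ Metric.ball z₀ b)) :=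
    hu.aestronglyMeasurable.mono_measure (Measure.restrict_mono
      (inter_subset_right.trans (Metric.ball_subset_ball (by linarith))) le_rfl)
  refine (eLpNorm'_le_eLpNorm'_mul_rpow_measure_univ hq0 hqp.le huμ).trans ?_
  have hv : volume.restrict (Metric.ball y ρ ∩ Metric.ball z₀ b) univ ≤
      ENNReal.ofReal (ρ ^ (n : ℝ) * τ) := by
    rw [← volume_ball_eq y hρ.1, Measure.restrict_apply_univ]
    exact measure_mono inter_subset_left
  refine (mul_le_mul' h (ENNReal.rpow_le_rpow hv hqp')).trans ?_
  have hρ0 := hρ.1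
  rw [ENNReal.ofReal_rpow_of_nonneg (by positivity) hqp', ← ENNReal.ofReal_mul (by positivity)]
  refine ENNReal.ofReal_le_ofReal ?_
  have h3 : ρ ^ (n : ℝ) = ρ ^ (n - d) * ρ ^ d := by rw [← Real.rpow_add hρ0]; congr 1; ring
  have h4 : (ρ ^ (n : ℝ) * τ) ^ (1 / q - 1 / p) ≤ ρ ^ ((n - d) * (1 / q - 1 / p)) * c := by
    rw [h3, mul_assoc, Real.mul_rpow (by positivity) (by positivity), ← Real.rpow_mul hρ0.le, hc]
    gcongr
    exact hρ.2
  have h5 : ρ ^ ((n - d) / q) = ρ ^ ((n - d) / p) * ρ ^ ((n - d) * (1 / q - 1 / p)) := by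
    rw [← Real.rpow_add hρ0]; congr 1; ring
  calc _ ≤ (ε / c * M + C * S) * ρ ^ ((n - d) / p) * (ρ ^ ((n - d) * (1 / q - 1 / p)) * c) := by
        gcongr
    _ = _ := by rw [h5]; field_simp

end LocalEstimate

/-! ### Comparison of the Riemannian distance with the coordinate distance -/

section Distance

open scoped NNReal

variable {n : ℕ} {X : Type*} [EMetricSpace X]
  [ChartedSpace (EuclideanSpace ℝ (Fin n)) X]
  [IsManifold (𝓡 n) ∞ X] [RiemannianBundle (fun x : X => TangentSpace (𝓡 n) x)]
  [IsContMDiffRiemannianBundle (𝓡 n) ∞ (EuclideanSpace ℝ (Fin n))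
    (fun x : X => TangentSpace (𝓡 n) x)]

lemma IsContMDiffRiemannianBundle.isContinuousRiemannianBundle {B : Type*} [TopologicalSpace B]
    [ChartedSpace (EuclideanSpace ℝ (Fin n)) B] {F : Type*} [NormedAddCommGroup F] [NormedSpace ℝ F]
    {E : B → Type*} [TopologicalSpace (TotalSpace F E)] [∀ x, NormedAddCommGroup (E x)]
    [∀ x, InnerProductSpace ℝ (E x)] [FiberBundle F E] [VectorBundle ℝ F E]
    [h : IsContMDiffRiemannianBundle (𝓡 n) ∞ F E] : IsContinuousRiemannianBundle F E := by
  obtain ⟨g, hg, h⟩ := h.exists_contMDiff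
  exact ⟨g, hg.continuous, h⟩

lemma isContinuousRiemannianBundle_tangentSpace : IsContinuousRiemannianBundle
    (EuclideanSpace ℝ (Fin n)) (fun x : X => TangentSpace (𝓡 n) x) :=
  IsContMDiffRiemannianBundle.isContinuousRiemannianBundle (n := n)

lemma eventually_enorm_coordField_le (x : X) : ∃ C : ℝ≥0, 0 < C ∧ ∀ᶠ y in 𝓝 x,
    ∀ v, ‖coordField n x y v‖ₑ ≤ C * ‖v‖ₑ := by
  have := isContinuousRiemannianBundle_tangentSpace (n := n) (X := X)
  obtain ⟨C, hC0, hC⟩ := eventually_norm_symmL_trivializationAt_lt (EuclideanSpace ℝ (Fin n))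
    (fun x : X => TangentSpace (𝓡 n) x) x
  lift C to ℝ≥0 using hC0.le
  refine ⟨C, mod_cast hC0, hC.mono fun y hy v => ?_⟩
  have h := ((trivializationAt (EuclideanSpace ℝ (Fin n))
    (fun x : X => TangentSpace (𝓡 n) x) x).symmL ℝ y).le_of_opNorm_le hy.le v
  simp only [enorm, nnnorm]
  exact_mod_cast h

lemma eventually_enorm_continuousLinearMapAt_le (x : X) : ∃ C : ℝ≥0, 0 < C ∧ ∀ᶠ y in 𝓝 x,
    ∀ v : TangentSpace (𝓡 n) y, ‖(trivializationAt (EuclideanSpace ℝ (Fin n))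
      (fun x : X => TangentSpace (𝓡 n) x) x).continuousLinearMapAt ℝ y v‖ₑ ≤ C * ‖v‖ₑ := by
  have := isContinuousRiemannianBundle_tangentSpace (n := n) (X := X)
  obtain ⟨C, hC0, hC⟩ := eventually_norm_trivializationAt_lt (EuclideanSpace ℝ (Fin n))
    (fun x : X => TangentSpace (𝓡 n) x) x
  lift C to ℝ≥0 using hC0.le
  refine ⟨C, mod_cast hC0, hC.mono fun y hy v => ?_⟩
  have h := ((trivializationAt (EuclideanSpace ℝ (Fin n))
    (fun x : X => TangentSpace (𝓡 n) x) x).continuousLinearMapAt ℝ y).le_of_opNorm_le hy.le v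
  simp only [enorm, nnnorm]
  exact_mod_cast h

variable [IsRiemannianManifold (𝓡 n) X]

/-- The Riemannian distance is at most the length of the image of the straight segment, and
coordinate vectors have locally bounded Riemannian norm. -/
lemma exists_ball_edist_symm_le (x : X) :
    ∃ C : ℝ≥0, 0 < C ∧ ∃ a > 0, ∀ z ∈ Metric.ball (chartAt (EuclideanSpace ℝ (Fin n)) x x) a,
      ∀ w ∈ Metric.ball (chartAt (EuclideanSpace ℝ (Fin n)) x x) a,
      edist ((chartAt (EuclideanSpace ℝ (Fin n)) x).symm z)
        ((chartAt (EuclideanSpace ℝ (Fin n)) x).symm w) ≤ C * edist z w := by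
  obtain ⟨C, C_pos, hC⟩ := eventually_enorm_coordField_le (n := n) x
  refine ⟨C, C_pos, ?_⟩
  have hC' : ∀ᶠ z in 𝓝 (extChartAt (𝓡 n) x x), ∀ v : EuclideanSpace ℝ (Fin n),
      ‖coordField n x ((extChartAt (𝓡 n) x).symm z) v‖ₑ ≤ C * ‖v‖ₑ := by
    have h := continuousAt_extChartAt_symm (I := 𝓡 n) x
    rw [ContinuousAt, extChartAt_to_inv] at h
    exact h.eventually hC
  obtain ⟨r, r_pos, hr⟩ := Metric.mem_nhds_iff.1
    (Filter.inter_mem (extChartAt_target_mem_nhds (I := 𝓡 n) x) hC')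
  refine ⟨r, r_pos, fun z hz w hw => ?_⟩
  let η := ContinuousAffineMap.lineMap (R := ℝ) z w
  set γ := (extChartAt (𝓡 n) x).symm ∘ η with hγ
  -- Convexity of the coordinate ball keeps the segment where the norm bound holds.
  have hη : Icc 0 1 ⊆ ⇑η ⁻¹' ((extChartAt (𝓡 n) x).target ∩
        {z | ∀ v : EuclideanSpace ℝ (Fin n),
          ‖coordField n x ((extChartAt (𝓡 n) x).symm z) v‖ₑ ≤ C * ‖v‖ₑ}) := by
    simp only [← image_subset_iff, ContinuousAffineMap.coe_lineMap_eq,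
     ← segment_eq_image_lineMap, η]
    exact Subset.trans ((convex_ball _ _).segment_subset hz hw) hr
  simp only [preimage_inter, subset_inter_iff] at hη
  have η_smooth : ContMDiffOn 𝓘(ℝ) (𝓡 n) 1 η (Icc 0 1) := by
    apply ContMDiff.contMDiffOn
    rw [contMDiff_iff_contDiff]
    exact ContinuousAffineMap.contDiff _
  have h : riemannianEDist (𝓡 n) (γ 0) (γ 1) ≤ pathELength (𝓡 n) γ 0 1 := by
    refine riemannianEDist_le_pathELength ?_ rfl rfl zero_le_one
    exact (contMDiffOn_extChartAt_symm x).comp η_smooth hη.1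
  have h0 : γ 0 = (chartAt (EuclideanSpace ℝ (Fin n)) x).symm z := by
    simp [γ, η, ContinuousAffineMap.coe_lineMap_eq]
  have h1 : γ 1 = (chartAt (EuclideanSpace ℝ (Fin n)) x).symm w := by
    simp [γ, η, ContinuousAffineMap.coe_lineMap_eq]
  rw [← h0, ← h1, IsRiemannianManifold.out (I := 𝓡 n) (γ 0) (γ 1)]
  refine h.trans ?_
  have hconst : (C : ℝ≥0∞) * edist z w = ∫⁻ _ in Icc (0 : ℝ) 1, C * ‖w - z‖ₑ := by
    simp [edist_comm z w, edist_eq_enorm_sub]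
  rw [hconst, pathELength_eq_lintegral_mfderivWithin_Icc]
  apply setLIntegral_mono' measurableSet_Icc (fun t ht ↦ ?_)
  have h2 : mfderivWithin 𝓘(ℝ) (𝓡 n) γ (Icc 0 1) t =
      (mfderivWithin (𝓡 n) (𝓡 n) (extChartAt (𝓡 n) x).symm (range (𝓡 n)) (η t)) ∘L
        (mfderivWithin 𝓘(ℝ) (𝓡 n) η (Icc 0 1) t) := by
    apply mfderivWithin_comp
    · exact mdifferentiableWithinAt_extChartAt_symm (hη.1 ht)
    · exact η_smooth.mdifferentiableOn one_ne_zero t ht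
    · exact hη.1.trans (preimage_mono (extChartAt_target_subset_range x))
    · rw [uniqueMDiffWithinAt_iff_uniqueDiffWithinAt]
      exact uniqueDiffOn_Icc zero_lt_one t ht
  have h3 : mfderivWithin 𝓘(ℝ) (𝓡 n) γ (Icc 0 1) t 1 =
      mfderivWithin (𝓡 n) (𝓡 n) (extChartAt (𝓡 n) x).symm (range (𝓡 n)) (η t)
        (mfderivWithin 𝓘(ℝ) (𝓡 n) η (Icc 0 1) t 1) := congrArg (fun L => L 1) h2
  have h5 : fderivWithin ℝ η (Icc 0 1) t 1 = w - z := by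
    rw [fderivWithin_eq_fderiv (uniqueDiffOn_Icc zero_lt_one _ ht)
      (ContinuousAffineMap.differentiableAt _)]
    simp [η]
  have hsrc : γ t ∈ (chartAt (EuclideanSpace ℝ (Fin n)) x).source := by
    have := (extChartAt (𝓡 n) x).map_target (hη.1 ht)
    rwa [extChartAt_source] at this
  -- The velocity of the image path is the coordinate field with constant coordinates w - z.
  have h6 : coordField n x (γ t) (w - z) = mfderivWithin 𝓘(ℝ) (𝓡 n) γ (Icc 0 1) t 1 := by
    rw [h3, mfderivWithin_eq_fderivWithin]
    unfold coordField
    rw [TangentBundle.symmL_trivializationAt hsrc, ← h5]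
    have : extChartAt (𝓡 n) x (γ t) = η t := (extChartAt (𝓡 n) x).right_inv (hη.1 ht)
    rw [this]
    rfl
  rw [← h6]
  exact hη.2 ht (w - z)

/-- A path shorter than |z - w| / C would move less than |z - w| in coordinates. It could therefore
neither leave the chart region nor reach w from z. -/
lemma exists_ball_edist_le (x : X) :
    ∃ C : ℝ≥0, 0 < C ∧ ∃ a > 0, ∀ z ∈ Metric.ball (chartAt (EuclideanSpace ℝ (Fin n)) x x) a,
      ∀ w ∈ Metric.ball (chartAt (EuclideanSpace ℝ (Fin n)) x x) a,
      edist z w ≤ C * edist ((chartAt (EuclideanSpace ℝ (Fin n)) x).symm z)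
        ((chartAt (EuclideanSpace ℝ (Fin n)) x).symm w) := by
  rcases eventually_enorm_continuousLinearMapAt_le (n := n) x with ⟨C, C_pos, hC⟩
  -- The continuation argument below needs two neighborhoods: u is closed so that the set of good
  -- times is closed, and the open v inside u lets the path continue past a good time.
  obtain ⟨u, u_mem, u_closed, hu, uc⟩ : ∃ u ∈ 𝓝 x, IsClosed u
      ∧ u ⊆ {y | ∀ v : TangentSpace (𝓡 n) y,
        ‖(trivializationAt (EuclideanSpace ℝ (Fin n)) (fun x : X => TangentSpace (𝓡 n) x)
          x).continuousLinearMapAt ℝ y v‖ₑ ≤ C * ‖v‖ₑ} ∧ u ⊆ (extChartAt (𝓡 n) x).source := by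
    have := Filter.inter_mem hC (extChartAt_source_mem_nhds (I := 𝓡 n) x)
    rcases exists_mem_nhds_isClosed_subset this with ⟨u, u_mem, u_closed, hu⟩
    simp only [subset_inter_iff] at hu
    exact ⟨u, u_mem, u_closed, hu.1, hu.2⟩
  have uc' : u ⊆ (chartAt (EuclideanSpace ℝ (Fin n)) x).source := by
    simpa [extChartAt_source (𝓡 n) x] using uc
  obtain ⟨v, ⟨v_mem, v_open⟩, hv⟩ : ∃ v, (v ∈ 𝓝 x ∧ IsOpen v) ∧ v ⊆ u :=
    (nhds_basis_opens' x).mem_iff.1 u_mem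
  obtain ⟨r, r_pos, hr⟩ : ∃ r > 0, Metric.ball (extChartAt (𝓡 n) x x) r ⊆
      (extChartAt (𝓡 n) x).target ∩ (extChartAt (𝓡 n) x).symm ⁻¹' v := by
    refine Metric.mem_nhds_iff.1 (Filter.inter_mem ?_ (extChartAt_preimage_mem_nhds v_mem))
    exact extChartAt_target_mem_nhds x
  lift r to ℝ≥0 using r_pos.le
  simp only [NNReal.coe_pos] at r_pos
  -- With z and w within r/4 of the center, a point closer to z than w is lies within r/2 + r/4 < r
  -- of the center.
  refine ⟨C, C_pos, r / 4, by positivity, fun z hz w hw => ?_⟩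
  change z ∈ Metric.ball (extChartAt (𝓡 n) x x) _ at hz
  change w ∈ Metric.ball (extChartAt (𝓡 n) x x) _ at hw
  change _ ≤ C * edist ((extChartAt (𝓡 n) x).symm z) ((extChartAt (𝓡 n) x).symm w)
  have hz' := hr (Metric.ball_subset_ball (by linarith [r.coe_nonneg]) hz)
  have hw' := hr (Metric.ball_subset_ball (by linarith [r.coe_nonneg]) hw)
  -- it suffices to bound the distance by `C L` if there is a path of length less than `L`
  by_contra! hlt
  set L := edist z w / C with hL
  have hLlt : riemannianEDist (𝓡 n) ((extChartAt (𝓡 n) x).symm z)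
      ((extChartAt (𝓡 n) x).symm w) < L := by
    rw [← IsRiemannianManifold.out (I := 𝓡 n), hL, ENNReal.lt_div_iff_mul_lt (by simp [C_pos.ne'])
      (by simp), mul_comm]
    exact hlt
  rcases exists_lt_locally_constant_of_riemannianEDist_lt hLlt zero_lt_one
    with ⟨γ, hγx, hγy, γ_smooth, hγ, -⟩
  have hCL : C * L = edist z w := ENNReal.mul_div_cancel (by simp [C_pos.ne']) (by simp)
  let A := γ ⁻¹' u
  let γ' := extChartAt (𝓡 n) x ∘ γ
  have hγ'0 : γ' 0 = z := by
    simp only [γ', Function.comp, hγx]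
    exact (extChartAt (𝓡 n) x).right_inv hz'.1
  have hγ'1 : γ' 1 = w := by
    simp only [γ', Function.comp, hγy]
    exact (extChartAt (𝓡 n) x).right_inv hw'.1
  -- While the path stays in u, its coordinate displacement is at most C times its length.
  have key : ∀ t₁ ∈ Icc (0 : ℝ) 1, Icc 0 t₁ ⊆ A →
      ‖γ' t₁ - γ' 0‖ₑ ≤ C * pathELength (𝓡 n) γ 0 1 := by
    intro t₁ ht₁ t₁_mem
    have hC : ContMDiffOn 𝓘(ℝ) (𝓡 n) 1 γ' (Icc 0 t₁) :=
      contMDiffOn_extChartAt.comp (I' := 𝓡 n) (t := (chartAt (EuclideanSpace ℝ (Fin n)) x).source)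
        γ_smooth.contMDiffOn (fun t' ht' ↦ uc' <| t₁_mem ht')
    rcases ht₁.1.eq_or_lt with rfl | h't'
    · simp
    calc
      ‖γ' t₁ - γ' 0‖ₑ
    _ ≤ ∫⁻ t' in Icc 0 t₁, ‖derivWithin γ' (Icc 0 t₁) t'‖ₑ := by
      apply enorm_sub_le_lintegral_derivWithin_Icc_of_contDiffOn_Icc _ ht₁.1
      rwa [← contMDiffOn_iff_contDiffOn]
    _ ≤ ∫⁻ t' in Icc 0 t₁, C * ‖mfderivWithin 𝓘(ℝ) (𝓡 n) γ (Icc 0 t₁) t' 1‖ₑ := by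
      apply setLIntegral_mono' measurableSet_Icc (fun t' ht' ↦ ?_)
      have h1 : mfderivWithin 𝓘(ℝ) (𝓡 n) γ' (Icc 0 t₁) t' =
          (mfderiv (𝓡 n) (𝓡 n) (extChartAt (𝓡 n) x) (γ t')) ∘L
            (mfderivWithin 𝓘(ℝ) (𝓡 n) γ (Icc 0 t₁) t') := by
        apply mfderiv_comp_mfderivWithin
        · refine mdifferentiableAt_extChartAt (uc' ?_)
          apply t₁_mem ht'
        · exact (γ_smooth.mdifferentiable one_ne_zero).mdifferentiableOn _ ht'
        · rw [uniqueMDiffWithinAt_iff_uniqueDiffWithinAt]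
          exact uniqueDiffOn_Icc h't' _ ht'
      have h2 : (trivializationAt (EuclideanSpace ℝ (Fin n)) (fun x : X => TangentSpace (𝓡 n) x)
          x).continuousLinearMapAt ℝ (γ t') (mfderivWithin 𝓘(ℝ) (𝓡 n) γ (Icc 0 t₁) t' 1) =
          derivWithin γ' (Icc 0 t₁) t' := by
        rw [TangentBundle.continuousLinearMapAt_trivializationAt (uc' (t₁_mem ht')),
          ← fderivWithin_derivWithin, ← mfderivWithin_eq_fderivWithin]
        exact (congrArg (fun L => L 1) h1).symm
      rw [← h2]
      exact hu (t₁_mem ht') _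
    _ = C * pathELength (𝓡 n) γ 0 t₁ := by
      rw [lintegral_const_mul' _ _ ENNReal.coe_ne_top,
          pathELength_eq_lintegral_mfderivWithin_Icc]
    _ ≤ C * pathELength (𝓡 n) γ 0 1 := by
      gcongr
      exact ht₁.2
  have hlt2 : C * pathELength (𝓡 n) γ 0 1 < edist z w := by
    rw [← hCL]
    exact ENNReal.mul_lt_mul_right (by simp [C_pos.ne']) (by simp) hγ
  -- Continuation along [0, 1]: if the path has stayed in u up to time t₁, the displacement bound
  -- places it in v at t₁, hence in u shortly after.
  have hsub : Icc 0 1 ⊆ A := by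
    have zero_mem : 0 ∈ A := by simpa [hγx, A] using hv hz'.2
    have A_closed : IsClosed (A ∩ Icc 0 1) :=
      (u_closed.preimage γ_smooth.continuous).inter isClosed_Icc
    apply A_closed.Icc_subset_of_forall_mem_nhdsGT_of_Icc_subset zero_mem
    rintro t₁ ⟨ht₁0, ht₁1⟩ t₁_mem
    suffices γ t₁ ∈ v from
      γ_smooth.continuous.continuousWithinAt <| Filter.mem_of_superset (v_open.mem_nhds this) hv
    have hlt3 := (key t₁ ⟨ht₁0, ht₁1.le⟩ t₁_mem).trans_lt hlt2
    have hball : γ' t₁ ∈ Metric.ball (extChartAt (𝓡 n) x x) r := by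
      have h1 : dist (γ' t₁) z < dist z w := by
        have h := hlt3
        rw [hγ'0, ← edist_eq_enorm_sub, edist_dist, edist_dist,
          ENNReal.ofReal_lt_ofReal_iff_of_nonneg dist_nonneg] at h
        exact h
      rw [Metric.mem_ball] at hz hw ⊢
      have h2 := dist_triangle_right z w (extChartAt (𝓡 n) x x)
      have h3 := dist_triangle (γ' t₁) z (extChartAt (𝓡 n) x x)
      linarith
    have := (hr hball).2
    simpa only [mem_preimage, Function.comp_apply, γ',
      (extChartAt (𝓡 n) x).left_inv <| uc <| t₁_mem (right_mem_Icc.mpr ht₁0)] using this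
  have := key 1 ⟨zero_le_one, le_rfl⟩ hsub
  rw [hγ'0, hγ'1, ← edist_eq_enorm_sub, edist_comm] at this
  exact absurd (this.trans_lt hlt2) (lt_irrefl _)
end Distance

/-! ### Change of coordinates for the metric determinant -/

section VolumeComparison
variable {n : ℕ} {X : Type*} [EMetricSpace X]
  [ChartedSpace (EuclideanSpace ℝ (Fin n)) X]
  [IsManifold (𝓡 n) ∞ X] [RiemannianBundle (fun x : X => TangentSpace (𝓡 n) x)]
  [IsContMDiffRiemannianBundle (𝓡 n) ∞ (EuclideanSpace ℝ (Fin n))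
    (fun x : X => TangentSpace (𝓡 n) x)]

local notation "φ[" x "]" => chartAt (EuclideanSpace ℝ (Fin n)) x

/-- The derivative of the change of coordinates from the chart at `x₀` to the chart at `x₁`. -/
def transitionDeriv (n : ℕ) {X : Type*} [EMetricSpace X] [ChartedSpace (EuclideanSpace ℝ (Fin n)) X]
    [IsManifold (𝓡 n) ∞ X] (x₀ x₁ x : X) : EuclideanSpace ℝ (Fin n) →L[ℝ] EuclideanSpace ℝ (Fin n) :=
  ((trivializationAt (EuclideanSpace ℝ (Fin n)) (TangentSpace (𝓡 n) (M := X)) x₁).continuousLinearMapAt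
    ℝ x).comp
  ((trivializationAt (EuclideanSpace ℝ (Fin n)) (TangentSpace (𝓡 n) (M := X)) x₀).symmL ℝ x)

lemma coordField_transitionDeriv (x₀ x₁ : X) {x : X} (hx : x ∈ φ[x₁].source)
    (v : EuclideanSpace ℝ (Fin n)) :
    coordField n x₁ x (transitionDeriv n x₀ x₁ x v) = coordField n x₀ x v := by
  unfold coordField transitionDeriv
  exact Trivialization.symmL_continuousLinearMapAt _ hx _

/-- The trivializations of the tangent bundle are the derivatives of the charts. The bundle
transition map is therefore the Jacobian required by the change of variables formula. -/
lemma hasFDerivAt_transition (x₀ x₁ : X) {z : EuclideanSpace ℝ (Fin n)} (hz : z ∈ φ[x₀].target)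
    (hx : φ[x₀].symm z ∈ φ[x₁].source) :
    HasFDerivAt (fun w => φ[x₁] (φ[x₀].symm w)) (transitionDeriv n x₀ x₁ (φ[x₀].symm z)) z := by
  have hx0 : φ[x₀].symm z ∈ φ[x₀].source := φ[x₀].map_target hz
  have hz' : z ∈ (extChartAt (𝓡 n) x₀).target := by simpa [extChartAt] using hz
  have h1 : HasMFDerivAt (𝓡 n) (𝓡 n) (extChartAt (𝓡 n) x₁) (φ[x₀].symm z)
      (mfderiv (𝓡 n) (𝓡 n) (extChartAt (𝓡 n) x₁) (φ[x₀].symm z)) :=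
    (mdifferentiableAt_extChartAt hx).hasMFDerivAt
  have h2 : HasMFDerivWithinAt (𝓡 n) (𝓡 n) (extChartAt (𝓡 n) x₀).symm (range (𝓡 n)) z
      (mfderivWithin (𝓡 n) (𝓡 n) (extChartAt (𝓡 n) x₀).symm (range (𝓡 n)) z) :=
    (mdifferentiableWithinAt_extChartAt_symm hz').hasMFDerivWithinAt
  have h3 := h1.comp_hasMFDerivWithinAt z h2
  have h4 : transitionDeriv n x₀ x₁ (φ[x₀].symm z) =
      (mfderiv (𝓡 n) (𝓡 n) (extChartAt (𝓡 n) x₁) (φ[x₀].symm z)).comp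
        (mfderivWithin (𝓡 n) (𝓡 n) (extChartAt (𝓡 n) x₀).symm (range (𝓡 n)) z) := by
    unfold transitionDeriv
    rw [TangentBundle.continuousLinearMapAt_trivializationAt hx,
      TangentBundle.symmL_trivializationAt hx0]
    have : extChartAt (𝓡 n) x₀ (φ[x₀].symm z) = z := (extChartAt (𝓡 n) x₀).right_inv hz'
    rw [this]
    rfl
  have h5 : HasFDerivWithinAt (fun w => φ[x₁] (φ[x₀].symm w))
      (transitionDeriv n x₀ x₁ (φ[x₀].symm z)) (range (𝓡 n)) z := by
    rw [h4]
    exact hasMFDerivWithinAt_iff_hasFDerivWithinAt.1 h3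
  rwa [(𝓡 n).range_eq_univ, hasFDerivWithinAt_univ] at h5

/-- With P the matrix of the transition derivative, the Gram matrices satisfy G₀ = Pᵀ G₁ P. Hence
√det G picks up exactly the absolute value of the Jacobian determinant. -/
lemma det_metricMatrix_eq (x₀ x₁ : X) {x : X} (hx : x ∈ φ[x₁].source) :
    (metricMatrix n x₀ x).det = (transitionDeriv n x₀ x₁ x).det ^ 2 * (metricMatrix n x₁ x).det := by
  set b := EuclideanSpace.basisFun (Fin n) ℝ with hb
  set L := transitionDeriv n x₀ x₁ x with hL
  set P := LinearMap.toMatrix b.toBasis b.toBasis (L : EuclideanSpace ℝ (Fin n) →ₗ[ℝ] _) with hP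
  have hLP : ∀ i, L (b i) = ∑ k, P k i • b k := by
    intro i
    rw [← b.sum_repr (L (b i))]
    refine Finset.sum_congr rfl fun k _ => ?_
    simp [hP, LinearMap.toMatrix_apply]
  have h : metricMatrix n x₀ x = P.transpose * metricMatrix n x₁ x * P := by
    ext i j
    simp only [metricMatrix, Matrix.of_apply, Matrix.mul_apply, Matrix.transpose_apply]
    rw [← coordField_transitionDeriv x₀ x₁ hx, ← coordField_transitionDeriv x₀ x₁ hx,
      ← hL, hLP i, hLP j]
    have hlin : ∀ i, coordField n x₁ x (∑ k, P k i • b k) = ∑ k, P k i • coordField n x₁ x (b k) := by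
      intro i
      unfold coordField
      simp only [map_sum, map_smul]
    rw [hlin, hlin]
    simp only [sum_inner, inner_sum, real_inner_smul_left, real_inner_smul_right, Finset.sum_mul]
    rw [show EuclideanSpace.basisFun (Fin n) ℝ = b from rfl]
    exact Finset.sum_congr rfl fun k _ => Finset.sum_congr rfl fun l _ => by ring
  rw [h, Matrix.det_mul, Matrix.det_mul, Matrix.det_transpose]
  have : P.det = L.det := LinearMap.det_toMatrix b.toBasis _
  rw [this]
  ring

lemma det_metricMatrix_pos (x₀ : X) {x : X} (hx : x ∈ φ[x₀].source) :
    0 < (metricMatrix n x₀ x).det := by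
  set e := trivializationAt (EuclideanSpace ℝ (Fin n)) (TangentSpace (𝓡 n) (M := X)) x₀ with he
  have hx' : x ∈ e.baseSet := hx
  have hli : LinearIndependent ℝ fun i : Fin n =>
      coordField n x₀ x (EuclideanSpace.basisFun (Fin n) ℝ i) := by
    have h := (EuclideanSpace.basisFun (Fin n) ℝ).toBasis.linearIndependent.map'
      (e.symmL ℝ x : EuclideanSpace ℝ (Fin n) →ₗ[ℝ] TangentSpace (𝓡 n) x) (by
        rw [LinearMap.ker_eq_bot]
        intro v w hvw
        have h2 := congrArg (e.continuousLinearMapAt ℝ x) hvw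
        simpa [e.continuousLinearMapAt_symmL hx'] using h2)
    simpa [Function.comp_def] using! h
  exact (Matrix.posDef_gram_of_linearIndependent hli).det_pos

end VolumeComparison

/-! ### The Riemannian volume in a chart -/

section VolumeMeasure
variable {n : ℕ} {X : Type*} [EMetricSpace X]
  [ChartedSpace (EuclideanSpace ℝ (Fin n)) X]
  [IsManifold (𝓡 n) ∞ X] [RiemannianBundle (fun x : X => TangentSpace (𝓡 n) x)]
  [IsContMDiffRiemannianBundle (𝓡 n) ∞ (EuclideanSpace ℝ (Fin n))
    (fun x : X => TangentSpace (𝓡 n) x)]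
variable [MeasurableSpace X] [BorelSpace X]

local notation "φ[" x "]" => chartAt (EuclideanSpace ℝ (Fin n)) x

lemma aemeasurable_chart_symm (x₀ : X) : AEMeasurable φ[x₀].symm
    ((volume : Measure (EuclideanSpace ℝ (Fin n))).restrict φ[x₀].target) :=
  φ[x₀].continuousOn_symm.aemeasurable φ[x₀].open_target.measurableSet

/-- The inverse chart is continuous only on its target, so measurability is checked on the subtype.
-/
lemma measurableSet_target_inter_preimage (x₀ : X) {A : Set X} (hA : MeasurableSet A)
    {S : Set (EuclideanSpace ℝ (Fin n))} (hS : MeasurableSet S) (hSt : S ⊆ φ[x₀].target) :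
    MeasurableSet (S ∩ φ[x₀].symm ⁻¹' A) := by
  have h : Measurable (S.domRestrict φ[x₀].symm) :=
    ((φ[x₀].continuousOn_symm.mono hSt).domRestrict).measurable
  have h2 := hS.subtype_image (h hA)
  convert h2 using 1
  ext z
  simp only [mem_inter_iff, mem_preimage, mem_image, Subtype.exists, exists_and_right,
    exists_eq_right]
  exact ⟨fun h => ⟨h.1, h.2⟩, fun ⟨h, h'⟩ => ⟨h, h'⟩⟩

lemma chartVolume_apply (x₀ : X) {A : Set X} (hA : MeasurableSet A) :
    chartVolume n x₀ A = ∫⁻ z in φ[x₀].target ∩ φ[x₀].symm ⁻¹' A,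
      ENNReal.ofReal √(metricMatrix n x₀ (φ[x₀].symm z)).det := by
  have h := aemeasurable_chart_symm (n := n) x₀
  have hm := measurableSet_target_inter_preimage (n := n) x₀ hA φ[x₀].open_target.measurableSet
    subset_rfl
  rw [chartVolume, Measure.map_apply_of_aemeasurable
      (h.mono_ac (withDensity_absolutelyContinuous _ _)) hA,
    withDensity_apply']
  rw [inter_comm, ← Measure.restrict_restrict₀' φ[x₀].open_target.measurableSet.nullMeasurableSet]

/-- Change of variables: the Jacobian turns one density into the other. It is only an inequality
because part of A may lie outside the chart at x₁, where that chart measure vanishes. -/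
lemma chartVolume_le_of_subset_source (x₀ x₁ : X) {A : Set X} (hA : MeasurableSet A)
    (hA₀ : A ⊆ φ[x₀].source) : chartVolume n x₁ A ≤ chartVolume n x₀ A := by
  rw [chartVolume_apply x₁ hA, chartVolume_apply x₀ hA]
  set O := φ[x₀].target ∩ φ[x₀].symm ⁻¹' (A ∩ φ[x₁].source) with hO
  have hOm : MeasurableSet O := measurableSet_target_inter_preimage x₀
    (hA.inter φ[x₁].open_source.measurableSet) φ[x₀].open_target.measurableSet subset_rfl
  have himg : φ[x₁].target ∩ φ[x₁].symm ⁻¹' A = (fun w => φ[x₁] (φ[x₀].symm w)) '' O := by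
    ext z
    constructor
    · rintro ⟨hz, hzA⟩
      have h1 := φ[x₁].map_target hz
      have h2 := hA₀ hzA
      refine ⟨φ[x₀] (φ[x₁].symm z), ⟨φ[x₀].map_source h2, ?_⟩, ?_⟩
      · simp only [mem_preimage, φ[x₀].left_inv h2]
        exact ⟨hzA, h1⟩
      · simp only [φ[x₀].left_inv h2, φ[x₁].right_inv hz]
    · rintro ⟨w, ⟨hw, hwA, hws⟩, rfl⟩
      refine ⟨φ[x₁].map_source hws, ?_⟩
      simp only [mem_preimage, φ[x₁].left_inv hws]
      exact hwA
  have hinj : InjOn (fun w => φ[x₁] (φ[x₀].symm w)) O := by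
    intro w hw w' hw' h
    exact φ[x₀].symm.injOn hw.1 hw'.1 (φ[x₁].injOn hw.2.2 hw'.2.2 h)
  rw [himg, lintegral_image_eq_lintegral_abs_det_fderiv_mul volume hOm
    (fun w hw => (hasFDerivAt_transition x₀ x₁ hw.1 hw.2.2).hasFDerivWithinAt) hinj]
  refine le_trans (le_of_eq (setLIntegral_congr_fun hOm fun w hw => ?_))
    (lintegral_mono_set (inter_subset_inter_right _ (preimage_mono inter_subset_left)))
  simp only [φ[x₁].left_inv hw.2.2]
  rw [det_metricMatrix_eq x₀ x₁ hw.2.2, Real.sqrt_mul (sq_nonneg _), Real.sqrt_sq_eq_abs,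
    ENNReal.ofReal_mul (abs_nonneg _)]

/-- A supremum of measures is not computed set by set, so the bound comes from an upper bound of the
family. Each chart measure is at most `chartVolume n x₀` plus the volume restricted to the
complement of the source, and the latter disappears on restriction. -/
lemma riemannianVolume_restrict_source_le (x₀ : X) :
    (riemannianVolume n X).restrict φ[x₀].source ≤ chartVolume n x₀ := by
  have hs : MeasurableSet φ[x₀].source := φ[x₀].open_source.measurableSet
  have h : riemannianVolume n X ≤
      chartVolume n x₀ + (riemannianVolume n X).restrict φ[x₀].sourceᶜ := by
    refine iSup_le fun x₁ => ?_
    rw [← Measure.restrict_add_restrict_compl (μ := chartVolume n x₁) hs]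
    refine add_le_add (Measure.le_iff.2 fun A hA => ?_)
      (Measure.restrict_mono subset_rfl (le_iSup (chartVolume n) x₁))
    rw [Measure.restrict_apply hA]
    exact (chartVolume_le_of_subset_source x₀ x₁ (hA.inter hs) inter_subset_right).trans
      (measure_mono inter_subset_left)
  refine Measure.le_iff.2 fun A hA => ?_
  rw [Measure.restrict_apply hA]
  refine (h _).trans ?_
  rw [Measure.add_apply, Measure.restrict_apply (hA.inter hs), inter_assoc, inter_compl_self,
    inter_empty, measure_empty, add_zero]
  exact measure_mono inter_subset_left

lemma chartVolume_le_riemannianVolume (x₀ : X) : chartVolume n x₀ ≤ riemannianVolume n X :=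
  le_iSup (chartVolume n) x₀

lemma continuousOn_det_metricMatrix (x₀ : X) :
    ContinuousOn (fun x => (metricMatrix n x₀ x).det) φ[x₀].source := by
  simp only [Matrix.det_apply']
  refine continuousOn_finsetSum _ fun σ _ => continuousOn_const.mul ?_
  refine continuousOn_finsetProd _ fun i _ => ?_
  exact (contMDiffOn_inner_constSection (n := n) (E := (TangentSpace (𝓡 n) : X → Type _))
        x₀ _ _).continuousOn

/-- In a chart, the Riemannian volume is locally comparable to the Lebesgue measure. -/
lemma exists_ball_volume_comparable (x₀ : X) : ∃ C : ℝ, 0 < C ∧ ∃ a > 0,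
    Metric.ball (φ[x₀] x₀) a ⊆ φ[x₀].target ∧ ∀ B : Set (EuclideanSpace ℝ (Fin n)),
      B ⊆ Metric.ball (φ[x₀] x₀) a → MeasurableSet B →
      (volume.restrict B).map φ[x₀].symm ≤ ENNReal.ofReal C • riemannianVolume n X ∧
      (riemannianVolume n X).restrict (φ[x₀].symm '' B) ≤
        ENNReal.ofReal C • (volume.restrict B).map φ[x₀].symm := by
  set h : EuclideanSpace ℝ (Fin n) → ℝ := fun z => √(metricMatrix n x₀ (φ[x₀].symm z)).det with hh
  set z₀ := φ[x₀] x₀ with hz₀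
  have hz₀t : z₀ ∈ φ[x₀].target := φ[x₀].map_source (mem_chart_source _ _)
  have hcont : ContinuousAt h z₀ := by
    have h1 : ContinuousOn h φ[x₀].target :=
      Real.continuous_sqrt.comp_continuousOn ((continuousOn_det_metricMatrix x₀).comp
        φ[x₀].continuousOn_symm φ[x₀].symm.mapsTo)
    exact h1.continuousAt (φ[x₀].open_target.mem_nhds hz₀t)
  have hpos : 0 < h z₀ := Real.sqrt_pos.2 (det_metricMatrix_pos x₀ (φ[x₀].map_target hz₀t))
  -- Near the center the density stays between half and twice its central value.
  have hev : ∀ᶠ z in 𝓝 z₀, z ∈ φ[x₀].target ∧ h z₀ / 2 < h z ∧ h z < 2 * h z₀ :=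
    Filter.Eventually.and (φ[x₀].open_target.eventually_mem hz₀t)
      ((hcont.eventually_const_lt (by linarith)).and
      (hcont.eventually_lt_const (by linarith)))
  obtain ⟨a, ha, hball⟩ := Metric.mem_nhds_iff.1 hev
  -- The first summand serves the upper bound on the density, the second the lower bound.
  refine ⟨2 * h z₀ + (h z₀ / 2)⁻¹, by positivity, a, ha, fun z hz => (hball hz).1,
    fun B hB hBm => ?_⟩
  have hBt : B ⊆ φ[x₀].target := fun z hz => (hball (hB hz)).1
  have hmeas : AEMeasurable φ[x₀].symm (volume.restrict B) :=
    (aemeasurable_chart_symm x₀).mono_measure (Measure.restrict_mono hBt le_rfl)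
  constructor
  · refine Measure.le_iff.2 fun A hA => ?_
    rw [Measure.smul_apply, smul_eq_mul]
    refine le_trans ?_ (mul_le_mul_right (chartVolume_le_riemannianVolume x₀ A) _)
    rw [chartVolume_apply x₀ hA, Measure.map_apply_of_aemeasurable hmeas hA,
      Measure.restrict_apply' hBm, ← lintegral_const_mul' _ _ ENNReal.ofReal_ne_top, inter_comm]
    refine le_trans ?_ (lintegral_mono_set (inter_subset_inter_left _ hBt))
    rw [← setLIntegral_one]
    refine setLIntegral_mono' (measurableSet_target_inter_preimage x₀ hA hBm hBt) fun z hz => ?_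
    rw [← ENNReal.ofReal_mul (by positivity), ← ENNReal.ofReal_one]
    refine ENNReal.ofReal_le_ofReal ?_
    have h1 := (hball (hB hz.1)).2.1
    have h2 : (h z₀ / 2)⁻¹ * (h z₀ / 2) = 1 := inv_mul_cancel₀ (by positivity)
    calc (1 : ℝ) = (h z₀ / 2)⁻¹ * (h z₀ / 2) := h2.symm
      _ ≤ (2 * h z₀ + (h z₀ / 2)⁻¹) * h z := by
        gcongr
        linarith
  · have himg : φ[x₀].symm '' B ⊆ φ[x₀].source := by
      rintro _ ⟨z, hz, rfl⟩
      exact φ[x₀].map_target (hBt hz)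
    have himgm : MeasurableSet (φ[x₀].symm '' B) := by
      have : φ[x₀].symm '' B = Subtype.val '' (φ[x₀].source.domRestrict φ[x₀] ⁻¹' B) := by
        ext x
        constructor
        · rintro ⟨z, hz, rfl⟩
          exact ⟨⟨φ[x₀].symm z, φ[x₀].map_target (hBt hz)⟩, by
            simp [domRestrict, φ[x₀].right_inv (hBt hz), hz], rfl⟩
        · rintro ⟨⟨y, hy⟩, hyB, rfl⟩
          exact ⟨φ[x₀] y, hyB, φ[x₀].left_inv hy⟩
      rw [this]
      exact φ[x₀].open_source.measurableSet.subtype_image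
        (φ[x₀].continuousOn.domRestrict.measurable hBm)
    refine Measure.le_iff.2 fun A hA => ?_
    have h1 : (riemannianVolume n X).restrict (φ[x₀].symm '' B) A ≤
        chartVolume n x₀ (A ∩ φ[x₀].symm '' B) := by
      rw [Measure.restrict_apply hA]
      refine le_trans (le_of_eq ?_) (riemannianVolume_restrict_source_le x₀ _)
      rw [Measure.restrict_apply (hA.inter himgm), inter_eq_left.2 (inter_subset_right.trans himg)]
    refine h1.trans ?_
    rw [chartVolume_apply x₀ (hA.inter himgm), Measure.smul_apply, smul_eq_mul,
      Measure.map_apply_of_aemeasurable hmeas hA, Measure.restrict_apply' hBm]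
    have hset : φ[x₀].target ∩ φ[x₀].symm ⁻¹' (A ∩ φ[x₀].symm '' B) = B ∩ φ[x₀].symm ⁻¹' A := by
      ext z
      constructor
      · rintro ⟨hz, hzA, w, hw, hwz⟩
        rw [← φ[x₀].symm.injOn (hBt hw) hz hwz]
        exact ⟨hw, by rw [mem_preimage, hwz]; exact hzA⟩
      · rintro ⟨hz, hzA⟩
        exact ⟨hBt hz, hzA, z, hz, rfl⟩
    rw [hset, inter_comm (φ[x₀].symm ⁻¹' A), ← setLIntegral_one,
      ← lintegral_const_mul' _ _ ENNReal.ofReal_ne_top]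
    refine setLIntegral_mono' (measurableSet_target_inter_preimage x₀ hA hBm hBt) fun z hz => ?_
    rw [mul_one]
    refine ENNReal.ofReal_le_ofReal ?_
    have h2 := (hball (hB hz.1)).2.2
    have h3 : 0 < (h z₀ / 2)⁻¹ := by positivity
    change h z ≤ _
    linarith

end VolumeMeasure

/-! ### Local bounds for fiber norms and for the connection -/

section LocalBounds

variable {n : ℕ} {X : Type*} [EMetricSpace X]
  [ChartedSpace (EuclideanSpace ℝ (Fin n)) X]
  [IsManifold (𝓡 n) ∞ X] [RiemannianBundle (fun x : X => TangentSpace (𝓡 n) x)]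
  [IsContMDiffRiemannianBundle (𝓡 n) ∞ (EuclideanSpace ℝ (Fin n))
    (fun x : X => TangentSpace (𝓡 n) x)]
  {F : Type*} [NormedAddCommGroup F] [NormedSpace ℝ F] [FiniteDimensional ℝ F]
  {E : X → Type*} [TopologicalSpace (TotalSpace F E)] [∀ x, NormedAddCommGroup (E x)]
  [∀ x, InnerProductSpace ℝ (E x)] [FiberBundle F E] [VectorBundle ℝ F E]
  [ContMDiffVectorBundle ∞ F E (𝓡 n)] [IsContMDiffRiemannianBundle (𝓡 n) ∞ F E]

lemma norm_apply_le_hsNorm_mul {V W : Type*} [NormedAddCommGroup V] [InnerProductSpace ℝ V]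
    [FiniteDimensional ℝ V] [NormedAddCommGroup W] [InnerProductSpace ℝ W] (T : V →L[ℝ] W) (v : V) :
    ‖T v‖ ≤ hsNorm T * ‖v‖ := by
  set b := stdOrthonormalBasis ℝ V
  have h1 : T v = ∑ i, b.repr v i • T (b i) := by
    conv_lhs => rw [← b.sum_repr v, map_sum]
    simp only [map_smul]
  rw [h1, hsNorm]
  calc ‖∑ i, b.repr v i • T (b i)‖ ≤ ∑ i, ‖T (b i)‖ * ‖b.repr v i‖ := by
        refine (norm_sum_le _ _).trans (Finset.sum_le_sum fun i _ => ?_)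
        rw [norm_smul, mul_comm]
    _ ≤ √(∑ i, ‖T (b i)‖ ^ 2) * √(∑ i, ‖b.repr v i‖ ^ 2) := Real.sum_mul_le_sqrt_mul_sqrt _ _ _
    _ = √(∑ i, ‖T (b i)‖ ^ 2) * ‖v‖ := by
        rw [← EuclideanSpace.norm_eq, b.repr.norm_map]

variable (F E) in
/-- The fiber norms are locally comparable to the norm of `F` in a trivialization. -/
lemma eventually_norm_le_fiberCoord [IsContinuousRiemannianBundle F E] (x₀ : X) :
    ∃ C > 0, ∀ᶠ y in 𝓝 x₀, ∀ v : E y,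
    ‖v‖ ≤ C * ‖fiberCoord F x₀ v‖ ∧ ‖fiberCoord F x₀ v‖ ≤ C * ‖v‖ := by
  obtain ⟨C₁, hC₁, h₁⟩ := eventually_norm_symmL_trivializationAt_lt F E x₀
  obtain ⟨C₂, hC₂, h₂⟩ := eventually_norm_trivializationAt_lt F E x₀
  refine ⟨max C₁ C₂, lt_max_of_lt_left hC₁, ?_⟩
  filter_upwards [h₁, h₂, (trivializationAt F E x₀).open_baseSet.mem_nhds
    (FiberBundle.mem_baseSet_trivializationAt' x₀)] with y hy₁ hy₂ hy v
  constructor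
  · have h := ((trivializationAt F E x₀).symmL ℝ y).le_of_opNorm_le hy₁.le (fiberCoord F x₀ v)
    have h' : (trivializationAt F E x₀).symmL ℝ y (fiberCoord F x₀ v) = v :=
      constSection_fiberCoord x₀ hy v
    rw [h'] at h
    exact h.trans (mul_le_mul_of_nonneg_right (le_max_left _ _) (norm_nonneg _))
  · exact (((trivializationAt F E x₀).continuousLinearMapAt ℝ y).le_of_opNorm_le hy₂.le v).trans
      (mul_le_mul_of_nonneg_right (le_max_right _ _) (norm_nonneg _))

/-- A smooth connection has locally bounded coefficients. -/
lemma eventually_norm_connection_le (A : CovariantDerivative (𝓡 n) F E)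
    [CovariantDerivative.ContMDiffCovariantDerivative A ∞] (x₀ : X) (c : F)
    (v : EuclideanSpace ℝ (Fin n)) : ∃ C, ∀ᶠ y in 𝓝 x₀,
      ‖fiberCoord F x₀ (A (constSection E x₀ c) y (coordField n x₀ y v))‖ ≤ C := by
  set e := trivializationAt F E x₀ with he
  have hx₀ : x₀ ∈ e.baseSet := FiberBundle.mem_baseSet_trivializationAt' x₀
  -- Smoothness of the connection is applied to a globally smooth section, so the local constant
  -- section is cut off by a bump function.
  obtain ⟨f, hf⟩ : ∃ f : SmoothBumpFunction (𝓡 n) x₀, tsupport f ⊆ e.baseSet :=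
    ((SmoothBumpFunction.nhds_basis_tsupport x₀).mem_iff.1 (e.open_baseSet.mem_nhds hx₀)).imp
      fun f hf => hf.2
  set σ : Π x : X, E x := fun x => f x • constSection E x₀ c x with hσ
  have hσs : ContMDiff (𝓡 n) ((𝓡 n).prod 𝓘(ℝ, F)) ∞ (fun x => TotalSpace.mk' F x (σ x)) :=
    contMDiffOn_univ.1 ((ContMDiffOn.smul_section_of_tsupport (V := E) (F := F)
      f.contMDiff.contMDiffOn e.open_baseSet hf (contMDiffOn_constSection x₀ c)).contMDiffOn)
  have hAσ := (CovariantDerivative.ContMDiffCovariantDerivative.contMDiff (cov := A)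
    (k := (∞ : ℕ∞ω))).contMDiff (σ := σ) (by simpa using hσs.contMDiffOn)
  have hs : ContMDiffAt (𝓡 n) ((𝓡 n).prod 𝓘(ℝ, F)) ∞
      (fun x => TotalSpace.mk' F x (A σ x (coordField n x₀ x v))) x₀ :=
    ContMDiffAt.clm_bundle_apply (b := fun x => x) (v := fun x => coordField n x₀ x v)
      (hAσ.contMDiffAt Filter.univ_mem)
      ((contMDiffOn_constSection (n := n) (E := (TangentSpace (𝓡 n) : X → Type _)) x₀ v).contMDiffAt
        ((chartAt (EuclideanSpace ℝ (Fin n)) x₀).open_source.mem_nhds (mem_chart_source _ _)))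
  have hcont := ((contMDiffAt_section x₀).1 hs).continuousAt.norm
  refine ⟨‖(e ⟨x₀, A σ x₀ (coordField n x₀ x₀ v)⟩).2‖ + 1, ?_⟩
  filter_upwards [hcont.eventually_lt_const (lt_add_one _), e.open_baseSet.mem_nhds hx₀,
    f.eventuallyEq_one.eventuallyEq_nhds] with y hy hye hyf
  -- Locality of A: the cutoff equals 1 near y, so it does not change the derivative there.
  have h1 : A (constSection E x₀ c) y = A σ y := by
    refine A.isCovariantDerivativeOnUniv.congr_of_eventuallyEq
      (mdifferentiableAt_constSection x₀ c hye) (hσs.mdifferentiable (by simp) y)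
      Filter.univ_mem ?_
    filter_upwards [hyf] with w hw
    simp [hσ, hw]
  rw [h1, fiberCoord, Trivialization.continuousLinearMapAt_apply_of_mem ℝ _ hye]
  exact hy.le

/-- The coordinate derivatives of a section are locally bounded by the section and its covariant
derivative. -/
lemma eventually_norm_derivCoord_le (A : CovariantDerivative (𝓡 n) F E)
    [CovariantDerivative.ContMDiffCovariantDerivative A ∞] (x₀ : X) : ∃ C > 0, ∀ᶠ y in 𝓝 x₀,
    ∀ (T : TangentSpace (𝓡 n) y →L[ℝ] E y) (v : E y) (i : Fin n),
      ‖fiberCoord F x₀ (T (coordField n x₀ y (EuclideanSpace.basisFun (Fin n) ℝ i))) -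
        fiberCoord F x₀ (A (constSection E x₀ (fiberCoord F x₀ v)) y
          (coordField n x₀ y (EuclideanSpace.basisFun (Fin n) ℝ i)))‖ ≤ C * (hsNorm T + ‖v‖) := by
  have := IsContMDiffRiemannianBundle.isContinuousRiemannianBundle
    (n := n) (F := F) (E := E)
  obtain ⟨C₁, hC₁, h₁⟩ := eventually_norm_le_fiberCoord F E x₀
  obtain ⟨C₂, hC₂, h₂⟩ := eventually_enorm_coordField_le (n := n) x₀
  set b := Module.finBasis ℝ F with hb
  choose K hK using fun (p : Fin (Module.finrank ℝ F) × Fin n) =>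
    eventually_norm_connection_le A x₀ (b p.1) (EuclideanSpace.basisFun (Fin n) ℝ p.2)
  obtain ⟨L, hL⟩ : ∃ L, ∀ (j : Fin (Module.finrank ℝ F)) (w : F), ‖b.repr w j‖ ≤ L * ‖w‖ := by
    refine ⟨∑ j, ‖LinearMap.toContinuousLinearMap (b.coord j)‖, fun j w => ?_⟩
    refine ((LinearMap.toContinuousLinearMap (b.coord j)).le_opNorm w).trans ?_
    refine mul_le_mul_of_nonneg_right ?_ (norm_nonneg w)
    exact Finset.single_le_sum (f := fun j => ‖LinearMap.toContinuousLinearMap (b.coord j)‖)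
      (fun j _ => norm_nonneg _) (Finset.mem_univ j)
  set K' := ∑ p, |K p|
  refine ⟨C₁ * C₂ + Module.finrank ℝ F * (|L| * C₁ * K'), by positivity, ?_⟩
  filter_upwards [h₁, h₂, Filter.eventually_all.2 hK, (trivializationAt F E x₀).open_baseSet.mem_nhds
    (FiberBundle.mem_baseSet_trivializationAt' x₀)] with y hy₁ hy₂ hyK hy T v i
  set ei := EuclideanSpace.basisFun (Fin n) ℝ i with hei
  have hK' : ∀ p, K p ≤ K' := fun p => (le_abs_self _).trans
    (Finset.single_le_sum (f := fun p => |K p|) (fun j _ => abs_nonneg _) (Finset.mem_univ p))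
  have hfirst : ‖fiberCoord F x₀ (T (coordField n x₀ y ei))‖ ≤ C₁ * C₂ * hsNorm T := by
    have h3 : ‖coordField n x₀ y ei‖ ≤ C₂ := by
      have h := hy₂ ei
      have h1 : ‖ei‖ = 1 := (EuclideanSpace.basisFun (Fin n) ℝ).norm_eq_one i
      rw [← ofReal_norm, ← ofReal_norm, h1, ENNReal.ofReal_one, mul_one] at h
      exact ENNReal.ofReal_le_coe.1 h
    calc _ ≤ C₁ * ‖T (coordField n x₀ y ei)‖ := (hy₁ _).2
      _ ≤ C₁ * (hsNorm T * ‖coordField n x₀ y ei‖) := by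
        gcongr; exact norm_apply_le_hsNorm_mul _ _
      _ ≤ C₁ * (hsNorm T * C₂) := by
        have := hsNorm_nonneg T
        gcongr
      _ = _ := by ring
  -- The coefficients are real constants, frozen at the point y, so only additivity and constant
  -- multiples are needed and no Leibniz term appears. This reduces the connection term to finitely
  -- many basis sections, with a bound uniform in v.
  have hcs : ∀ (ι : Finset (Fin (Module.finrank ℝ F))) (a : Fin (Module.finrank ℝ F) → ℝ),
      A (constSection E x₀ (∑ j ∈ ι, a j • b j)) y =
      ∑ j ∈ ι, a j • A (constSection E x₀ (b j)) y := by
    intro ι a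
    induction ι using Finset.induction_on with
    | empty =>
      have h0 : constSection E x₀ (0 : F) = 0 := by ext x; simp [constSection]
      simp [h0]
    | insert j ι hj ih =>
      rw [Finset.sum_insert hj, Finset.sum_insert hj, constSection_add, constSection_smul,
        A.isCovariantDerivativeOnUniv.add _ (mdifferentiableAt_constSection x₀ _ hy),
        A.isCovariantDerivativeOnUniv.smul_const _ (mdifferentiableAt_constSection x₀ _ hy), ih]
      rw [← constSection_smul]
      exact mdifferentiableAt_constSection x₀ _ hy
  have hsecond : ‖fiberCoord F x₀ (A (constSection E x₀ (fiberCoord F x₀ v)) y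
      (coordField n x₀ y ei))‖ ≤ Module.finrank ℝ F * (|L| * C₁ * K') * ‖v‖ := by
    rw [← b.sum_repr (fiberCoord F x₀ v), hcs, sum_apply, fiberCoord, map_sum]
    refine (norm_sum_le _ _).trans ?_
    rw [mul_assoc, ← nsmul_eq_mul]
    refine (Finset.sum_le_card_nsmul _ _ (|L| * C₁ * K' * ‖v‖) fun j _ => ?_).trans
      (le_of_eq (by simp))
    rw [smul_apply, map_smul, norm_smul]
    calc _ ≤ (|L| * (C₁ * ‖v‖)) * K' := by
          gcongr
          · refine (hL _ _).trans ?_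
            gcongr
            · exact le_abs_self _
            · exact (hy₁ _).2
          · exact (hyK (j, i)).trans (hK' _)
      _ = _ := by ring
  have hT := hsNorm_nonneg T
  have hv := norm_nonneg v
  have hp : 0 ≤ (Module.finrank ℝ F * (|L| * C₁ * K') : ℝ) := by positivity
  calc _ ≤ C₁ * C₂ * hsNorm T + Module.finrank ℝ F * (|L| * C₁ * K') * ‖v‖ :=
        (norm_sub_le _ _).trans (add_le_add hfirst hsecond)
    _ ≤ (C₁ * C₂ + Module.finrank ℝ F * (|L| * C₁ * K')) * hsNorm T +
        (C₁ * C₂ + Module.finrank ℝ F * (|L| * C₁ * K')) * ‖v‖ := by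
        gcongr
        · linarith
        · have : 0 ≤ C₁ * (C₂ : ℝ) := by positivity
          linarith
    _ = _ := by ring

end LocalBounds

/-! ### Transfer of integrals along a map with comparable measures -/

lemma lintegral_comp_le_of_map_le {α β : Type*} [MeasurableSpace α] [MeasurableSpace β]
    {μ : Measure α} {ν : Measure β} {φ : α → β} (hφ : AEMeasurable φ μ) {c : ℝ≥0∞}
    (h : μ.map φ ≤ c • ν) {f : β → ℝ≥0∞} (hf : AEMeasurable f ν) {A : Set β} (hA : MeasurableSet A)
    (hA' : ∀ᵐ z ∂μ, φ z ∈ A) : ∫⁻ z, f (φ z) ∂μ ≤ c * ∫⁻ y in A, f y ∂ν := by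
  have hac : μ.map φ ≪ ν := (Measure.absolutelyContinuous_of_le h).trans
    Measure.smul_absolutelyContinuous
  have h1 : ∫⁻ z, f (φ z) ∂μ = ∫⁻ z, A.indicator f (φ z) ∂μ :=
    lintegral_congr_ae (hA'.mono fun z hz => (indicator_of_mem hz f).symm)
  rw [h1, ← lintegral_map' ((hf.mono_ac hac).indicator hA) hφ, ← lintegral_indicator hA,
    ← smul_eq_mul, ← lintegral_smul_measure]
  exact lintegral_mono' h le_rfl

lemma setLIntegral_le_of_le_map {α β : Type*} [MeasurableSpace α] [MeasurableSpace β]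
    {μ : Measure α} {ν : Measure β} {φ : α → β} (hφ : AEMeasurable φ μ) {c : ℝ≥0∞}
    (h : ν ≤ c • μ.map φ) {f : β → ℝ≥0∞} (hf : AEMeasurable f (μ.map φ)) {A : Set β}
    (hA : MeasurableSet A) {B : Set α} (hB : MeasurableSet B) (hAB : ∀ᵐ z ∂μ, φ z ∈ A → z ∈ B) :
    ∫⁻ y in A, f y ∂ν ≤ c * ∫⁻ z in B, f (φ z) ∂μ := by
  have h1 : ∫⁻ z, A.indicator f (φ z) ∂μ ≤ ∫⁻ z, B.indicator (fun z => f (φ z)) z ∂μ := by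
    refine lintegral_mono_ae (hAB.mono fun z hz => ?_)
    by_cases hzA : φ z ∈ A
    · rw [indicator_of_mem hzA, indicator_of_mem (hz hzA)]
    · rw [indicator_of_notMem hzA]
      exact zero_le
  rw [← lintegral_indicator hB]
  refine le_trans ?_ (mul_le_mul_right h1 c)
  rw [← lintegral_map' (hf.indicator hA) hφ, ← lintegral_indicator hA, ← smul_eq_mul,
    ← lintegral_smul_measure]
  exact lintegral_mono' h le_rfl

/-! ### Comparison balls and the passage to weak partial derivatives -/

section LocalEstimate

variable {n : ℕ} {X : Type*} [EMetricSpace X] 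
  [ChartedSpace (EuclideanSpace ℝ (Fin n)) X]
  [IsManifold (𝓡 n) ∞ X] [RiemannianBundle (fun x : X => TangentSpace (𝓡 n) x)]
  [IsContMDiffRiemannianBundle (𝓡 n) ∞ (EuclideanSpace ℝ (Fin n))
    (fun x : X => TangentSpace (𝓡 n) x)]
  [MeasurableSpace X] [BorelSpace X]
  {F : Type*} [NormedAddCommGroup F] [NormedSpace ℝ F] [FiniteDimensional ℝ F]
  {E : X → Type*} [TopologicalSpace (TotalSpace F E)] [∀ x, NormedAddCommGroup (E x)]
  [∀ x, InnerProductSpace ℝ (E x)] [FiberBundle F E] [VectorBundle ℝ F E]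
  [ContMDiffVectorBundle ∞ F E (𝓡 n)] [IsContMDiffRiemannianBundle (𝓡 n) ∞ F E]

local notation "φ[" x "]" => chartAt (EuclideanSpace ℝ (Fin n)) x

/-- Over the image of the Euclidean ball of radius `a`, the distance, the volume, the fiber norms
and the derivatives agree with the Euclidean ones up to the factor `C`. -/
structure IsComparisonBall (A : CovariantDerivative (𝓡 n) F E) (x₀ : X) (C a : ℝ) : Prop where
  one_le : 1 ≤ C
  pos : 0 < a
  subset : Metric.ball (φ[x₀] x₀) a ⊆ chartDomain n F E x₀
  edist_symm_le : ∀ z ∈ Metric.ball (φ[x₀] x₀) a, ∀ w ∈ Metric.ball (φ[x₀] x₀) a,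
    edist (φ[x₀].symm z) (φ[x₀].symm w) ≤ ENNReal.ofReal C * edist z w
  edist_le : ∀ z ∈ Metric.ball (φ[x₀] x₀) a, ∀ w ∈ Metric.ball (φ[x₀] x₀) a,
    edist z w ≤ ENNReal.ofReal C * edist (φ[x₀].symm z) (φ[x₀].symm w)
  map_volume_le : ∀ B ⊆ Metric.ball (φ[x₀] x₀) a, MeasurableSet B →
    (volume.restrict B).map φ[x₀].symm ≤ ENNReal.ofReal C • riemannianVolume n X
  restrict_volume_le : ∀ B ⊆ Metric.ball (φ[x₀] x₀) a, MeasurableSet B →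
    (riemannianVolume n X).restrict (φ[x₀].symm '' B) ≤
      ENNReal.ofReal C • (volume.restrict B).map φ[x₀].symm
  enorm_le : ∀ z ∈ Metric.ball (φ[x₀] x₀) a, ∀ s : Π x : X, E x,
    ‖s (φ[x₀].symm z)‖ₑ ≤ ENNReal.ofReal C * ‖sectionCoord n F s x₀ z‖ₑ
  enorm_sectionCoord_le : ∀ z ∈ Metric.ball (φ[x₀] x₀) a, ∀ s : Π x : X, E x,
    ‖sectionCoord n F s x₀ z‖ₑ ≤ ENNReal.ofReal C * ‖s (φ[x₀].symm z)‖ₑ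
  enorm_derivCoord_le : ∀ z ∈ Metric.ball (φ[x₀] x₀) a, ∀ (s : Π x : X, E x)
    (t : Π x : X, TangentSpace (𝓡 n) x →L[ℝ] E x) (i : Fin n),
    ‖derivCoord A s t x₀ (EuclideanSpace.basisFun (Fin n) ℝ i) z‖ₑ ≤ ENNReal.ofReal C *
      (ENNReal.ofReal (hsNorm (t (φ[x₀].symm z))) + ‖s (φ[x₀].symm z)‖ₑ)

lemma exists_isComparisonBall [IsRiemannianManifold (𝓡 n) X] (A : CovariantDerivative (𝓡 n) F E)
    [CovariantDerivative.ContMDiffCovariantDerivative A ∞] (x₀ : X) :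
    ∃ C a, IsComparisonBall A x₀ C a := by
  have := IsContMDiffRiemannianBundle.isContinuousRiemannianBundle
    (n := n) (F := F) (E := E)
  obtain ⟨C₁, hC₁, a₁, ha₁, h₁⟩ := exists_ball_edist_symm_le (n := n) x₀
  obtain ⟨C₂, hC₂, a₂, ha₂, h₂⟩ := exists_ball_edist_le (n := n) x₀
  obtain ⟨C₃, hC₃, a₃, ha₃, h₃, h₃'⟩ := exists_ball_volume_comparable (n := n) x₀
  obtain ⟨C₄, hC₄, h₄⟩ := eventually_norm_le_fiberCoord F E x₀
  obtain ⟨C₅, hC₅, h₅⟩ := eventually_norm_derivCoord_le A x₀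
  set z₀ := φ[x₀] x₀ with hz₀
  have hz₀t : z₀ ∈ φ[x₀].target := φ[x₀].map_source (mem_chart_source _ _)
  have hsymm : Filter.Tendsto φ[x₀].symm (𝓝 z₀) (𝓝 x₀) := by
    have := φ[x₀].continuousAt_symm hz₀t
    rwa [ContinuousAt, φ[x₀].left_inv (mem_chart_source _ _)] at this
  have hdom : ∀ᶠ z in 𝓝 z₀, z ∈ chartDomain n F E x₀ := by
    refine (isOpen_chartDomain x₀).mem_nhds ⟨hz₀t, ?_⟩
    rw [mem_preimage, φ[x₀].left_inv (mem_chart_source _ _)]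
    exact FiberBundle.mem_baseSet_trivializationAt' x₀
  obtain ⟨a₄, ha₄, h⟩ := Metric.mem_nhds_iff.1 (hdom.and ((hsymm.eventually h₄).and
    (hsymm.eventually h₅)))
  -- One constant dominates all the local ones; the summand 1 gives C ≥ 1, later used to absorb C
  -- into powers.
  set C : ℝ := 1 + C₁ + C₂ + C₃ + C₄ + C₅ with hC
  set a := min (min a₁ a₂) (min a₃ a₄) with ha
  have hb : ∀ {i}, a ≤ i → Metric.ball z₀ a ⊆ Metric.ball z₀ i := fun h => Metric.ball_subset_ball h
  have hb₁ := hb ((min_le_left _ _).trans (min_le_left _ _) : a ≤ a₁)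
  have hb₂ := hb ((min_le_left _ _).trans (min_le_right _ _) : a ≤ a₂)
  have hb₃ := hb ((min_le_right _ _).trans (min_le_left _ _) : a ≤ a₃)
  have hb₄ := hb ((min_le_right _ _).trans (min_le_right _ _) : a ≤ a₄)
  have hC₁' := C₁.coe_nonneg
  have hC₂' := C₂.coe_nonneg
  have hC1 : (C₁ : ℝ≥0∞) ≤ ENNReal.ofReal C := by
    rw [← ENNReal.ofReal_coe_nnreal]; exact ENNReal.ofReal_le_ofReal (by linarith)
  have hC2 : (C₂ : ℝ≥0∞) ≤ ENNReal.ofReal C := by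
    rw [← ENNReal.ofReal_coe_nnreal]; exact ENNReal.ofReal_le_ofReal (by linarith)
  have hC3 : ENNReal.ofReal C₃ ≤ ENNReal.ofReal C := ENNReal.ofReal_le_ofReal (by linarith)
  have key : ∀ {x y c : ℝ}, 0 ≤ y → x ≤ c * y → c ≤ C →
      ENNReal.ofReal x ≤ ENNReal.ofReal C * ENNReal.ofReal y := by
    intro x y c hy hxy hc
    rw [← ENNReal.ofReal_mul (by linarith)]
    exact ENNReal.ofReal_le_ofReal (hxy.trans (mul_le_mul_of_nonneg_right hc hy))
  refine ⟨C, a, by linarith, by positivity, fun z hz => (h (hb₄ hz)).1, ?_, ?_, ?_, ?_, ?_, ?_, ?_⟩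
  · exact fun z hz w hw => (h₁ z (hb₁ hz) w (hb₁ hw)).trans (mul_le_mul_left hC1 _)
  · exact fun z hz w hw => (h₂ z (hb₂ hz) w (hb₂ hw)).trans (mul_le_mul_left hC2 _)
  · intro B hB hBm
    refine (h₃' B (hB.trans hb₃) hBm).1.trans (Measure.le_iff'.2 fun S => ?_)
    exact mul_le_mul_left hC3 _
  · intro B hB hBm
    refine (h₃' B (hB.trans hb₃) hBm).2.trans (Measure.le_iff'.2 fun S => ?_)
    exact mul_le_mul_left hC3 _
  · intro z hz s
    rw [← ofReal_norm, ← ofReal_norm]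
    exact key (norm_nonneg _) ((h (hb₄ hz)).2.1 _).1 (by linarith)
  · intro z hz s
    rw [← ofReal_norm, ← ofReal_norm]
    exact key (norm_nonneg _) ((h (hb₄ hz)).2.1 _).2 (by linarith)
  · intro z hz s t i
    rw [← ofReal_norm, ← ofReal_norm, ← ENNReal.ofReal_add (hsNorm_nonneg _) (norm_nonneg _)]
    exact key (add_nonneg (hsNorm_nonneg _) (norm_nonneg _)) ((h (hb₄ hz)).2.2 _ _ i) (by linarith)

variable {A : CovariantDerivative (𝓡 n) F E}

/-- A test function supported in Ω, together with its derivative, vanishes off Ω, so the integrals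
over Ω and over the whole chart domain agree. -/
lemma IsWeakCovDeriv.hasWeakPartials {s : Π x : X, E x}
    {t : Π x : X, TangentSpace (𝓡 n) x →L[ℝ] E x} (h : IsWeakCovDeriv A s t) (x₀ : X)
    {Ω : Set (EuclideanSpace ℝ (Fin n))} (hΩ : Ω ⊆ chartDomain n F E x₀) :
    HasWeakPartials Ω (sectionCoord n F s x₀)
      (fun i => derivCoord A s t x₀ (EuclideanSpace.basisFun (Fin n) ℝ i)) where
  locallyIntegrableOn i := (h.locallyIntegrableOn_deriv x₀ _).mono_set hΩ
  integral_eq i η hη hc hs := by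
    have hm := (isOpen_chartDomain (n := n) (F := F) (E := E) x₀).measurableSet
    have hη0 : ∀ z, z ∉ Ω → η =ᶠ[𝓝 z] 0 := fun z hz =>
      notMem_tsupport_iff_eventuallyEq.1 fun h => hz (hs h)
    rw [← setIntegral_eq_of_subset_of_forall_sdiff_eq_zero hm hΩ fun z hz => by
        rw [(hη0 z hz.2).fderiv_eq]; simp,
      ← setIntegral_eq_of_subset_of_forall_sdiff_eq_zero hm hΩ fun z hz => by
        rw [(hη0 z hz.2).eq_of_nhds]; simp]
    exact h.integral_eq x₀ _ η hη hc (hs.trans hΩ)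

end LocalEstimate

/-! ### Estimates carried between X and the comparison balls -/

section SectionEstimate

variable {n : ℕ} {X : Type*} [EMetricSpace X] [CompactSpace X]
  [ChartedSpace (EuclideanSpace ℝ (Fin n)) X]
  [IsManifold (𝓡 n) ∞ X] [RiemannianBundle (fun x : X => TangentSpace (𝓡 n) x)]
  [IsContMDiffRiemannianBundle (𝓡 n) ∞ (EuclideanSpace ℝ (Fin n))
    (fun x : X => TangentSpace (𝓡 n) x)]
  [MeasurableSpace X] [BorelSpace X]
  {F : Type*} [NormedAddCommGroup F] [NormedSpace ℝ F] [FiniteDimensional ℝ F]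
  {E : X → Type*} [TopologicalSpace (TotalSpace F E)] [∀ x, NormedAddCommGroup (E x)]
  [∀ x, InnerProductSpace ℝ (E x)] [FiberBundle F E] [VectorBundle ℝ F E]
  [ContMDiffVectorBundle ∞ F E (𝓡 n)] [IsContMDiffRiemannianBundle (𝓡 n) ∞ F E]
  {A : CovariantDerivative (𝓡 n) F E} {R d p q : ℝ}

local notation "φ[" x "]" => chartAt (EuclideanSpace ℝ (Fin n)) x

lemma lintegral_rpow_le_morreyENorm (hp : 0 < p) (f : X → ℝ≥0∞) :
    ∫⁻ y, f y ^ p ∂(riemannianVolume n X) ≤ morreyENorm n R d p f ^ p := by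
  rw [morreyENorm_rpow hp]
  exact le_self_add

lemma setLIntegral_eball_le_morreyENorm (hp : 0 < p) (f : X → ℝ≥0∞) (x : X) {ρ : ℝ}
    (hρ : ρ ∈ Ioc 0 R) :
    ∫⁻ y in Metric.eball x (ENNReal.ofReal ρ), f y ^ p ∂(riemannianVolume n X) ≤
      morreyENorm n R d p f ^ p * ENNReal.ofReal (ρ ^ (n - d)) := by
  rw [morreyENorm_rpow hp]
  set I := ∫⁻ y in Metric.eball x (ENNReal.ofReal ρ), f y ^ p ∂(riemannianVolume n X)
  have h1 : ENNReal.ofReal (ρ ^ (d - n)) * I ≤ ⨆ ρ ∈ Ioc 0 R, ⨆ x : X,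
      ENNReal.ofReal (ρ ^ (d - n)) *
        ∫⁻ y in Metric.eball x (ENNReal.ofReal ρ), f y ^ p ∂(riemannianVolume n X) :=
    le_trans (le_iSup (fun x : X => ENNReal.ofReal (ρ ^ (d - n)) *
      ∫⁻ y in Metric.eball x (ENNReal.ofReal ρ), f y ^ p ∂(riemannianVolume n X)) x)
      (le_iSup₂ (f := fun ρ (_ : ρ ∈ Ioc 0 R) => ⨆ x : X, ENNReal.ofReal (ρ ^ (d - n)) *
      ∫⁻ y in Metric.eball x (ENNReal.ofReal ρ), f y ^ p ∂(riemannianVolume n X)) ρ hρ)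
  have h2 : ENNReal.ofReal (ρ ^ (d - n)) * ENNReal.ofReal (ρ ^ (n - d)) = 1 := by
    rw [← ENNReal.ofReal_mul (Real.rpow_nonneg hρ.1.le _), ← Real.rpow_add hρ.1]
    simp
  calc I = (ENNReal.ofReal (ρ ^ (d - n)) * ENNReal.ofReal (ρ ^ (n - d))) * I := by
        rw [h2, one_mul]
    _ = (ENNReal.ofReal (ρ ^ (d - n)) * I) * ENNReal.ofReal (ρ ^ (n - d)) := by ring
    _ ≤ _ := by
      gcongr
      exact h1.trans le_add_self

lemma sectionENorm_le_sobolevENorm (hp : 0 < p)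
    (st : (Π x : X, E x) × (Π x : X, TangentSpace (𝓡 n) x →L[ℝ] E x)) :
    sectionENorm n R d p st.1 ≤ sobolevENorm R d p st := by
  rw [sobolevENorm, one_div, ENNReal.le_rpow_inv_iff hp]
  exact le_self_add

lemma homSectionENorm_le_sobolevENorm (hp : 0 < p)
    (st : (Π x : X, E x) × (Π x : X, TangentSpace (𝓡 n) x →L[ℝ] E x)) :
    homSectionENorm R d p st.2 ≤ sobolevENorm R d p st := by
  rw [sobolevENorm, one_div, ENNReal.le_rpow_inv_iff hp]
  exact le_add_self

lemma SobolevSections.sobolevENorm_eq {hp : 1 ≤ p} (st : SobolevSections A R d p hp) :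
    sobolevENorm R d p st.1 = ENNReal.ofReal ‖st‖ :=
  (ENNReal.ofReal_toReal st.2.2.2.2.ne).symm

/-- In a comparison ball the sum |t| + |s| dominates every coordinate derivative: the term |s|
accounts for the connection coefficients. -/
lemma SobolevSections.morreyENorm_add_le {hp : 1 ≤ p} (st : SobolevSections A R d p hp) :
    morreyENorm n R d p (fun y => ENNReal.ofReal (hsNorm (st.1.2 y)) + ‖st.1.1 y‖ₑ) ≤
      ENNReal.ofReal (2 * ‖st‖) := by
  have hp0 : 0 < p := zero_lt_one.trans_le hp
  refine (Morrey.morreyENorm_add_le hp st.2.2.1.aemeasurable_hsNorm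
    st.2.1.aemeasurable_enorm).trans ?_
  rw [two_mul, ENNReal.ofReal_add (norm_nonneg _) (norm_nonneg _), ← st.sobolevENorm_eq]
  exact add_le_add (homSectionENorm_le_sobolevENorm hp0 st.1) (sectionENorm_le_sobolevENorm hp0 st.1)

lemma IsComparisonBall.aemeasurable_symm {x₀ : X} {C a : ℝ} (h : IsComparisonBall A x₀ C a)
    {B : Set (EuclideanSpace ℝ (Fin n))} (hB : B ⊆ Metric.ball (φ[x₀] x₀) a) :
    AEMeasurable φ[x₀].symm (volume.restrict B) :=
  (aemeasurable_chart_symm x₀).mono_measure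
    (Measure.restrict_mono (fun _ hz => (h.subset (hB hz)).1) le_rfl)

/-- A Sobolev section satisfies the hypotheses of the Euclidean estimate in a comparison ball. -/
lemma IsComparisonBall.exists_bound {x₀ : X} {C a b : ℝ} (h : IsComparisonBall A x₀ C a)
    (hba : 4 * b ≤ a) (hbR : 8 * C * b ≤ R) (hp : 1 ≤ p) (hd : 0 < d) :
    ∃ K, 0 ≤ K ∧ ∀ st : SobolevSections A R d p hp,
      IntegrableOn (sectionCoord n F st.1.1 x₀) (Metric.ball (φ[x₀] x₀) (4 * b)) ∧
      ∫ w in Metric.ball (φ[x₀] x₀) (4 * b), ‖sectionCoord n F st.1.1 x₀ w‖ ≤ K * ‖st‖ ∧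
      ∀ y, ∀ ρ ∈ Ioc 0 (4 * b), ∫⁻ w in Metric.ball y ρ ∩ Metric.ball (φ[x₀] x₀) (4 * b),
        (∑ i, ‖derivCoord A st.1.1 st.1.2 x₀ (EuclideanSpace.basisFun (Fin n) ℝ i) w‖ₑ) ^ p ≤
          ENNReal.ofReal ((K * ‖st‖) ^ p * ρ ^ (n - d)) := by
  have hp0 : 0 < p := zero_lt_one.trans_le hp
  have hC0 : 0 < C := zero_lt_one.trans_le h.one_le
  set B := Metric.ball (φ[x₀] x₀) (4 * b) with hBdef
  have hBa : B ⊆ Metric.ball (φ[x₀] x₀) a := Metric.ball_subset_ball hba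
  set v := (volume B).toReal with hv
  have hv0 : 0 ≤ v := ENNReal.toReal_nonneg
  have hvB : volume B = ENNReal.ofReal v := (ENNReal.ofReal_toReal measure_ball_lt_top.ne).symm
  -- Constants at least 1 may be raised to the power p, so that the final bound is the p-th power of
  -- a multiple of the Sobolev norm.
  have hself : ∀ c : ℝ, 1 ≤ c → c ≤ c ^ p := fun c hc => Real.self_le_rpow_of_one_le hc hp
  set K₁ : ℝ := n * C * C * 2 * (2 * C) ^ (n : ℝ)
  set K₂ : ℝ := (1 + v) * C * C
  have hK₁ : 0 ≤ K₁ := by positivity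
  have hK₂ : 0 ≤ K₂ := by positivity
  refine ⟨K₁ + K₂, by positivity, fun st => ?_⟩
  set s := st.1.1
  set t := st.1.2
  set N := ‖st‖ with hN
  have hN0 : 0 ≤ N := norm_nonneg st
  set f : X → ℝ≥0∞ := fun y => ENNReal.ofReal (hsNorm (t y)) + ‖s y‖ₑ with hf
  have hfm : AEMeasurable f (riemannianVolume n X) :=
    st.2.2.1.aemeasurable_hsNorm.add st.2.1.aemeasurable_enorm
  have hsm : AEStronglyMeasurable (sectionCoord n F s x₀) (volume.restrict B) :=
    (st.2.2.2.1.locallyIntegrableOn x₀).aestronglyMeasurable.mono_measure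
      (Measure.restrict_mono (hBa.trans h.subset) le_rfl)
  have hL1 : ∫⁻ w in B, ‖sectionCoord n F s x₀ w‖ₑ ≤ ENNReal.ofReal (K₂ * N) := by
    rw [← ENNReal.rpow_le_rpow_iff hp0]
    refine (lintegral_rpow_le_measure_mul hsm.enorm hp).trans ?_
    have h1 : ∫⁻ w in B, ‖sectionCoord n F s x₀ w‖ₑ ^ p ≤
        ENNReal.ofReal (C ^ p * (C * N ^ p)) := by
      calc ∫⁻ w in B, ‖sectionCoord n F s x₀ w‖ₑ ^ p
          ≤ ∫⁻ w in B, ENNReal.ofReal C ^ p * ‖s (φ[x₀].symm w)‖ₑ ^ p := by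
            refine setLIntegral_mono' Metric.isOpen_ball.measurableSet fun w hw => ?_
            rw [← ENNReal.mul_rpow_of_nonneg _ _ hp0.le]
            exact ENNReal.rpow_le_rpow (h.enorm_sectionCoord_le w (hBa hw) s) hp0.le
        _ = ENNReal.ofReal C ^ p * ∫⁻ w in B, ‖s (φ[x₀].symm w)‖ₑ ^ p :=
            lintegral_const_mul' _ _ (by finiteness)
        _ ≤ ENNReal.ofReal C ^ p * (ENNReal.ofReal C *
              ∫⁻ y in univ, ‖s y‖ₑ ^ p ∂(riemannianVolume n X)) := by
            gcongr
            exact lintegral_comp_le_of_map_le (f := fun y => ‖s y‖ₑ ^ p) (h.aemeasurable_symm hBa)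
              (h.map_volume_le B hBa Metric.isOpen_ball.measurableSet)
              (st.2.1.aemeasurable_enorm.pow_const p) MeasurableSet.univ (by simp)
        _ ≤ ENNReal.ofReal C ^ p * (ENNReal.ofReal C * ENNReal.ofReal N ^ p) := by
            gcongr
            rw [Measure.restrict_univ, ← st.sobolevENorm_eq]
            exact (lintegral_rpow_le_morreyENorm hp0 _).trans
              (ENNReal.rpow_le_rpow (sectionENorm_le_sobolevENorm hp0 st.1) hp0.le)
        _ = _ := by
            rw [ENNReal.ofReal_rpow_of_nonneg hC0.le hp0.le,
              ENNReal.ofReal_rpow_of_nonneg hN0 hp0.le,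
              ← ENNReal.ofReal_mul (by positivity), ← ENNReal.ofReal_mul (by positivity)]
    rw [Measure.restrict_apply_univ, hvB, ENNReal.ofReal_rpow_of_nonneg hv0 (by linarith)]
    refine (mul_le_mul_right h1 _).trans ?_
    rw [← ENNReal.ofReal_mul (by positivity), ENNReal.ofReal_rpow_of_nonneg (by positivity) hp0.le]
    refine ENNReal.ofReal_le_ofReal ?_
    have h2 : v ^ (p - 1) ≤ (1 + v) ^ p :=
      (Real.rpow_le_rpow hv0 (by linarith) (by linarith)).trans
        (Real.rpow_le_rpow_of_exponent_le (by linarith) (by linarith))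
    calc v ^ (p - 1) * (C ^ p * (C * N ^ p)) ≤ (1 + v) ^ p * (C ^ p * (C ^ p * N ^ p)) := by
          gcongr
          exact hself C h.one_le
      _ = (K₂ * N) ^ p := by
          simp only [K₂]
          rw [Real.mul_rpow (by positivity) hN0, Real.mul_rpow (by positivity) hC0.le,
            Real.mul_rpow (by positivity) hC0.le]
          ring
  have hint : IntegrableOn (sectionCoord n F s x₀) B :=
    ⟨hsm, hL1.trans_lt ENNReal.ofReal_lt_top⟩
  refine ⟨hint, ?_, ?_⟩
  · have h1 : ∫ w in B, ‖sectionCoord n F s x₀ w‖ ≤ K₂ * N := by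
      rw [integral_norm_eq_lintegral_enorm hsm]
      exact ENNReal.toReal_le_of_le_ofReal (by positivity) hL1
    exact h1.trans (by gcongr; linarith)
  · intro y ρ hρ
    -- The center y may lie outside the comparison ball, so the geodesic ball is centered at the
    -- image of a point w₁ of the intersection instead. The price is a radius 2Cρ.
    rcases (Metric.ball y ρ ∩ B).eq_empty_or_nonempty with hempty | ⟨w₁, hw₁⟩
    · simp [hempty]
    set D := Metric.ball y ρ ∩ B with hD
    have hDB : D ⊆ B := inter_subset_right
    have hDa : D ⊆ Metric.ball (φ[x₀] x₀) a := hDB.trans hBa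
    have hDm : MeasurableSet D := (Metric.isOpen_ball.inter Metric.isOpen_ball).measurableSet
    -- Since ρ ≤ 4b, the condition 8Cb ≤ R is what makes this radius admissible in the Morrey norm.
    have hρ' : 2 * C * ρ ∈ Ioc 0 R := by
      refine ⟨by have := hρ.1; positivity, ?_⟩
      have := mul_le_mul_of_nonneg_left hρ.2 hC0.le
      linarith
    have hDA : ∀ w ∈ D, φ[x₀].symm w ∈
        Metric.eball (φ[x₀].symm w₁) (ENNReal.ofReal (2 * C * ρ)) := by
      intro w hw
      rw [Metric.mem_eball]
      refine (h.edist_symm_le w (hDa hw) w₁ (hDa hw₁)).trans_lt ?_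
      rw [edist_dist, ← ENNReal.ofReal_mul hC0.le, ENNReal.ofReal_lt_ofReal_iff hρ'.1]
      have h1 := dist_triangle_right w w₁ y
      have h2 := Metric.mem_ball.1 hw.1
      have h3 := Metric.mem_ball.1 hw₁.1
      calc C * dist w w₁ < C * (2 * ρ) := by gcongr; linarith
        _ = _ := by ring
    have hsum : ∀ w ∈ D,
        ∑ i, ‖derivCoord A s t x₀ (EuclideanSpace.basisFun (Fin n) ℝ i) w‖ₑ ≤
          ENNReal.ofReal (n * C) * f (φ[x₀].symm w) := by
      intro w hw
      refine (Finset.sum_le_card_nsmul _ _ _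
        fun i _ => h.enorm_derivCoord_le w (hDa hw) s t i).trans (le_of_eq ?_)
      rw [Finset.card_univ, Fintype.card_fin, nsmul_eq_mul, ENNReal.ofReal_mul (by positivity),
        ENNReal.ofReal_natCast, mul_assoc]
    calc ∫⁻ w in D, (∑ i, ‖derivCoord A s t x₀ (EuclideanSpace.basisFun (Fin n) ℝ i) w‖ₑ) ^ p
        ≤ ∫⁻ w in D, ENNReal.ofReal (n * C) ^ p * f (φ[x₀].symm w) ^ p := by
          refine setLIntegral_mono' hDm fun w hw => ?_
          rw [← ENNReal.mul_rpow_of_nonneg _ _ hp0.le]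
          exact ENNReal.rpow_le_rpow (hsum w hw) hp0.le
      _ = ENNReal.ofReal (n * C) ^ p * ∫⁻ w in D, f (φ[x₀].symm w) ^ p :=
          lintegral_const_mul' _ _ (by finiteness)
      _ ≤ ENNReal.ofReal (n * C) ^ p * (ENNReal.ofReal C *
            ∫⁻ y in Metric.eball (φ[x₀].symm w₁) (ENNReal.ofReal (2 * C * ρ)), f y ^ p
              ∂(riemannianVolume n X)) := by
          gcongr
          exact lintegral_comp_le_of_map_le (f := fun y => f y ^ p) (h.aemeasurable_symm hDa)
            (h.map_volume_le D hDa hDm) (hfm.pow_const p) Metric.isOpen_eball.measurableSet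
            (by filter_upwards [ae_restrict_mem hDm] with w hw using hDA w hw)
      _ ≤ ENNReal.ofReal (n * C) ^ p * (ENNReal.ofReal C *
            (ENNReal.ofReal (2 * N) ^ p * ENNReal.ofReal ((2 * C * ρ) ^ (n - d)))) := by
          gcongr
          refine (setLIntegral_eball_le_morreyENorm (d := d) hp0 f _ hρ').trans ?_
          gcongr
          exact st.morreyENorm_add_le
      _ = ENNReal.ofReal ((n * C) ^ p * (C * ((2 * N) ^ p * (2 * C * ρ) ^ (n - d)))) := by
          have := hρ.1
          rw [ENNReal.ofReal_rpow_of_nonneg (by positivity) hp0.le,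
            ENNReal.ofReal_rpow_of_nonneg (by positivity) hp0.le,
            ← ENNReal.ofReal_mul (by positivity), ← ENNReal.ofReal_mul (by positivity),
            ← ENNReal.ofReal_mul (by positivity)]
      _ ≤ ENNReal.ofReal (((K₁ + K₂) * N) ^ p * ρ ^ (n - d)) := by
          refine ENNReal.ofReal_le_ofReal ?_
          have hρ0 := hρ.1
          have h1 : (2 * C) ^ (n - d) ≤ ((2 * C) ^ (n : ℝ)) ^ p := by
            refine le_trans ?_ (hself _ (Real.one_le_rpow (by linarith [h.one_le]) (by positivity)))
            exact Real.rpow_le_rpow_of_exponent_le (by linarith [h.one_le]) (by linarith)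
          calc (n * C) ^ p * (C * ((2 * N) ^ p * (2 * C * ρ) ^ (n - d)))
              = (n * C) ^ p * (C * ((2 * N) ^ p * ((2 * C) ^ (n - d) * ρ ^ (n - d)))) := by
                rw [Real.mul_rpow (by positivity) hρ0.le]
            _ ≤ (n * C) ^ p * (C ^ p * ((2 * N) ^ p * (((2 * C) ^ (n : ℝ)) ^ p * ρ ^ (n - d)))) := by
                gcongr
                exact hself C h.one_le
            _ = (K₁ * N) ^ p * ρ ^ (n - d) := by
                have h3 : K₁ * N = (n * C) * C * (2 * N) * (2 * C) ^ (n : ℝ) := by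
                  simp only [K₁]; ring
                rw [h3, Real.mul_rpow (x := (n : ℝ) * C * C * (2 * N)) (by positivity) (by positivity),
                  Real.mul_rpow (x := (n : ℝ) * C * C) (y := 2 * N) (by positivity) (by positivity),
                  Real.mul_rpow (x := (n : ℝ) * C) (y := C) (by positivity) hC0.le]
                ring
            _ ≤ _ := by
                gcongr
                linarith

/-- Euclidean bounds in a comparison ball give bounds on the manifold. -/
lemma IsComparisonBall.setLIntegral_le {x₀ : X} {C a b : ℝ} (h : IsComparisonBall A x₀ C a)
    (hb : 0 < b) (hba : b ≤ a) (hq : 1 ≤ q) (hd : 0 < d) (hdn : d < n) {s : Π x : X, E x}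
    (hs : AEMeasurableSection n F s) {Q : ℝ} (hQ : 0 ≤ Q)
    (hest : ∀ y, ∀ ρ ∈ Ioc 0 b, eLpNorm' (sectionCoord n F s x₀) q
      (volume.restrict (Metric.ball y ρ ∩ Metric.ball (φ[x₀] x₀) b)) ≤
        ENNReal.ofReal (Q * ρ ^ ((n - d) / q))) :
    (∀ x, ∀ ρ > 0, ∫⁻ y in Metric.eball x (ENNReal.ofReal ρ), ‖s y‖ₑ ^ q
      ∂((riemannianVolume n X).restrict (φ[x₀].symm '' Metric.ball (φ[x₀] x₀) b)) ≤
        ENNReal.ofReal ((C * C * (2 * C) ^ (n : ℝ) * (1 + b) ^ (n : ℝ) * Q) ^ q * ρ ^ (n - d))) ∧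
    ∫⁻ y, ‖s y‖ₑ ^ q
      ∂((riemannianVolume n X).restrict (φ[x₀].symm '' Metric.ball (φ[x₀] x₀) b)) ≤
        ENNReal.ofReal ((C * C * (2 * C) ^ (n : ℝ) * (1 + b) ^ (n : ℝ) * Q) ^ q) := by
  have hq0 : 0 < q := zero_lt_one.trans_le hq
  have hC0 : 0 < C := zero_lt_one.trans_le h.one_le
  have hnd : 0 ≤ n - d := by linarith
  have hself : ∀ c : ℝ, 1 ≤ c → c ≤ c ^ q := fun c hc => Real.self_le_rpow_of_one_le hc hq
  set B := Metric.ball (φ[x₀] x₀) b with hBdef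
  have hBa : B ⊆ Metric.ball (φ[x₀] x₀) a := Metric.ball_subset_ball hba
  have hBm : MeasurableSet B := Metric.isOpen_ball.measurableSet
  have hsq : AEMeasurable (fun y => ‖s y‖ₑ ^ q) ((volume.restrict B).map φ[x₀].symm) :=
    (hs.aemeasurable_enorm.pow_const q).mono_ac
      ((Measure.absolutelyContinuous_of_le (h.map_volume_le B hBa hBm)).trans
        Measure.smul_absolutelyContinuous)
  -- the main estimate, in terms of a Euclidean ball
  have key : ∀ S : Set X, MeasurableSet S → ∀ y, ∀ ρ ∈ Ioc 0 b,
      (∀ z ∈ B, φ[x₀].symm z ∈ S → z ∈ Metric.ball y ρ) →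
      ∫⁻ y in S, ‖s y‖ₑ ^ q ∂((riemannianVolume n X).restrict (φ[x₀].symm '' B)) ≤
        ENNReal.ofReal ((C * C * Q) ^ q * ρ ^ (n - d)) := by
    intro S hS y ρ hρ hSy
    have hρ0 := hρ.1
    set D := Metric.ball y ρ with hD
    have hDm : MeasurableSet D := Metric.isOpen_ball.measurableSet
    have h1 : ∫⁻ z in D ∩ B, ‖sectionCoord n F s x₀ z‖ₑ ^ q ≤
        ENNReal.ofReal (Q ^ q * ρ ^ (n - d)) := by
      have h2 := ENNReal.rpow_le_rpow (hest y ρ hρ) hq0.le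
      rw [eLpNorm', ← ENNReal.rpow_mul, one_div_mul_cancel hq0.ne', ENNReal.rpow_one,
        ENNReal.ofReal_rpow_of_nonneg (by positivity) hq0.le,
        Real.mul_rpow hQ (by positivity), ← Real.rpow_mul hρ0.le, div_mul_cancel₀ _ hq0.ne'] at h2
      exact h2
    calc ∫⁻ y in S, ‖s y‖ₑ ^ q ∂((riemannianVolume n X).restrict (φ[x₀].symm '' B))
        ≤ ENNReal.ofReal C * ∫⁻ z in D, ‖s (φ[x₀].symm z)‖ₑ ^ q ∂(volume.restrict B) :=
          setLIntegral_le_of_le_map (h.aemeasurable_symm hBa)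
            (h.restrict_volume_le B hBa hBm) hsq hS hDm
            (by filter_upwards [ae_restrict_mem hBm] with z hz using hSy z hz)
      _ = ENNReal.ofReal C * ∫⁻ z in D ∩ B, ‖s (φ[x₀].symm z)‖ₑ ^ q := by
          rw [Measure.restrict_restrict hDm]
      _ ≤ ENNReal.ofReal C * ∫⁻ z in D ∩ B,
            ENNReal.ofReal C ^ q * ‖sectionCoord n F s x₀ z‖ₑ ^ q := by
          gcongr ENNReal.ofReal C * ?_
          refine setLIntegral_mono' (hDm.inter hBm) fun z hz => ?_
          rw [← ENNReal.mul_rpow_of_nonneg _ _ hq0.le]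
          exact ENNReal.rpow_le_rpow (h.enorm_le z (hBa hz.2) s) hq0.le
      _ = ENNReal.ofReal C * (ENNReal.ofReal C ^ q *
            ∫⁻ z in D ∩ B, ‖sectionCoord n F s x₀ z‖ₑ ^ q) := by
          rw [lintegral_const_mul' _ _ (by finiteness)]
      _ ≤ ENNReal.ofReal C * (ENNReal.ofReal C ^ q * ENNReal.ofReal (Q ^ q * ρ ^ (n - d))) := by
          gcongr
      _ = ENNReal.ofReal (C * (C ^ q * (Q ^ q * ρ ^ (n - d)))) := by
          rw [ENNReal.ofReal_rpow_of_nonneg hC0.le hq0.le, ← ENNReal.ofReal_mul (by positivity),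
            ← ENNReal.ofReal_mul (by positivity)]
      _ ≤ ENNReal.ofReal (C ^ q * (C ^ q * (Q ^ q * ρ ^ (n - d)))) := by
          refine ENNReal.ofReal_le_ofReal ?_
          gcongr
          exact hself C h.one_le
      _ = _ := by
          rw [Real.mul_rpow (by positivity) hQ, Real.mul_rpow hC0.le hC0.le]
          congr 1
          ring
  have h2C : (2 * C) ^ (n - d) ≤ ((2 * C) ^ (n : ℝ)) ^ q := by
    refine le_trans ?_ (hself _ (Real.one_le_rpow (by linarith [h.one_le]) (by positivity)))
    exact Real.rpow_le_rpow_of_exponent_le (by linarith [h.one_le]) (by linarith)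
  have hbq : b ^ (n - d) ≤ ((1 + b) ^ (n : ℝ)) ^ q := by
    refine le_trans ?_ (hself _ (Real.one_le_rpow (by linarith) (by positivity)))
    exact (Real.rpow_le_rpow hb.le (by linarith) hnd).trans
      (Real.rpow_le_rpow_of_exponent_le (by linarith) (by linarith))
  have h1b : 1 ≤ ((1 + b) ^ (n : ℝ)) ^ q :=
    Real.one_le_rpow (Real.one_le_rpow (by linarith) (by positivity)) hq0.le
  have h12C : 1 ≤ ((2 * C) ^ (n : ℝ)) ^ q :=
    Real.one_le_rpow (Real.one_le_rpow (by linarith [h.one_le]) (by positivity)) hq0.le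
  have hK : (C * C * (2 * C) ^ (n : ℝ) * (1 + b) ^ (n : ℝ) * Q) ^ q =
      (C * C * Q) ^ q * ((2 * C) ^ (n : ℝ)) ^ q * ((1 + b) ^ (n : ℝ)) ^ q := by
    rw [← Real.mul_rpow (by positivity) (by positivity),
      ← Real.mul_rpow (by positivity) (by positivity)]
    congr 1
    ring
  rw [hK]
  -- The Euclidean estimate on the whole ball of radius b, used for the total integral and for large
  -- geodesic balls.
  have hall : ∀ S : Set X, MeasurableSet S →
      ∫⁻ y in S, ‖s y‖ₑ ^ q ∂((riemannianVolume n X).restrict (φ[x₀].symm '' B)) ≤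
        ENNReal.ofReal ((C * C * Q) ^ q * b ^ (n - d)) := fun S hS =>
    key S hS (φ[x₀] x₀) b ⟨hb, le_rfl⟩ fun z hz _ => hz
  constructor
  · intro x ρ hρ
    -- A small geodesic ball pulls back into a Euclidean ball of radius 2Cρ around any of its points
    -- in B. For a large one, b < 2Cρ, so b^{n-d} is already bounded by a multiple of ρ^{n-d}.
    rcases le_or_gt (2 * C * ρ) b with hle | hlt
    · rcases (B ∩ φ[x₀].symm ⁻¹' Metric.eball x (ENNReal.ofReal ρ)).eq_empty_or_nonempty with
        hempty | ⟨z₁, hz₁⟩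
      -- The geodesic ball misses the comparison region, so the choice of center is immaterial.
      · refine (key _ Metric.isOpen_eball.measurableSet (φ[x₀] x₀) (2 * C * ρ)
          ⟨by positivity, hle⟩ fun z hz hzS => ?_).trans ?_
        · exact absurd (mem_inter hz (mem_preimage.2 hzS)) (hempty ▸ notMem_empty z)
        · refine ENNReal.ofReal_le_ofReal ?_
          rw [Real.mul_rpow (by positivity) hρ.le, ← mul_assoc]
          gcongr ?_ * _
          calc (C * C * Q) ^ q * (2 * C) ^ (n - d) ≤
                (C * C * Q) ^ q * ((2 * C) ^ (n : ℝ)) ^ q * 1 := by rw [mul_one]; gcongr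
            _ ≤ _ := by gcongr
      · refine (key _ Metric.isOpen_eball.measurableSet z₁ (2 * C * ρ)
          ⟨by positivity, hle⟩ fun z hz hzS => ?_).trans ?_
        · rw [Metric.mem_ball, ← ENNReal.ofReal_lt_ofReal_iff (by positivity), ← edist_dist]
          refine (h.edist_le z (hBa hz) z₁ (hBa hz₁.1)).trans_lt ?_
          have h3 : edist (φ[x₀].symm z) (φ[x₀].symm z₁) < ENNReal.ofReal (2 * ρ) := by
            refine (edist_triangle_right _ _ x).trans_lt ?_
            rw [two_mul, ENNReal.ofReal_add hρ.le hρ.le]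
            exact ENNReal.add_lt_add hzS hz₁.2
          rw [show 2 * C * ρ = C * (2 * ρ) by ring, ENNReal.ofReal_mul hC0.le]
          exact ENNReal.mul_lt_mul_right (by simpa using hC0) ENNReal.ofReal_ne_top h3
        · refine ENNReal.ofReal_le_ofReal ?_
          rw [Real.mul_rpow (by positivity) hρ.le, ← mul_assoc]
          gcongr ?_ * _
          calc (C * C * Q) ^ q * (2 * C) ^ (n - d) ≤
                (C * C * Q) ^ q * ((2 * C) ^ (n : ℝ)) ^ q * 1 := by rw [mul_one]; gcongr
            _ ≤ _ := by gcongr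
    · refine (hall _ Metric.isOpen_eball.measurableSet).trans (ENNReal.ofReal_le_ofReal ?_)
      calc (C * C * Q) ^ q * b ^ (n - d) ≤ (C * C * Q) ^ q * (2 * C * ρ) ^ (n - d) := by gcongr
        _ = (C * C * Q) ^ q * (2 * C) ^ (n - d) * 1 * ρ ^ (n - d) := by
          rw [Real.mul_rpow (by positivity) hρ.le]; ring
        _ ≤ _ := by gcongr
  · rw [← setLIntegral_univ]
    refine (hall _ MeasurableSet.univ).trans (ENNReal.ofReal_le_ofReal ?_)
    calc (C * C * Q) ^ q * b ^ (n - d) = (C * C * Q) ^ q * 1 * b ^ (n - d) := by ring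
      _ ≤ _ := by gcongr

end SectionEstimate

/-! ### The Ehrling inequality on X -/

section Ehrling

variable {n : ℕ} {X : Type*} [EMetricSpace X] [CompactSpace X]
  [ChartedSpace (EuclideanSpace ℝ (Fin n)) X]
  [IsManifold (𝓡 n) ∞ X] [RiemannianBundle (fun x : X => TangentSpace (𝓡 n) x)]
  [IsContMDiffRiemannianBundle (𝓡 n) ∞ (EuclideanSpace ℝ (Fin n))
    (fun x : X => TangentSpace (𝓡 n) x)]
  [MeasurableSpace X] [BorelSpace X]
  {F : Type*} [NormedAddCommGroup F] [NormedSpace ℝ F] [FiniteDimensional ℝ F]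
  {E : X → Type*} [TopologicalSpace (TotalSpace F E)] [∀ x, NormedAddCommGroup (E x)]
  [∀ x, InnerProductSpace ℝ (E x)] [FiberBundle F E] [VectorBundle ℝ F E]
  [ContMDiffVectorBundle ∞ F E (𝓡 n)] [IsContMDiffRiemannianBundle (𝓡 n) ∞ F E]
  {A : CovariantDerivative (𝓡 n) F E} {R d p q : ℝ}

local notation "φ[" x "]" => chartAt (EuclideanSpace ℝ (Fin n)) x

variable [IsRiemannianManifold (𝓡 n) X]

variable (A) in
/-- Near each point, a Morrey norm of a section is bounded by a small multiple of the Sobolev norm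
and finitely many functionals. -/
lemma exists_nhds_estimate [CovariantDerivative.ContMDiffCovariantDerivative A ∞] (hR : 0 < R)
    (hp : 1 ≤ p) (hd : 0 < d) (hdn : d < n) (hq : 1 ≤ q) (hθ : 0 < 1 - d / p + d / q) (x₀ : X) :
    ∃ W : Set X, IsOpen W ∧ x₀ ∈ W ∧ ∀ ε > 0, ∃ (m : ℕ)
      (T : SobolevSections A R d p hp →L[ℝ] (Fin m → F)), ∀ st : SobolevSections A R d p hp,
      (∀ x, ∀ ρ > 0, ∫⁻ y in Metric.eball x (ENNReal.ofReal ρ), ‖st.1.1 y‖ₑ ^ q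
        ∂((riemannianVolume n X).restrict W) ≤
          ENNReal.ofReal ((ε * ‖st‖ + ∑ j, ‖T st j‖) ^ q * ρ ^ (n - d))) ∧
      ∫⁻ y, ‖st.1.1 y‖ₑ ^ q ∂((riemannianVolume n X).restrict W) ≤
        ENNReal.ofReal ((ε * ‖st‖ + ∑ j, ‖T st j‖) ^ q) := by
  have : CompleteSpace F := FiniteDimensional.complete ℝ F
  obtain ⟨C, a, h⟩ := exists_isComparisonBall A x₀
  have hC0 : 0 < C := zero_lt_one.trans_le h.one_le
  have ha0 := h.pos
  -- The two terms ensure 4b ≤ a and 8Cb ≤ R.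
  set b := min (a / 4) (R / (8 * C)) with hbdef
  have hb : 0 < b := by positivity
  have hba : 4 * b ≤ a := by have := min_le_left (a / 4) (R / (8 * C)); linarith
  have hbR : 8 * C * b ≤ R := by
    have := min_le_right (a / 4) (R / (8 * C))
    rwa [le_div_iff₀' (by positivity)] at this
  set z₀ := φ[x₀] x₀ with hz₀
  obtain ⟨K, hK, hbound⟩ := h.exists_bound (d := d) hba hbR hp hd
  set L : ℝ := C * C * (2 * C) ^ (n : ℝ) * (1 + b) ^ (n : ℝ) with hL
  have hL0 : 0 ≤ L := by positivity
  -- The neighborhood is chosen before ε, so the number of neighborhoods in a finite cover does not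
  -- depend on ε.
  refine ⟨φ[x₀].symm '' Metric.ball z₀ b, ?_, ⟨z₀, Metric.mem_ball_self hb,
    φ[x₀].left_inv (mem_chart_source _ _)⟩, fun ε hε => ?_⟩
  · exact φ[x₀].isOpen_image_symm_of_subset_target Metric.isOpen_ball fun z hz =>
      (h.subset (Metric.ball_subset_ball (by linarith) hz)).1
  -- The estimate is applied with M = K‖st‖ and its result is multiplied by L, so ε is divided by
  -- LK; the summand 1 avoids division by zero.
  obtain ⟨m, ψ, hψ, ⟨B, hB⟩, C₁, hC₁, hest⟩ := exists_local_estimate (F := F) hp hd hdn hq hθ z₀ hb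
    (show 0 < ε / (L * K + 1) by positivity)
  set u : SobolevSections A R d p hp → EuclideanSpace ℝ (Fin n) → F :=
    fun st => sectionCoord n F st.1.1 x₀ with hu
  have hint : ∀ st j, IntegrableOn (fun w => ψ j w • u st w) (Metric.ball z₀ (4 * b)) :=
    fun st j => integrable_continuous_bounded_smul (hbound st).1 (hψ j) (hB j)
  -- The factor L C₁ is built into the functionals so that they enter the final bound with
  -- coefficient 1.
  let T₀ : SobolevSections A R d p hp →ₗ[ℝ] (Fin m → F) :=
    { toFun := fun st j => (L * C₁) • ∫ w in Metric.ball z₀ (4 * b), ψ j w • u st w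
      map_add' := fun st st' => by
        ext j
        have h1 : u (st + st') = u st + u st' := congrFun (sectionCoord_add (n := n) (F := F)) x₀
        simp only [h1, Pi.add_apply, smul_add]
        rw [integral_add (hint st j) (hint st' j), smul_add]
      map_smul' := fun c st => by
        ext j
        have h1 : u (c • st) = c • u st := congrFun (sectionCoord_smul (n := n) (F := F) c) x₀
        simp only [h1, Pi.smul_apply, RingHom.id_apply, smul_comm _ c]
        rw [integral_smul, smul_comm] }
  let T : SobolevSections A R d p hp →L[ℝ] (Fin m → F) :=
    T₀.mkContinuous (L * C₁ * (|B| * K)) fun st => by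
      refine (pi_norm_le_iff_of_nonneg (by positivity)).2 fun j => ?_
      change ‖(L * C₁) • ∫ w in Metric.ball z₀ (4 * b), ψ j w • u st w‖ ≤ _
      rw [norm_smul, Real.norm_of_nonneg (by positivity), mul_assoc (L * C₁)]
      gcongr
      calc ‖∫ w in Metric.ball z₀ (4 * b), ψ j w • u st w‖
          ≤ ∫ w in Metric.ball z₀ (4 * b), |B| * ‖u st w‖ := by
            refine norm_integral_le_of_norm_le ((hbound st).1.norm.const_mul _)
              (ae_of_all _ fun w => ?_)
            rw [norm_smul]
            gcongr
            exact (hB j w).trans (le_abs_self B)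
        _ = |B| * ∫ w in Metric.ball z₀ (4 * b), ‖u st w‖ := integral_const_mul _ _
        _ ≤ |B| * (K * ‖st‖) := by gcongr; exact (hbound st).2.1
        _ = _ := by ring
  refine ⟨m, T, fun st => ?_⟩
  set Q : ℝ := ε / (L * K + 1) * (K * ‖st‖) +
    C₁ * ∑ j, ‖∫ w in Metric.ball z₀ (4 * b), ψ j w • u st w‖ with hQ
  have hQ0 : 0 ≤ Q := by positivity
  have hLQ : L * Q ≤ ε * ‖st‖ + ∑ j, ‖T st j‖ := by
    have h1 : ∑ j, ‖T st j‖ =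
        L * C₁ * ∑ j, ‖∫ w in Metric.ball z₀ (4 * b), ψ j w • u st w‖ := by
      rw [Finset.mul_sum]
      refine Finset.sum_congr rfl fun j _ => ?_
      change ‖(L * C₁) • ∫ w in Metric.ball z₀ (4 * b), ψ j w • u st w‖ = _
      rw [norm_smul, Real.norm_of_nonneg (by positivity)]
    have h2 : L * (ε / (L * K + 1) * (K * ‖st‖)) ≤ ε * ‖st‖ := by
      have h3 : ε / (L * K + 1) * (L * K) ≤ ε := by
        rw [div_mul_eq_mul_div, div_le_iff₀ (by positivity)]
        nlinarith
      calc L * (ε / (L * K + 1) * (K * ‖st‖)) = ε / (L * K + 1) * (L * K) * ‖st‖ := by ring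
        _ ≤ _ := by gcongr
    rw [h1, hQ, mul_add]
    linarith
  have hmain := h.setLIntegral_le hb (by linarith) hq hd hdn st.2.1 hQ0 fun y ρ hρ =>
    hest (K * ‖st‖) (u st) _ (by positivity) (hbound st).1 (hbound st).2.1
      (st.2.2.2.1.hasWeakPartials x₀ ((Metric.ball_subset_ball hba).trans h.subset))
      (hbound st).2.2 y ρ hρ
  have hq0 : 0 ≤ q := zero_le_one.trans hq
  have hLQ0 : 0 ≤ L * Q := by positivity
  refine ⟨fun x ρ hρ => (hmain.1 x ρ hρ).trans ?_, hmain.2.trans ?_⟩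
  · have hρ' : 0 ≤ ρ ^ (n - d) := Real.rpow_nonneg (le_of_lt hρ) _
    exact ENNReal.ofReal_le_ofReal
      (mul_le_mul_of_nonneg_right (Real.rpow_le_rpow hLQ0 hLQ hq0) hρ')
  · exact ENNReal.ofReal_le_ofReal (Real.rpow_le_rpow hLQ0 hLQ hq0)

variable (A) in
/-- The Morrey norm is bounded by a small multiple of the Sobolev norm and finitely many
functionals. -/
lemma exists_sectionENorm_le [CovariantDerivative.ContMDiffCovariantDerivative A ∞] (hR : 0 < R)
    (hp : 1 ≤ p) (hd : 0 < d) (hdn : d < n) (hq : 1 ≤ q) (hθ : 0 < 1 - d / p + d / q)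
    {ε : ℝ} (hε : 0 < ε) : ∃ (ι : Type) (_ : Fintype ι)
      (T : SobolevSections A R d p hp →L[ℝ] (ι → F)), ∀ st : SobolevSections A R d p hp,
        sectionENorm n R d q st.1.1 ≤ ENNReal.ofReal (ε * ‖st‖ + ∑ j, ‖T st j‖) := by
  have hq0 : 0 < q := zero_lt_one.trans_le hq
  choose W hWo hxW hW using exists_nhds_estimate (R := R) A hR hp hd hdn hq hθ
  obtain ⟨t, ht⟩ := isCompact_univ.elim_finite_subcover W hWo
    (fun x _ => mem_iUnion.2 ⟨x, hxW x⟩)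
  set k := t.card with hk
  set x : Fin k → X := fun i => t.equivFin.symm i with hx
  have hcov : (⋃ i, W (x i)) = univ := by
    refine univ_subset_iff.1 fun y hy => ?_
    obtain ⟨i, hi, hyi⟩ := mem_iUnion₂.1 (ht hy)
    exact mem_iUnion.2 ⟨t.equivFin ⟨i, hi⟩, by simpa [hx] using hyi⟩
  -- There are k local estimates to add, and the sum is multiplied by 2k + 1 at the end; the total
  -- is ε k/(k + 1) ≤ ε, and k = 0 causes no division by zero.
  choose m T hT using fun i => hW (x i) (ε / ((2 * k + 1) * (k + 1))) (by positivity)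
  refine ⟨Σ i : Fin k, Fin (m i), inferInstance, ContinuousLinearMap.pi fun j =>
    (2 * k + 1 : ℝ) • (ContinuousLinearMap.proj j.2).comp (T j.1), fun st => ?_⟩
  set Q : Fin k → ℝ := fun i =>
    ε / ((2 * k + 1) * (k + 1)) * ‖st‖ + ∑ j, ‖T i st j‖ with hQ
  have hQ0 : ∀ i, 0 ≤ Q i := fun i => by positivity
  set S := ∑ i, Q i with hS
  have hS0 : 0 ≤ S := Finset.sum_nonneg fun i _ => hQ0 i
  have hQS : ∀ i, Q i ≤ S := fun i =>
    Finset.single_le_sum (f := Q) (fun i _ => hQ0 i) (Finset.mem_univ i)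
  have hsplit : ∀ D : Set X, MeasurableSet D → ∫⁻ y in D, ‖st.1.1 y‖ₑ ^ q ∂(riemannianVolume n X) ≤
      ∑ i, ∫⁻ y in D, ‖st.1.1 y‖ₑ ^ q ∂((riemannianVolume n X).restrict (W (x i))) := by
    intro D hD
    have h1 := lintegral_iUnion_le (μ := (riemannianVolume n X).restrict D) (fun i => W (x i))
      (fun y => ‖st.1.1 y‖ₑ ^ q)
    rw [hcov, Measure.restrict_univ, tsum_fintype] at h1
    refine h1.trans (le_of_eq (Finset.sum_congr rfl fun i _ => ?_))
    rw [Measure.restrict_restrict (hWo _).measurableSet, Measure.restrict_restrict hD, inter_comm]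
  have hfin : S * (2 * k + 1) ≤ ε * ‖st‖ + ∑ j : Σ i : Fin k, Fin (m i),
      ‖(ContinuousLinearMap.pi (fun j : Σ i : Fin k, Fin (m i) =>
        (2 * k + 1 : ℝ) • (ContinuousLinearMap.proj (R := ℝ) j.2).comp (T j.1))) st j‖ := by
    have h1 : ∀ j : Σ i : Fin k, Fin (m i), ‖(ContinuousLinearMap.pi
        (fun j : Σ i : Fin k, Fin (m i) =>
        (2 * k + 1 : ℝ) • (ContinuousLinearMap.proj (R := ℝ) j.2).comp (T j.1))) st j‖ =
        (2 * k + 1) * ‖T j.1 st j.2‖ := by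
      intro j
      change ‖(2 * k + 1 : ℝ) • T j.1 st j.2‖ = _
      rw [norm_smul, Real.norm_of_nonneg (by positivity)]
    rw [Finset.sum_congr rfl fun j _ => h1 j, ← Finset.mul_sum, Fintype.sum_sigma, hS]
    simp only [hQ, Finset.sum_add_distrib, Finset.sum_const, Finset.card_univ, Fintype.card_fin,
      nsmul_eq_mul]
    have h2 : (k : ℝ) * (ε / ((2 * k + 1) * (k + 1)) * ‖st‖) * (2 * k + 1) ≤ ε * ‖st‖ := by
      have h3 : (k : ℝ) * (ε / ((2 * k + 1) * (k + 1))) * (2 * k + 1) ≤ ε := by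
        have : (k : ℝ) * (ε / ((2 * k + 1) * (k + 1))) * (2 * k + 1) = ε * (k / (k + 1)) := by
          field_simp
        rw [this]
        refine mul_le_of_le_one_right hε.le ((div_le_one (by positivity)).2 (by linarith))
      calc _ = (k : ℝ) * (ε / ((2 * k + 1) * (k + 1))) * (2 * k + 1) * ‖st‖ := by ring
        _ ≤ _ := by gcongr
    rw [add_mul]
    linarith
  refine le_trans ?_ (ENNReal.ofReal_le_ofReal hfin)
  rw [sectionENorm, ← ENNReal.rpow_le_rpow_iff hq0, morreyENorm_rpow hq0]
  have hsum : ∀ c : ℝ, 0 ≤ c → ∑ i, ENNReal.ofReal (Q i ^ q * c) ≤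
      ENNReal.ofReal (k * S ^ q * c) := by
    intro c hc
    have h1 := fun i => hQ0 i
    rw [← ENNReal.ofReal_sum_of_nonneg fun i _ => mul_nonneg (Real.rpow_nonneg (hQ0 i) _) hc]
    refine ENNReal.ofReal_le_ofReal ?_
    rw [← Finset.sum_mul]
    gcongr
    refine (Finset.sum_le_card_nsmul _ _ (S ^ q) fun i _ => ?_).trans (le_of_eq (by simp))
    exact Real.rpow_le_rpow (hQ0 i) (hQS i) hq0.le
  have htot : ∫⁻ y, ‖st.1.1 y‖ₑ ^ q ∂(riemannianVolume n X) ≤ ENNReal.ofReal (k * S ^ q) := by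
    have h1 := hsplit univ MeasurableSet.univ
    simp only [Measure.restrict_univ] at h1
    refine h1.trans ((Finset.sum_le_sum fun i _ => (hT i st).2).trans ?_)
    simpa using hsum 1 zero_le_one
  have hball : ∀ ρ ∈ Ioc 0 R, ∀ y : X, ENNReal.ofReal (ρ ^ (d - n)) *
      ∫⁻ y in Metric.eball y (ENNReal.ofReal ρ), ‖st.1.1 y‖ₑ ^ q ∂(riemannianVolume n X) ≤
        ENNReal.ofReal (k * S ^ q) := by
    intro ρ hρ y
    have hρ0 := hρ.1
    have h1 := (hsplit _ Metric.isOpen_eball.measurableSet).trans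
      ((Finset.sum_le_sum fun i _ => (hT i st).1 y ρ hρ.1).trans
        (hsum (ρ ^ (n - d)) (by positivity)))
    refine (mul_le_mul_right h1 _).trans ?_
    rw [← ENNReal.ofReal_mul (by positivity)]
    refine ENNReal.ofReal_le_ofReal (le_of_eq ?_)
    have h2 : ρ ^ (d - n) * ρ ^ (n - d) = 1 := by
      rw [← Real.rpow_add hρ0]; simp
    linear_combination (k * S ^ q) * h2
  refine (add_le_add htot (iSup₂_le fun ρ hρ => iSup_le fun y => hball ρ hρ y)).trans ?_
  rw [← ENNReal.ofReal_add (by positivity) (by positivity),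
    ENNReal.ofReal_rpow_of_nonneg (by positivity) hq0.le]
  refine ENNReal.ofReal_le_ofReal ?_
  rw [Real.mul_rpow hS0 (by positivity)]
  -- The global integral and the supremum over balls contribute k S^q each, and 2k ≤ (2k + 1)^q
  -- absorbs both.
  have h3 : (2 * k + 1 : ℝ) ≤ (2 * k + 1 : ℝ) ^ q :=
    Real.self_le_rpow_of_one_le (by linarith [(Nat.cast_nonneg k : (0 : ℝ) ≤ k)]) hq
  have h4 : 0 ≤ S ^ q := by positivity
  nlinarith

end Ehrling

/-! ### Completeness of the Morrey space -/

section Completeness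

variable {n : ℕ} {X : Type*} [EMetricSpace X] [CompactSpace X]
  [ChartedSpace (EuclideanSpace ℝ (Fin n)) X]
  [IsManifold (𝓡 n) ∞ X] [RiemannianBundle (fun x : X => TangentSpace (𝓡 n) x)]
  [IsContMDiffRiemannianBundle (𝓡 n) ∞ (EuclideanSpace ℝ (Fin n))
    (fun x : X => TangentSpace (𝓡 n) x)]
  [MeasurableSpace X] [BorelSpace X]
  {F : Type*} [NormedAddCommGroup F] [NormedSpace ℝ F] [FiniteDimensional ℝ F]
  {E : X → Type*} [TopologicalSpace (TotalSpace F E)] [∀ x, NormedAddCommGroup (E x)]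
  [∀ x, InnerProductSpace ℝ (E x)] [FiberBundle F E] [VectorBundle ℝ F E]
  [ContMDiffVectorBundle ∞ F E (𝓡 n)] [IsContMDiffRiemannianBundle (𝓡 n) ∞ F E]
  {A : CovariantDerivative (𝓡 n) F E} {R d p q : ℝ}

local notation "φ[" x "]" => chartAt (EuclideanSpace ℝ (Fin n)) x

/-- This replaces the supremum inside the norm by bounds on ordinary L^p integrals, one for each
measure μ + ρ^{d-n} μ|_B. Monotone convergence can then be used measure by measure. The condition on
μ alone covers an empty family of balls. -/
lemma morreyENorm_le_iff (hp : 0 < p) {f : X → ℝ≥0∞} {M : ℝ≥0∞} :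
    morreyENorm n R d p f ≤ M ↔ ∫⁻ y, f y ^ p ∂(riemannianVolume n X) ≤ M ^ p ∧
      ∀ ρ ∈ Ioc 0 R, ∀ x : X, ∫⁻ y, f y ^ p ∂(riemannianVolume n X + ENNReal.ofReal (ρ ^ (d - n)) •
        (riemannianVolume n X).restrict (Metric.eball x (ENNReal.ofReal ρ))) ≤ M ^ p := by
  simp only [lintegral_add_measure, lintegral_smul_measure, smul_eq_mul]
  rw [← ENNReal.rpow_le_rpow_iff hp, morreyENorm_rpow hp]
  constructor
  · intro h
    refine ⟨le_self_add.trans h, fun ρ hρ x => le_trans ?_ h⟩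
    gcongr
    exact le_trans (le_iSup (fun x : X => ENNReal.ofReal (ρ ^ (d - n)) *
      ∫⁻ y in Metric.eball x (ENNReal.ofReal ρ), f y ^ p ∂(riemannianVolume n X)) x)
      (le_iSup₂ (f := fun ρ (_ : ρ ∈ Ioc 0 R) => ⨆ x : X, ENNReal.ofReal (ρ ^ (d - n)) *
      ∫⁻ y in Metric.eball x (ENNReal.ofReal ρ), f y ^ p ∂(riemannianVolume n X)) ρ hρ)
  · rintro ⟨h, h'⟩
    -- The supremum is compared with the difference of M^p and the global integral, so that integral
    -- has to be finite.
    rcases eq_or_ne (∫⁻ y, f y ^ p ∂(riemannianVolume n X)) ⊤ with htop | hfin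
    · rw [htop, top_le_iff] at h
      rw [h]
      exact le_top
    rw [← add_tsub_cancel_of_le h]
    gcongr
    exact iSup₂_le fun ρ hρ => iSup_le fun x => ENNReal.le_sub_of_add_le_left hfin (h' ρ hρ x)

lemma morreyENorm_mono_ae (hp : 0 ≤ p) {f g : X → ℝ≥0∞}
    (h : ∀ᵐ x ∂(riemannianVolume n X), f x ≤ g x) :
    morreyENorm n R d p f ≤ morreyENorm n R d p g := by
  have h' : ∀ᵐ x ∂(riemannianVolume n X), f x ^ p ≤ g x ^ p :=
    h.mono fun x hx => ENNReal.rpow_le_rpow hx hp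
  unfold morreyENorm
  refine ENNReal.rpow_le_rpow (add_le_add (lintegral_mono_ae h') ?_) (by positivity)
  exact iSup₂_mono fun ρ _ => iSup_mono fun x =>
    mul_le_mul_right (lintegral_mono_ae (ae_restrict_of_ae h')) _

/-- Minkowski's inequality for the partial sums, followed by monotone convergence for each of the
measures in `morreyENorm_le_iff`. These are absolutely continuous with respect to the volume, so
measurability carries over. -/
lemma morreyENorm_tsum_le (hp : 1 ≤ p) {f : ℕ → X → ℝ≥0∞}
    (hf : ∀ k, AEMeasurable (f k) (riemannianVolume n X)) :
    morreyENorm n R d p (fun y => ∑' k, f k y) ≤ ∑' k, morreyENorm n R d p (f k) := by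
  have hp0 : 0 < p := zero_lt_one.trans_le hp
  set M := ∑' k, morreyENorm n R d p (f k) with hM
  have hpart : ∀ N, morreyENorm n R d p (fun y => ∑ k ∈ Finset.range N, f k y) ≤
      ∑ k ∈ Finset.range N, morreyENorm n R d p (f k) := by
    intro N
    induction N with
    | zero => simp [morreyENorm_zero hp0]
    | succ N ih =>
      simp only [Finset.sum_range_succ]
      exact (morreyENorm_add_le hp (Finset.aemeasurable_fun_sum _ fun k _ => hf k) (hf N)).trans
        (add_le_add ih le_rfl)
  have hpart' := fun N => (morreyENorm_le_iff hp0).1 ((hpart N).trans (ENNReal.sum_le_tsum _))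
  have key : ∀ μ : Measure X, μ ≪ riemannianVolume n X →
      (∀ N, ∫⁻ y, (∑ k ∈ Finset.range N, f k y) ^ p ∂μ ≤ M ^ p) →
      ∫⁻ y, (∑' k, f k y) ^ p ∂μ ≤ M ^ p := by
    intro μ hμ h
    have h1 : ∀ y, (∑' k, f k y) ^ p = ⨆ N, (∑ k ∈ Finset.range N, f k y) ^ p := fun y => by
      rw [ENNReal.tsum_eq_iSup_nat]
      exact (ENNReal.orderIsoRpow p hp0).map_iSup _
    simp_rw [h1]
    rw [lintegral_iSup']
    · exact iSup_le h
    · exact fun N => (Finset.aemeasurable_fun_sum _ fun k _ => (hf k).mono_ac hμ).pow_const p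
    · refine ae_of_all _ fun y N N' hN => ENNReal.rpow_le_rpow ?_ hp0.le
      exact Finset.sum_le_sum_of_subset (Finset.range_mono hN)
  refine (morreyENorm_le_iff hp0).2 ⟨key _ .rfl fun N => (hpart' N).1, fun ρ hρ x =>
    key _ ?_ fun N => (hpart' N).2 ρ hρ x⟩
  exact Measure.AbsolutelyContinuous.add_left .rfl
    (Measure.smul_absolutelyContinuous.trans Measure.restrict_le_self.absolutelyContinuous)

/-- Absolutely convergent series of sections converge in the Morrey norm. -/
lemma exists_sectionENorm_sub_sum_le (hq : 1 ≤ q) {w : ℕ → Π x : X, E x}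
    (hw : ∀ k, AEMeasurableSection n F (w k)) (hsum : ∑' k, sectionENorm n R d q (w k) ≠ ⊤) :
    ∃ v : Π x : X, E x, AEMeasurableSection n F v ∧ ∀ N,
      sectionENorm n R d q (v - ∑ k ∈ Finset.range N, w k) ≤
        ∑' k, sectionENorm n R d q (w (k + N)) := by
  have hq0 : 0 < q := zero_lt_one.trans_le hq
  -- The fibers are finite dimensional; their completeness turns absolute summability at a point
  -- into summability.
  have hcomplete : ∀ x, CompleteSpace (E x) := fun x => by
    have : FiniteDimensional ℝ (E x) :=
      ((trivializationAt F E x).continuousLinearEquivAt ℝ x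
        (FiberBundle.mem_baseSet_trivializationAt' x)).symm.toLinearEquiv.finiteDimensional
    exact FiniteDimensional.complete ℝ (E x)
  have hwm := fun k => (hw k).aemeasurable_enorm
  -- The series of norms has finite L^q norm, hence is finite almost everywhere.
  have hfin : ∀ᵐ x ∂(riemannianVolume n X), ∑' k, ‖w k x‖ₑ < ⊤ := by
    have h1 := (lintegral_rpow_le_morreyENorm (R := R) (d := d) hq0
      (fun x => ∑' k, ‖w k x‖ₑ)).trans
      (ENNReal.rpow_le_rpow (morreyENorm_tsum_le hq hwm) hq0.le)
    have h2 := ae_lt_top' ((AEMeasurable.tsum hwm).pow_const q)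
      (h1.trans_lt (ENNReal.rpow_lt_top_of_nonneg hq0.le hsum)).ne
    exact h2.mono fun x hx => (ENNReal.rpow_lt_top_iff_of_pos hq0).1 hx
  have hsummable : ∀ᵐ x ∂(riemannianVolume n X), Summable fun k => w k x := by
    filter_upwards [hfin] with x hx
    refine Summable.of_norm ?_
    have := (ENNReal.tsum_coe_ne_top_iff_summable (f := fun k => ‖w k x‖₊)).1 hx.ne
    exact NNReal.summable_coe.2 this
  refine ⟨fun x => ∑' k, w k x, fun x₀ => ?_, fun N => ?_⟩
  · refine aestronglyMeasurable_of_tendsto_ae Filter.atTop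
      (f := fun N x => fiberCoord F x₀ (∑ k ∈ Finset.range N, w k x)) (fun N => ?_) ?_
    · have h1 : (fun x => fiberCoord F x₀ (∑ k ∈ Finset.range N, w k x)) =
          fun x => ∑ k ∈ Finset.range N, fiberCoord F x₀ (w k x) := by
        ext x
        exact map_sum _ _ _
      rw [h1]
      exact Finset.aestronglyMeasurable_fun_sum _ fun k _ => hw k x₀
    · filter_upwards [ae_restrict_of_ae hsummable] with x hx
      exact (((trivializationAt F E x₀).continuousLinearMapAt ℝ x).continuous.tendsto _).comp
        hx.hasSum.tendsto_sum_nat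
  · refine le_trans (morreyENorm_mono_ae hq0.le ?_) (morreyENorm_tsum_le hq fun k => hwm (k + N))
    filter_upwards [hsummable] with x hx
    have h1 : (fun x => ∑' k, w k x) x - (∑ k ∈ Finset.range N, w k) x = ∑' k, w (k + N) x := by
      change (∑' k, w k x) - _ = _
      rw [Finset.sum_apply, ← hx.sum_add_tsum_nat_add N, add_sub_cancel_left]
    rw [Pi.sub_apply, h1]
    exact enorm_tsum_le_tsum_enorm

/-- The Riesz–Fischer argument: for a sequence with consecutive distances below 2^{-k}, the series
of increments converges absolutely, and its tails bound the distance to the limit by 2 · 2^{-N}. -/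
instance LpSections.instCompleteSpace {hq : 1 ≤ q} : CompleteSpace (LpSections n F E R d q hq) := by
  refine Metric.complete_of_convergent_controlled_sequences (fun N => (1 / 2) ^ N) (by simp)
    fun u hu => ?_
  have henorm : ∀ s : LpSections n F E R d q hq,
      sectionENorm n R d q s.1 = ENNReal.ofReal ‖s‖ := fun s =>
    (ENNReal.ofReal_toReal s.2.2.ne).symm
  set w : ℕ → LpSections n F E R d q hq := fun k => u (k + 1) - u k with hw
  have hwn : ∀ k, sectionENorm n R d q (w k).1 ≤ ENNReal.ofReal ((1 / 2) ^ k) := fun k => by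
    rw [henorm, hw, ← dist_eq_norm]
    exact ENNReal.ofReal_le_ofReal (hu k (k + 1) k (by omega) le_rfl).le
  have hgeom : ∀ N, ∑' k, sectionENorm n R d q (w (k + N)).1 ≤ ENNReal.ofReal (2 * (1 / 2) ^ N) := by
    intro N
    refine (ENNReal.tsum_le_tsum fun k => hwn (k + N)).trans (le_of_eq ?_)
    have hs : Summable fun k : ℕ => (1 / 2 : ℝ) ^ (k + N) :=
      (summable_nat_add_iff N).2 summable_geometric_two
    rw [← ENNReal.ofReal_tsum_of_nonneg (fun k => by positivity) hs]
    congr 1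
    simp_rw [pow_add]
    rw [tsum_mul_right, tsum_geometric_two]
  have hsum : ∑' k, sectionENorm n R d q (w k).1 ≠ ⊤ :=
    ((hgeom 0).trans_lt ENNReal.ofReal_lt_top).ne
  obtain ⟨v, hv, hvN⟩ := exists_sectionENorm_sub_sum_le hq (fun k => (w k).2.1) hsum
  have hvlt : sectionENorm n R d q v < ⊤ := by
    have h := hvN 0
    simp only [Finset.range_zero, Finset.sum_empty, sub_zero] at h
    exact h.trans_lt ((hgeom 0).trans_lt ENNReal.ofReal_lt_top)
  let V : LpSections n F E R d q hq := ⟨v, hv, hvlt⟩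
  refine ⟨V + u 0, tendsto_iff_dist_tendsto_zero.2 ?_⟩
  have hlim : Filter.Tendsto (fun N : ℕ => (2 : ℝ) * (1 / 2) ^ N) Filter.atTop (𝓝 0) := by
    simpa using (tendsto_pow_atTop_nhds_zero_of_lt_one (r := (1 / 2 : ℝ)) (by norm_num)
      (by norm_num)).const_mul 2
  refine squeeze_zero (fun N => dist_nonneg) (fun N => ?_) hlim
  have h1 : V + u 0 - u N = V - ∑ k ∈ Finset.range N, w k := by
    rw [Finset.sum_range_sub]
    abel
  have h2 : (V - ∑ k ∈ Finset.range N, w k : LpSections n F E R d q hq).1 =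
      v - ∑ k ∈ Finset.range N, (w k).1 := by
    have : ∀ N, (∑ k ∈ Finset.range N, w k : LpSections n F E R d q hq).1 =
        ∑ k ∈ Finset.range N, (w k).1 := fun N =>
      map_sum (lpSubmodule n F E R d q hq).subtype w _
    rw [← this]
    rfl
  rw [dist_comm, dist_eq_norm, h1, LpSections.norm_def, h2]
  exact ENNReal.toReal_le_of_le_ofReal (by positivity) ((hvN N).trans (hgeom N))

end Completeness

/-- A bounded linear operator into a Banach space is compact if, up to small multiples of the norm,
it is controlled by operators of finite rank. -/
lemma isCompactOperator_of_forall_exists_norm_le {V W F : Type*} [SeminormedAddCommGroup V]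
    [NormedSpace ℝ V] [NormedAddCommGroup W] [NormedSpace ℝ W] [CompleteSpace W]
    [NormedAddCommGroup F] [NormedSpace ℝ F] [FiniteDimensional ℝ F] (f : V →L[ℝ] W)
    (h : ∀ ε > 0, ∃ (ι : Type) (_ : Fintype ι) (T : V →L[ℝ] (ι → F)),
      ∀ v, ‖f v‖ ≤ ε * ‖v‖ + ∑ j, ‖T v j‖) : IsCompactOperator f := by
  refine ⟨closure (f '' Metric.closedBall 0 1), ?_, Filter.mem_of_superset
    (Metric.closedBall_mem_nhds 0 zero_lt_one)
    fun v hv => subset_closure (mem_image_of_mem f hv)⟩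
  refine TotallyBounded.isCompact_of_isClosed ?_ isClosed_closure
  refine TotallyBounded.closure (Metric.totallyBounded_iff.2 fun ε hε => ?_)
  -- Two vectors of the unit ball differ by at most 2, so this term costs ε/2; the finite-rank part
  -- will cost ε/4.
  obtain ⟨ι, _, T, hT⟩ := h (ε / 4) (by positivity)
  have hTb : TotallyBounded (T '' Metric.closedBall 0 1) := by
    have : ProperSpace (ι → F) := FiniteDimensional.proper ℝ _
    have hT := T.lipschitz.isBounded_image (Metric.isBounded_closedBall (x := 0) (r := 1))
    exact hT.isCompact_closure.totallyBounded.subset subset_closure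
  set δ := ε / (4 * (Fintype.card ι + 1)) with hδ
  have hδ0 : 0 < δ := by positivity
  obtain ⟨S, hS, hSf, hcov⟩ := totallyBounded_iff_subset.1 hTb _ (Metric.dist_mem_uniformity hδ0)
  -- The net for the image under T lifts to vectors of the unit ball, whose images under f form the
  -- required net.
  choose! g hg using fun y (hy : y ∈ S) => hS hy
  refine ⟨(fun y => f (g y)) '' S, hSf.image _, ?_⟩
  rintro _ ⟨v, hv, rfl⟩
  obtain ⟨y, hy, hvy⟩ := mem_iUnion₂.1 (hcov (mem_image_of_mem T hv))
  refine mem_iUnion₂.2 ⟨f (g y), mem_image_of_mem _ hy, ?_⟩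
  rw [Metric.mem_ball, dist_eq_norm, ← map_sub]
  have h1 : ‖T (v - g y)‖ ≤ δ := by
    rw [map_sub, (hg y hy).2, ← dist_eq_norm]
    exact le_of_lt hvy
  have h2 : ‖v - g y‖ ≤ 2 := by
    have h3 := mem_closedBall_zero_iff.1 hv
    have h4 := mem_closedBall_zero_iff.1 (hg y hy).1
    linarith [norm_sub_le v (g y)]
  have h5 : ∑ j, ‖T (v - g y) j‖ ≤ Fintype.card ι * δ := by
    refine (Finset.sum_le_card_nsmul _ _ δ fun j _ => ?_).trans (le_of_eq (by simp))
    exact (norm_le_pi_norm _ j).trans h1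
  have h6 : Fintype.card ι * δ ≤ ε / 4 := by
    have : Fintype.card ι * δ = ε / 4 * (Fintype.card ι / (Fintype.card ι + 1)) := by
      rw [hδ]; field_simp
    rw [this]
    exact mul_le_of_le_one_right (by positivity) ((div_le_one (by positivity)).2 (by linarith))
  calc ‖f (v - g y)‖ ≤ ε / 4 * ‖v - g y‖ + ∑ j, ‖T (v - g y) j‖ := hT _
    _ ≤ ε / 4 * 2 + ε / 4 := by gcongr; exact h5.trans h6
    _ < ε := by linarith

/-! ### The inclusion and its injectivity -/

section Embedding

variable {n : ℕ} {X : Type*} [EMetricSpace X] [CompactSpace X]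
  [ChartedSpace (EuclideanSpace ℝ (Fin n)) X]
  [IsManifold (𝓡 n) ∞ X] [RiemannianBundle (fun x : X => TangentSpace (𝓡 n) x)]
  [IsContMDiffRiemannianBundle (𝓡 n) ∞ (EuclideanSpace ℝ (Fin n))
    (fun x : X => TangentSpace (𝓡 n) x)]
  [MeasurableSpace X] [BorelSpace X]
  {F : Type*} [NormedAddCommGroup F] [NormedSpace ℝ F] [FiniteDimensional ℝ F]
  {E : X → Type*} [TopologicalSpace (TotalSpace F E)] [∀ x, NormedAddCommGroup (E x)]
  [∀ x, InnerProductSpace ℝ (E x)] [FiberBundle F E] [VectorBundle ℝ F E]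
  [ContMDiffVectorBundle ∞ F E (𝓡 n)] [IsContMDiffRiemannianBundle (𝓡 n) ∞ F E]
  {A : CovariantDerivative (𝓡 n) F E} {R d p q : ℝ}

local notation "φ[" x "]" => chartAt (EuclideanSpace ℝ (Fin n)) x

variable [IsRiemannianManifold (𝓡 n) X]

variable (A) in
/-- The inclusion of the spaces of representatives. -/
lemma exists_inclusion [CovariantDerivative.ContMDiffCovariantDerivative A ∞] (hR : 0 < R)
    (hp : 1 ≤ p) (hd : 0 < d) (hdn : d < n) (hq : 1 ≤ q) (hθ : 0 < 1 - d / p + d / q) :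
    ∃ J : SobolevSections A R d p hp →L[ℝ] LpSections n F E R d q hq, ∀ st, (J st).1 = st.1.1 := by
  -- Any ε would do here: only finiteness and boundedness are at stake.
  obtain ⟨ι, _, T, hT⟩ := exists_sectionENorm_le A hR hp hd hdn hq hθ zero_lt_one
  let J : SobolevSections A R d p hp →ₗ[ℝ] LpSections n F E R d q hq :=
    { toFun := fun st => ⟨st.1.1, st.2.1, (hT st).trans_lt ENNReal.ofReal_lt_top⟩
      map_add' := fun _ _ => rfl
      map_smul' := fun _ _ => rfl }
  refine ⟨J.mkContinuous (1 + Fintype.card ι * ‖T‖) fun st => ?_, fun st => rfl⟩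
  rw [LpSections.norm_def]
  refine ENNReal.toReal_le_of_le_ofReal (by positivity)
    ((hT st).trans (ENNReal.ofReal_le_ofReal ?_))
  rw [add_mul, mul_assoc]
  gcongr
  refine (Finset.sum_le_card_nsmul _ _ (‖T‖ * ‖st‖) fun j _ => ?_).trans (le_of_eq (by simp))
  exact (norm_le_pi_norm _ j).trans (T.le_opNorm st)

/-- The weak covariant derivative of a section that vanishes almost everywhere vanishes almost
everywhere. -/
lemma IsWeakCovDeriv.hsNorm_ae_eq_zero [CovariantDerivative.ContMDiffCovariantDerivative A ∞]
    {s : Π x : X, E x} {t : Π x : X, TangentSpace (𝓡 n) x →L[ℝ] E x} (h : IsWeakCovDeriv A s t)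
    (ht : AEMeasurableHomSection F t) (hs : ∀ᵐ x ∂(riemannianVolume n X), s x = 0) :
    ∀ᵐ x ∂(riemannianVolume n X), hsNorm (t x) = 0 := by
  have : CompleteSpace F := FiniteDimensional.complete ℝ F
  choose C a hball using exists_isComparisonBall (F := F) (E := E) A
  set W : X → Set X := fun x₀ => φ[x₀].symm '' Metric.ball (φ[x₀] x₀) (a x₀) with hW
  have hlocal : ∀ x₀, ∀ᵐ x ∂((riemannianVolume n X).restrict (W x₀)), hsNorm (t x) = 0 := by
    intro x₀
    have hb := hball x₀
    set B := Metric.ball (φ[x₀] x₀) (a x₀) with hB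
    have hBm : MeasurableSet B := Metric.isOpen_ball.measurableSet
    have hsymm := hb.aemeasurable_symm (n := n) subset_rfl
    have hac : (volume.restrict B).map φ[x₀].symm ≪ riemannianVolume n X :=
      (Measure.absolutelyContinuous_of_le (hb.map_volume_le B subset_rfl hBm)).trans
        Measure.smul_absolutelyContinuous
    have hs' : ∀ᵐ z ∂(volume.restrict B), s (φ[x₀].symm z) = 0 :=
      ae_of_ae_map hsymm (hac.ae_le hs)
    have hu : ∀ᵐ z ∂(volume.restrict B), sectionCoord n F s x₀ z = 0 :=
      hs'.mono fun z hz => by rw [sectionCoord, hz, fiberCoord_zero]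
    have hw := h.hasWeakPartials x₀ hb.subset
    have hg : ∀ i, ∀ᵐ z ∂(volume.restrict B),
        derivCoord A s t x₀ (EuclideanSpace.basisFun (Fin n) ℝ i) z = 0 := by
      intro i
      -- Fundamental lemma of the calculus of variations: the weak partial derivative integrates to
      -- zero against every test function.
      refine (ae_restrict_iff' hBm).2 (Metric.isOpen_ball.ae_eq_zero_of_integral_contDiff_smul_eq_zero
        (hw.locallyIntegrableOn i) fun η hη hηc hηB => ?_)
      have h1 := hw.integral_eq i η hη hηc hηB
      have h2 : ∫ z in B, (fderiv ℝ η z (EuclideanSpace.basisFun (Fin n) ℝ i)) •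
          sectionCoord n F s x₀ z = 0 :=
        integral_eq_zero_of_ae (hu.mono fun z hz => by simp [hz])
      rw [h2, eq_comm, neg_eq_zero] at h1
      rw [← h1, setIntegral_eq_integral_of_forall_compl_eq_zero]
      intro z hz
      rw [image_eq_zero_of_notMem_tsupport fun h => hz (hηB h), zero_smul]
    have ht0 : ∀ᵐ z ∂(volume.restrict B), hsNorm (t (φ[x₀].symm z)) = 0 := by
      -- Where u vanishes the connection term vanishes too, so the coordinate derivatives reduce to
      -- the components of t.
      filter_upwards [ae_all_iff.2 hg, hu, ae_restrict_mem hBm] with z hz huz hzB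
      have hzd := hb.subset hzB
      have h0 : constSection E x₀ (0 : F) = 0 := by ext x; simp [constSection]
      have h1 : ∀ i, t (φ[x₀].symm z) (coordField n x₀ (φ[x₀].symm z)
          (EuclideanSpace.basisFun (Fin n) ℝ i)) = 0 := by
        intro i
        have h2 := hz i
        simp only [derivCoord, huz, h0, CovariantDerivative.zero, Pi.zero_apply, zero_apply,
          fiberCoord_zero, sub_zero] at h2
        rw [← constSection_fiberCoord (F := F) x₀ hzd.2 (t _ _), h2, h0, Pi.zero_apply]
      refine pow_eq_zero_iff (two_ne_zero) |>.1 ?_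
      rw [hsNorm_sq_eq_metricMatrix x₀ (φ[x₀].map_target hzd.1)]
      exact Finset.sum_eq_zero fun i _ => Finset.sum_eq_zero fun j _ => by
        rw [h1 i, inner_zero_left, mul_zero]
    -- The conclusion is carried from the chart to X through the integral of |t|, using that the
    -- volume there is at most a multiple of the image of Lebesgue measure.
    have hmeas := ht.aemeasurable_hsNorm
    have hint := setLIntegral_le_of_le_map hsymm (hb.restrict_volume_le B subset_rfl hBm)
      (hmeas.mono_ac hac) MeasurableSet.univ (B := univ) MeasurableSet.univ (by simp)
    have h3 : ∫⁻ z in univ, ENNReal.ofReal (hsNorm (t (φ[x₀].symm z))) ∂(volume.restrict B) = 0 := by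
      rw [Measure.restrict_univ]
      refine (lintegral_congr_ae (ht0.mono fun z hz => ?_)).trans lintegral_zero
      simp [hz]
    rw [h3, mul_zero, nonpos_iff_eq_zero, Measure.restrict_univ,
      lintegral_eq_zero_iff' hmeas.restrict] at hint
    filter_upwards [hint] with x hx
    exact le_antisymm (ENNReal.ofReal_eq_zero.1 hx) (hsNorm_nonneg _)
  have hWo : ∀ x₀, IsOpen (W x₀) := fun x₀ =>
    φ[x₀].isOpen_image_symm_of_subset_target Metric.isOpen_ball fun z hz =>
      ((hball x₀).subset hz).1
  obtain ⟨f, hf⟩ := isCompact_univ.elim_finite_subcover W hWo (fun x _ => mem_iUnion.2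
    ⟨x, φ[x] x, Metric.mem_ball_self (hball x).pos, φ[x].left_inv (mem_chart_source _ _)⟩)
  have hall := (ae_restrict_biUnion_finset_iff W f _).2 fun x₀ _ => hlocal x₀
  rwa [univ_subset_iff.1 hf, Measure.restrict_univ] at hall

/-- The Sobolev norm also sees the derivative t of the pair, so injectivity of the inclusion rests
on `IsWeakCovDeriv.hsNorm_ae_eq_zero`. -/
lemma SobolevSections.norm_eq_zero_of_sectionENorm_eq_zero
    [CovariantDerivative.ContMDiffCovariantDerivative A ∞] {hp : 1 ≤ p} (hq : 0 < q)
    (st : SobolevSections A R d p hp) (h : sectionENorm n R d q st.1.1 = 0) : ‖st‖ = 0 := by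
  have hp0 : 0 < p := zero_lt_one.trans_le hp
  have h1 := lintegral_rpow_le_morreyENorm (n := n) (R := R) (d := d) hq (fun x => ‖st.1.1 x‖ₑ)
  rw [show morreyENorm n R d q (fun x => ‖st.1.1 x‖ₑ) = 0 from h, ENNReal.zero_rpow_of_pos hq,
    nonpos_iff_eq_zero, lintegral_eq_zero_iff' (st.2.1.aemeasurable_enorm.pow_const q)] at h1
  have hs : ∀ᵐ x ∂(riemannianVolume n X), st.1.1 x = 0 := h1.mono fun x hx => by
    simpa [hq, hq.le, not_lt.2 hq.le] using hx
  have ht := st.2.2.2.1.hsNorm_ae_eq_zero st.2.2.1 hs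
  have hs0 : sectionENorm n R d p st.1.1 = 0 := by
    refine nonpos_iff_eq_zero.1 ((morreyENorm_mono_ae hp0.le ?_).trans (morreyENorm_zero hp0).le)
    exact hs.mono fun x hx => by simp [hx]
  have ht0 : homSectionENorm R d p st.1.2 = 0 := by
    refine nonpos_iff_eq_zero.1 ((morreyENorm_mono_ae hp0.le ?_).trans (morreyENorm_zero hp0).le)
    exact ht.mono fun x hx => by simp [hx]
  rw [SobolevSections.norm_def, sobolevENorm, hs0, ht0]
  simp [hp0]

end Embedding

end Morrey

end

/-! ### The compact embedding -/

theorem lemmaA4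
    -- a compact Riemannian manifold `X` of dimension `n`, without boundary
    {n : ℕ} {X : Type*} [EMetricSpace X] [CompactSpace X]
    [ChartedSpace (EuclideanSpace ℝ (Fin n)) X] [IsManifold (𝓡 n) ∞ X]
    [RiemannianBundle (fun x : X => TangentSpace (𝓡 n) x)]
    [IsContMDiffRiemannianBundle (𝓡 n) ∞ (EuclideanSpace ℝ (Fin n))
      (fun x : X => TangentSpace (𝓡 n) x)]
    [IsRiemannianManifold (𝓡 n) X] [MeasurableSpace X] [BorelSpace X]
    -- a smooth Euclidean vector bundle `E` over `X`
    {F : Type*} [NormedAddCommGroup F] [NormedSpace ℝ F] [FiniteDimensional ℝ F]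
    {E : X → Type*} [TopologicalSpace (TotalSpace F E)] [∀ x, NormedAddCommGroup (E x)]
    [∀ x, InnerProductSpace ℝ (E x)] [FiberBundle F E] [VectorBundle ℝ F E]
    [ContMDiffVectorBundle ∞ F E (𝓡 n)] [IsContMDiffRiemannianBundle (𝓡 n) ∞ F E]
    -- a smooth connection `A` on `E`
    (A : CovariantDerivative (𝓡 n) F E) [CovariantDerivative.ContMDiffCovariantDerivative A ∞]
    -- the bound on the radii in the Morrey norms, and the exponents
    (R : ℝ) (hR : 0 < R) (d p pstar q : ℝ) (hd : 0 < d) (hdn : d < n) (hp : 1 < p) (hpd : p < d)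
    (hpstar : 1 / pstar = 1 / p - 1 / d) (hq : 1 ≤ q) (hqp : q < pstar) :
    ∃ ι : Morrey.MorreySobolev A R d p hp.le →L[ℝ] Morrey.MorreyLp n F E R d q hq,
      -- `ι` is the inclusion: it maps the class of `s` to the class of `s`
      (∀ (s : Π x : X, E x) (t : Π x : X, TangentSpace (𝓡 n) x →L[ℝ] E x)
        (h : (s, t) ∈ Morrey.sobolevSubmodule A R d p hp.le),
        ∃ h' : s ∈ Morrey.lpSubmodule n F E R d q hq,
          ι (Morrey.MorreySobolev.mk R d hp.le s t h) = Morrey.MorreyLp.mk R d hq s h') ∧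
      Function.Injective ι ∧ IsCompactOperator ι := by
  have hp1 : 1 ≤ p := hp.le
  have hp0 : 0 < p := zero_lt_one.trans hp
  have hq0 : 0 < q := zero_lt_one.trans_le hq
  -- This quantity is d (1/q - 1/p*), and p* > 0 because 1 ≤ q < p*.
  have hθ : 0 < 1 - d / p + d / q := by
    have h1 : 0 < pstar := hq0.trans hqp
    have h2 : 1 / pstar < 1 / q := one_div_lt_one_div_of_lt hq0 hqp
    rw [hpstar] at h2
    have h3 : d * (1 / p - 1 / d) < d * (1 / q) := by gcongr
    have h4 : d * (1 / p - 1 / d) = d / p - 1 := by field_simp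
    have h5 : d * (1 / q) = d / q := by ring
    linarith
  obtain ⟨J, hJ⟩ := Morrey.exists_inclusion (R := R) A hR hp1 hd hdn hq hθ
  set f : Morrey.SobolevSections A R d p hp.le →L[ℝ] Morrey.MorreyLp n F E R d q hq :=
    (SeparationQuotient.mkCLM ℝ (Morrey.LpSections n F E R d q hq)).comp J with hf
  have hfJ : ∀ st, f st = Morrey.MorreyLp.mk R d hq st.1.1 (hJ st ▸ (J st).2) := by
    intro st
    change SeparationQuotient.mk (J st) = SeparationQuotient.mk _
    congr 1
    exact Subtype.ext (hJ st)
  have hfnorm : ∀ st, ‖f st‖ = (Morrey.sectionENorm n R d q st.1.1).toReal := fun st => by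
    rw [hfJ, Morrey.MorreyLp.norm_mk]
  -- Inseparable pairs have inseparable images under the continuous map f, and these coincide in the
  -- Hausdorff quotient.
  set ι : Morrey.MorreySobolev A R d p hp.le →L[ℝ] Morrey.MorreyLp n F E R d q hq :=
    SeparationQuotient.liftCLM f fun x y hxy => (hxy.map f.continuous).eq with hι
  have hιmk : ∀ st, ι (SeparationQuotient.mk st) = f st := fun st => rfl
  refine ⟨ι, fun s t h => ⟨_, hfJ ⟨(s, t), h⟩⟩, ?_, ?_⟩
  · refine (injective_iff_map_eq_zero ι).2 fun x hx => ?_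
    obtain ⟨st, rfl⟩ := SeparationQuotient.surjective_mk x
    rw [hιmk, ← norm_eq_zero, hfnorm, ENNReal.toReal_eq_zero_iff] at hx
    have hfin : Morrey.sectionENorm n R d q st.1.1 ≠ ⊤ := by
      rw [← hJ st]
      exact (J st).2.2.ne
    rw [← norm_eq_zero, SeparationQuotient.norm_mk]
    exact st.norm_eq_zero_of_sectionENorm_eq_zero hq0 (hx.resolve_right hfin)
  · have hcomp : IsCompactOperator f := by
      refine Morrey.isCompactOperator_of_forall_exists_norm_le (F := F) f fun ε hε => ?_
      obtain ⟨κ, hκ, T, hT⟩ := Morrey.exists_sectionENorm_le (R := R) A hR hp1 hd hdn hq hθ hε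
      refine ⟨κ, hκ, T, fun st => ?_⟩
      rw [hfnorm]
      exact ENNReal.toReal_le_of_le_ofReal (by positivity) (hT st)
    obtain ⟨K, hK, hKf⟩ := hcomp
    refine ⟨K, hK, ?_⟩
    have h0 : (0 : Morrey.MorreySobolev A R d p hp.le) = SeparationQuotient.mk 0 := rfl
    -- Neighborhoods of zero in the quotient are detected on representatives, so the compact set
    -- found for f also serves ι.
    rw [h0, ← SeparationQuotient.map_mk_nhds, Filter.mem_map]
    exact hKf
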